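/- Let $n\ge 2$ and let $\Omega\subset\mathbb{R}^n$ be a bounded domain with Lipschitz boundary. Let $0<\nu<1<p<n$ and $p<q<\kappa_i+1$ $(i=1,2)$ with $\kappa_1+\kappa_2+2<p^*:=\frac{np}{n-p}$. Let $\eta,a_1,a_2\in L^\infty(\Omega)$ with $\eta\ge 0$ and $a_1,a_2>0$ a.e. in $\Omega$. Consider, for $\lambda>0$, the double phase system $$\begin{cases}-\operatorname{div}\big(|\nabla y_1|^{p-2}\nabla y_1+\eta|\nabla y_1|^{q-2}\nabla y_1\big)=a_1|y_1|^{-1-\nu}y_1+\lambda(\kappa_1+1)|y_1|^{\kappa_1-1}y_1|y_2|^{\kappa_2+1}&\text{in }\Omega,\\-\operatorname{div}\big(|\nabla y_2|^{p-2}\nabla y_2+\eta|\nabla y_2|^{q-2}\nabla y_2\big)=a_2|y_2|^{-1-\nu}y_2+\lambda(\kappa_2+1)|y_1|^{\kappa_1+1}|y_2|^{\kappa_2-1}y_2&\text{in }\Omega,\\ y_1=y_2=0&\text{on }\partial\Omega,\end{cases}$$ where $|\cdot|$ is the Euclidean norm. For measurable $u$ put $\rho_{\mathcal H}(u)=\int_\Omega(|u|^p+\eta|u|^q)\,dz$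 and $\|u\|_{\mathcal H}=\inf\{\tau>0:\rho_{\mathcal H}(u/\tau)\le 1\}$. Let $L^{\mathcal H}(\Omega)=\{u:\rho_{\mathcal H}(u)<\infty\}$, let $W^{1,\mathcal H}(\Omega)$ be the space of weakly differentiable $y\in L^{\mathcal H}(\Omega)$ with $|\nabla y|\in L^{\mathcal H}(\Omega)$, normed by $\|\,|\nabla y|\,\|_{\mathcal H}+\|y\|_{\mathcal H}$, and let $W=W_0^{1,\mathcal H}(\Omega)$ be the closure of $C_0^\infty(\Omega)$ in it. On $W\times W$ let $$J(y_1,y_2)=\int_\Omega\Big[\tfrac1p\big(|\nabla y_1|^p+|\nabla y_2|^p\big)+\tfrac{\eta}{q}\big(|\nabla y_1|^q+|\nabla y_2|^q\big)-\tfrac{1}{1-\nu}\big(a_1|y_1|^{1-\nu}+a_2|y_2|^{1-\nu}\big)-\lambda|y_1|^{\kappa_1+1}|y_2|^{\kappa_2+1}\Big]dz .$$ Let $\mathcal N_\lambda$ be the set of $(y_1,y_2)\in (W\times W)\setminus\{(0,0)\}$ with $\langle J'(y_1,y_2),(y_1,y_2)\rangle=0$, that is, $$\int_\Omega\sum_{i=1}^2\big(|\nabla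 y_i|^p+\eta|\nabla y_i|^q-a_i|y_i|^{1-\nu}\big)\,dz=\lambda(\kappa_1+\kappa_2+2)\int_\Omega|y_1|^{\kappa_1+1}|y_2|^{\kappa_2+1}\,dz ,$$ and let $\mathcal N_\lambda^-$ be the set of $(y_1,y_2)\in\mathcal N_\lambda$ with $\psi''(1)<0$, where $\psi(t)=J(ty_1,ty_2)$. Then there is $\lambda^*>0$ such that, for every $\lambda\in(0,\lambda^*)$, the functional $J$ attains its minimum over $\mathcal N_\lambda^-$ at some $(y_{1*},y_{2*})$ with $y_{1*},y_{2*}\ge 0$ a.e., and every such minimizer $(y_{1*},y_{2*})$ with a.e. nonnegative components is a positive weak solution of the system with $J(y_{1*},y_{2*})\ge 0$. That is, $y_{1*}>0$ and $y_{2*}>0$ a.e. in $\Omega$, and for all $(h,w)\in W\times W$ the functions $a_1y_{1*}^{-\nu}h$ and $a_2y_{2*}^{-\nu}w$ are integrable on $\Omega$ and $$\begin{aligned}&\int_\Omega\big(|\nabla y_{1*}|^{p-2}+\eta|\nabla y_{1*}|^{q-2}\big)\nabla y_{1*}\cdot\nabla h\,dz-\int_\Omega a_1y_{1*}^{-\nu}h\,dz-\lambda(\kappa_1+1)\int_\Omega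 y_{1*}^{\kappa_1}y_{2*}^{\kappa_2+1}h\,dz\\&+\int_\Omega\big(|\nabla y_{2*}|^{p-2}+\eta|\nabla y_{2*}|^{q-2}\big)\nabla y_{2*}\cdot\nabla w\,dz-\int_\Omega a_2y_{2*}^{-\nu}w\,dz-\lambda(\kappa_2+1)\int_\Omega y_{1*}^{\kappa_1+1}y_{2*}^{\kappa_2}w\,dz=0.\end{aligned}$$ -/

import Mathlib

open MeasureTheory Filter Topology Set
open scoped ContDiff ENNReal

noncomputable section

namespace DoublePhase

/-- The boundary of `Ω` is locally the graph of a Lipschitz function with `Ω` lying on one side of it: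
near each boundary point there are a unit vector `v` and a Lipschitz function `γ` of the component
`x - ⟪v, x⟫ v` of `x` orthogonal to `v` such that `Ω` is the region `⟪v, x⟫ > γ`. -/
def HasLipschitzBoundary {n : ℕ} (Ω : Set (EuclideanSpace ℝ (Fin n))) : Prop :=
  ∀ x₀ ∈ frontier Ω, ∃ (v : EuclideanSpace ℝ (Fin n)) (r : ℝ) (K : NNReal)
    (γ : EuclideanSpace ℝ (Fin n) → ℝ), ‖v‖ = 1 ∧ 0 < r ∧ LipschitzWith K γ ∧
      ∀ x ∈ Metric.ball x₀ r, x ∈ Ω ↔ γ (x - inner ℝ v x • v) < inner ℝ v x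

/-- The critical Sobolev exponent `p* = np / (n - p)` (used for `p < n`). -/
def critExp (n : ℕ) (p : ℝ) : ℝ := n * p / (n - p)

/-- The data of the two-component double phase system: the domain, the exponents `p, q, ν, κ₁, κ₂`,
the weight `η` and the coefficients `a₁, a₂`. Only the values of the functions on `Ω` matter, and
functions are identified when they agree almost everywhere on `Ω`. -/
structure Data (n : ℕ) where
  Ω : Set (EuclideanSpace ℝ (Fin n))
  p : ℝ
  q : ℝ
  ν : ℝ
  κ₁ : ℝ
  κ₂ : ℝ
  η : EuclideanSpace ℝ (Fin n) → ℝ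
  a₁ : EuclideanSpace ℝ (Fin n) → ℝ
  a₂ : EuclideanSpace ℝ (Fin n) → ℝ

/-- `φ ∈ C_0^∞(Ω)`: smooth with compact support contained in `Ω`. -/
def IsTestFunction {n : ℕ} (Ω : Set (EuclideanSpace ℝ (Fin n)))
    (φ : EuclideanSpace ℝ (Fin n) → ℝ) : Prop :=
  ContDiff ℝ ∞ φ ∧ HasCompactSupport φ ∧ tsupport φ ⊆ Ω

/-- `g` is a weak (distributional) gradient of `y` in `Ω`. -/
def IsWeakGradient {n : ℕ} (Ω : Set (EuclideanSpace ℝ (Fin n)))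
    (y : EuclideanSpace ℝ (Fin n) → ℝ)
    (g : EuclideanSpace ℝ (Fin n) → EuclideanSpace ℝ (Fin n)) : Prop :=
  LocallyIntegrableOn y Ω ∧ LocallyIntegrableOn g Ω ∧
    ∀ φ : EuclideanSpace ℝ (Fin n) → ℝ, IsTestFunction Ω φ → ∀ v : EuclideanSpace ℝ (Fin n),
      ∫ x in Ω, y x * fderiv ℝ φ x v = -∫ x in Ω, inner ℝ (g x) v * φ x

open Classical in
/-- The weak gradient of `y` in `Ω`, unique up to null sets where it exists (and `0` otherwise). -/
def weakGrad {n : ℕ} (Ω : Set (EuclideanSpace ℝ (Fin n))) (y : EuclideanSpace ℝ (Fin n) → ℝ) :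
    EuclideanSpace ℝ (Fin n) → EuclideanSpace ℝ (Fin n) :=
  if h : ∃ g, IsWeakGradient Ω y g then h.choose else 0

namespace Data

variable {n : ℕ} (P : Data n)

/-- Lebesgue measure on `Ω`. -/
def μ : Measure (EuclideanSpace ℝ (Fin n)) := volume.restrict P.Ω

/-- The modular `ρ_H(u) = ∫_Ω (|u|^p + η |u|^q)`, as an extended nonnegative number. -/
def modular (u : EuclideanSpace ℝ (Fin n) → ℝ) : ℝ≥0∞ :=
  ∫⁻ x, ENNReal.ofReal (|u x| ^ P.p + P.η x * |u x| ^ P.q) ∂P.μ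

/-- The Musielak-Orlicz space `L^H(Ω)`. -/
def MemLH (u : EuclideanSpace ℝ (Fin n) → ℝ) : Prop :=
  AEStronglyMeasurable u P.μ ∧ P.modular u < ⊤

/-- The Luxemburg norm of `L^H(Ω)`. -/
def luxNorm (u : EuclideanSpace ℝ (Fin n) → ℝ) : ℝ :=
  sInf {τ : ℝ | 0 < τ ∧ P.modular (fun x => u x / τ) ≤ 1}

/-- The Musielak-Orlicz Sobolev space `W^{1,H}(Ω)`. -/
def MemW1H (y : EuclideanSpace ℝ (Fin n) → ℝ) : Prop :=
  P.MemLH y ∧ (∃ g, IsWeakGradient P.Ω y g) ∧ P.MemLH (fun x => ‖weakGrad P.Ω y x‖)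

/-- The norm `‖y‖_{1,H} = ‖∇y‖_H + ‖y‖_H` of `W^{1,H}(Ω)`. -/
def normW1H (y : EuclideanSpace ℝ (Fin n) → ℝ) : ℝ :=
  P.luxNorm (fun x => ‖weakGrad P.Ω y x‖) + P.luxNorm y

/-- `W_0^{1,H}(Ω)`, the closure of `C_0^∞(Ω)` in `W^{1,H}(Ω)`. -/
def MemW01H (y : EuclideanSpace ℝ (Fin n) → ℝ) : Prop :=
  P.MemW1H y ∧ ∃ φ : ℕ → EuclideanSpace ℝ (Fin n) → ℝ,
    (∀ k, IsTestFunction P.Ω (φ k)) ∧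
      Tendsto (fun k => P.normW1H (fun x => y x - φ k x)) atTop (𝓝 0)

/-- The energy functional `J` with parameter `lam`. -/
def J (lam : ℝ) (y : (EuclideanSpace ℝ (Fin n) → ℝ) × (EuclideanSpace ℝ (Fin n) → ℝ)) : ℝ :=
  1 / P.p * ((∫ x, ‖weakGrad P.Ω y.1 x‖ ^ P.p ∂P.μ) + ∫ x, ‖weakGrad P.Ω y.2 x‖ ^ P.p ∂P.μ)
  + 1 / P.q * ((∫ x, P.η x * ‖weakGrad P.Ω y.1 x‖ ^ P.q ∂P.μ)
      + ∫ x, P.η x * ‖weakGrad P.Ω y.2 x‖ ^ P.q ∂P.μ)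
  - 1 / (1 - P.ν) *
      ∫ x, (P.a₁ x * |y.1 x| ^ (1 - P.ν) + P.a₂ x * |y.2 x| ^ (1 - P.ν)) ∂P.μ
  - lam * ∫ x, |y.1 x| ^ (P.κ₁ + 1) * |y.2 x| ^ (P.κ₂ + 1) ∂P.μ

/-- The pairing `∫_Ω |∇y|^{p-2} ∇y · ∇h + ∫_Ω η |∇y|^{q-2} ∇y · ∇h` of the double phase operator. -/
def opPairing (y h : EuclideanSpace ℝ (Fin n) → ℝ) : ℝ :=
  (∫ x, ‖weakGrad P.Ω y x‖ ^ (P.p - 2) * inner ℝ (weakGrad P.Ω y x) (weakGrad P.Ω h x) ∂P.μ)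
  + ∫ x, P.η x * ‖weakGrad P.Ω y x‖ ^ (P.q - 2) *
      inner ℝ (weakGrad P.Ω y x) (weakGrad P.Ω h x) ∂P.μ

/-- The pairing `⟨J'(y₁, y₂), (h, w)⟩`. -/
def dJ (lam : ℝ) (y h : (EuclideanSpace ℝ (Fin n) → ℝ) × (EuclideanSpace ℝ (Fin n) → ℝ)) : ℝ :=
  P.opPairing y.1 h.1
  - (∫ x, P.a₁ x * |y.1 x| ^ (-1 - P.ν) * y.1 x * h.1 x ∂P.μ)
  - lam * (P.κ₁ + 1) *
      (∫ x, |y.1 x| ^ (P.κ₁ - 1) * y.1 x * |y.2 x| ^ (P.κ₂ + 1) * h.1 x ∂P.μ)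
  + P.opPairing y.2 h.2
  - (∫ x, P.a₂ x * |y.2 x| ^ (-1 - P.ν) * y.2 x * h.2 x ∂P.μ)
  - lam * (P.κ₂ + 1) *
      ∫ x, |y.1 x| ^ (P.κ₁ + 1) * |y.2 x| ^ (P.κ₂ - 1) * y.2 x * h.2 x ∂P.μ

/-- The Nehari manifold `N_lam`. -/
def nehari (lam : ℝ) : Set ((EuclideanSpace ℝ (Fin n) → ℝ) × (EuclideanSpace ℝ (Fin n) → ℝ)) :=
  {y | P.MemW01H y.1 ∧ P.MemW01H y.2 ∧ ¬ (y.1 =ᵐ[P.μ] 0 ∧ y.2 =ᵐ[P.μ] 0) ∧ P.dJ lam y y = 0}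

/-- The fibering map `ψ_{(y₁, y₂)}(t) = J(t y₁, t y₂)`. -/
def fiber (lam : ℝ) (y : (EuclideanSpace ℝ (Fin n) → ℝ) × (EuclideanSpace ℝ (Fin n) → ℝ))
    (t : ℝ) : ℝ := P.J lam (t • y)

/-- `N_lam^-`, the part of the Nehari manifold where `ψ''(1) < 0`. -/
def nehariMinus (lam : ℝ) :
    Set ((EuclideanSpace ℝ (Fin n) → ℝ) × (EuclideanSpace ℝ (Fin n) → ℝ)) :=
  {y | y ∈ P.nehari lam ∧ iteratedDeriv 2 (P.fiber lam y) 1 < 0}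

/-- `y` minimizes `J` over `N_lam^-` and has nonnegative components. -/
def IsNonnegMinimizer (lam : ℝ)
    (y : (EuclideanSpace ℝ (Fin n) → ℝ) × (EuclideanSpace ℝ (Fin n) → ℝ)) : Prop :=
  y ∈ P.nehariMinus lam ∧ IsMinOn (P.J lam) (P.nehariMinus lam) y ∧
    (∀ᵐ x ∂P.μ, 0 ≤ y.1 x) ∧ ∀ᵐ x ∂P.μ, 0 ≤ y.2 x

/-- `y = (y₁, y₂)` is a positive weak solution of the system in `W_0^{1,H}(Ω) × W_0^{1,H}(Ω)`. -/
def IsPositiveWeakSolution (lam : ℝ)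
    (y : (EuclideanSpace ℝ (Fin n) → ℝ) × (EuclideanSpace ℝ (Fin n) → ℝ)) : Prop :=
  P.MemW01H y.1 ∧ P.MemW01H y.2 ∧ (∀ᵐ x ∂P.μ, 0 < y.1 x) ∧ (∀ᵐ x ∂P.μ, 0 < y.2 x) ∧
  ∀ h w : EuclideanSpace ℝ (Fin n) → ℝ, P.MemW01H h → P.MemW01H w →
    Integrable (fun x => P.a₁ x * y.1 x ^ (-P.ν) * h x) P.μ ∧
    Integrable (fun x => P.a₂ x * y.2 x ^ (-P.ν) * w x) P.μ ∧
    P.opPairing y.1 h - (∫ x, P.a₁ x * y.1 x ^ (-P.ν) * h x ∂P.μ)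
    + P.opPairing y.2 w - (∫ x, P.a₂ x * y.2 x ^ (-P.ν) * w x ∂P.μ)
    - lam * (P.κ₁ + 1) * (∫ x, |y.1 x| ^ P.κ₁ * |y.2 x| ^ (P.κ₂ + 1) * h x ∂P.μ)
    - lam * (P.κ₂ + 1) * (∫ x, |y.1 x| ^ (P.κ₁ + 1) * |y.2 x| ^ P.κ₂ * w x ∂P.μ) = 0

end Data

end DoublePhase

end

/-!
Membership of `y = (y₁, y₂)` in `W × W` is expressed by `IsPair y g`: each component together with
its gradient is a limit of test functions in `L¹ × (L^p(μ) ∩ L^q(η μ))` (`IsW0`). The closure in the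
Luxemburg norm gives the same space, with `g` the weak gradient (`IsW0.memW01H`, `MemW01H.isW0`).

*Fibering maps.* The map `ψ(t) = J(t y)` depends only on the four numbers
`A = ∫|∇y|^p`, `B = ∫η|∇y|^q`, `C = ∫a|y|^{1-ν}`, `D = ∫|y₁|^{κ₁+1}|y₂|^{κ₂+1}`, and `y ∈ N⁻` means
`FibMinus` for these numbers (`mem_nehariMinus_iff`). One has `t^ν ψ'(t) = m(t) - C` where `m` is
first increasing and then decreasing, because `p < q < k = κ₁ + κ₂ + 2`. Sobolev's inequality gives
`C ≤ c A^{(1-ν)/p}` and `D ≤ S A^{k/p}`, so for `λ` below a threshold independent of `y` both `ψ` and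
`ψ'` are positive somewhere (`exists_lamStar`). Then `ψ` has a positive global maximum over `(0, ∞)`
at `1` whenever `y ∈ N⁻` (`fib_le_fib_one`), and every `y` with `D > 0` has a dilation in `N⁻`
(`exists_fibMinus_scale`). In particular `J > 0` on `N⁻`.

*Existence.* On `N⁻` the functional `J` is coercive (`exists_energy_bound`) and `D` is bounded below
by a positive constant (`exists_coupling_lower_bound`). By Rellich–Kondrachov
(`exists_subseq_tendsto`) a minimizing sequence `uⱼ` has a subsequence along which `C` and `D`
converge to their values at some `y` with `D(y) > 0`, and
`A`, `B` are lower semicontinuous (`exists_isW0_of_tendsto`). With `t|y| ∈ N⁻`,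
`J(t|y|) ≤ lim J(t uⱼ) ≤ lim J(uⱼ) = inf J`, the second inequality because fibering maps are maximal
at `1`. Lower semicontinuity is obtained without weak topologies: among the elements of `W_0`
that are `L¹`-close to `y`, those almost minimizing the energy have Cauchy gradients by uniform
convexity of `L^p` and `L^q` (`exists_isW0_energy_le`). Since passing to `√(φ² + δ²) - δ` does not
increase gradients, this also shows that `W_0` is stable under absolute values (`IsW0.abs`).

*The equation.* Let `y ≥ 0` minimize `J` over `N⁻`. For any direction `d` and small `s > 0` there is
`t` close to `1` with `t(y + s d) ∈ N⁻`, by the implicit function argument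
`FibMinus.exists_scale_of_tendsto`. Comparing `J(t y) ≤ J(y) ≤ J(t(y + s d))` bounds the difference
quotient of the singular term `C` from above by a quantity converging to the derivative of the other
terms (`exists_seq_sumS_le`). For `d ≥ 0` Fatou's lemma turns this into `y > 0` where `d > 0` and
integrability of `a y^{-ν} d` (`pos_and_integrable_of_singular_le`). Once these hold, `C` is
differentiable in every direction at `y` (`tendsto_singular_slope`), and the inequality
for `d` and for `-d` is the weak formulation (`isPositiveWeakSolution`).
-/

/-! ### Fibering maps -/

namespace DoublePhase

/-- The fibering map `t ↦ J(t y)` in terms of the numbers `A = ∫|∇y|^p`, `B = ∫η|∇y|^q`,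
`C = ∫ a|y|^{1-ν}`, `D = ∫|y₁|^{κ₁+1}|y₂|^{κ₂+1}`, with `k = κ₁ + κ₂ + 2`. -/
noncomputable def fib (p q ν k lam A B C D t : ℝ) : ℝ :=
  t ^ p / p * A + t ^ q / q * B - t ^ (1 - ν) / (1 - ν) * C - lam * t ^ k * D

/-- `fib' = t ^ (-ν) * (reduced - C)`: the derivative of the fibering map without its singular
part. -/
noncomputable def reduced (p q ν k lam A B D t : ℝ) : ℝ :=
  t ^ (p - 1 + ν) * A + t ^ (q - 1 + ν) * B - lam * k * t ^ (k - 1 + ν) * D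

/-- `reduced' = t ^ (q - 2 + ν) * slope`. -/
noncomputable def slope (p q ν k lam A B D t : ℝ) : ℝ :=
  (p - 1 + ν) * A * t ^ (p - q) + (q - 1 + ν) * B - lam * k * (k - 1 + ν) * D * t ^ (k - q)

/-- The conditions `ψ'(1) = 0` and `ψ''(1) < 0` for the fibering map `ψ`, where `C` has been
eliminated from the second one. -/
def FibMinus (p q ν k lam A B C D : ℝ) : Prop :=
  A + B - C - lam * k * D = 0 ∧
    (p - 1 + ν) * A + (q - 1 + ν) * B - lam * k * (k - 1 + ν) * D < 0

section Fibering

variable {p q ν k lam A B C D : ℝ}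

lemma hasDerivAt_fib (hp : p ≠ 0) (hq : q ≠ 0) (hν : 1 - ν ≠ 0) {t : ℝ} (ht : 0 < t) :
    HasDerivAt (fib p q ν k lam A B C D)
      (t ^ (-ν) * (reduced p q ν k lam A B D t - C)) t := by
  have h (r : ℝ) : HasDerivAt (fun t : ℝ => t ^ r) (r * t ^ (r - 1)) t :=
    Real.hasDerivAt_rpow_const (Or.inl ht.ne')
  have e (r : ℝ) : t ^ (-ν) * t ^ (r - 1 + ν) = t ^ (r - 1) := by
    rw [← Real.rpow_add ht]; ring_nf
  have e0 : t ^ (1 - ν - 1) = t ^ (-ν) := by ring_nf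
  have H := (((((h p).div_const p).mul_const A).add (((h q).div_const q).mul_const B)).sub
    (((h (1 - ν)).div_const (1 - ν)).mul_const C)).sub (((h k).const_mul lam).mul_const D)
  refine H.congr_deriv ?_
  unfold reduced
  rw [e0, mul_div_cancel_left₀ _ hp, mul_div_cancel_left₀ _ hq, mul_div_cancel_left₀ _ hν,
    ← e p, ← e q, ← e k]
  ring

lemma hasDerivAt_reduced {t : ℝ} (ht : 0 < t) :
    HasDerivAt (reduced p q ν k lam A B D) (t ^ (q - 2 + ν) * slope p q ν k lam A B D t) t := by
  have h (r : ℝ) : HasDerivAt (fun t : ℝ => t ^ r) (r * t ^ (r - 1)) t :=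
    Real.hasDerivAt_rpow_const (Or.inl ht.ne')
  have H := (((h (p - 1 + ν)).mul_const A).add ((h (q - 1 + ν)).mul_const B)).sub
    (((h (k - 1 + ν)).const_mul (lam * k)).mul_const D)
  refine H.congr_deriv ?_
  have e (r : ℝ) : t ^ (q - 2 + ν) * t ^ (r - q) = t ^ (r - 1 + ν - 1) := by
    rw [← Real.rpow_add ht]; ring_nf
  have e0 : t ^ (q - 2 + ν) = t ^ (q - 1 + ν - 1) := by ring_nf
  unfold slope
  symm
  rw [← e p, ← e k, ← e0]; ring

/-- The standing relations between the exponents. -/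
structure Exponents (p q ν k : ℝ) : Prop where
  ν_pos : 0 < ν
  ν_lt : ν < 1
  p_gt : 1 < p
  p_lt : p < q
  q_lt : q < k

variable (E : Exponents p q ν k)
include E

/-- Here the order `p < q < k` of the exponents enters: the coefficient of the decreasing power
`t ^ (p - q)` is nonnegative, that of the increasing power `t ^ (k - q)` is nonpositive. -/
lemma slope_antitone (hlam : 0 < lam) (hA : 0 ≤ A) (hD : 0 ≤ D) {s t : ℝ} (hs : 0 < s)
    (hst : s ≤ t) : slope p q ν k lam A B D t ≤ slope p q ν k lam A B D s := by
  obtain ⟨h1, h2, h3, h4, h5⟩ := E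
  unfold slope
  have e1 : t ^ (p - q) ≤ s ^ (p - q) := Real.rpow_le_rpow_of_nonpos hs hst (by linarith)
  have e2 : s ^ (k - q) ≤ t ^ (k - q) := Real.rpow_le_rpow hs.le hst (by linarith)
  have e3 := mul_le_mul_of_nonneg_left e1 (mul_nonneg (by linarith : 0 ≤ p - 1 + ν) hA)
  have hk : 0 < k := by linarith
  have e4 := mul_le_mul_of_nonneg_left e2
    (mul_nonneg (mul_nonneg (mul_pos hlam hk).le (by linarith : 0 ≤ k - 1 + ν)) hD)
  linarith

lemma reduced_monotone (hlam : 0 < lam) (hA : 0 ≤ A) (hD : 0 ≤ D) {s t : ℝ} (hs : 0 < s)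
    (hst : s ≤ t) (h : 0 ≤ slope p q ν k lam A B D t) :
    reduced p q ν k lam A B D s ≤ reduced p q ν k lam A B D t := by
  have hd : ∀ x ∈ Icc s t, HasDerivAt (reduced p q ν k lam A B D)
      (x ^ (q - 2 + ν) * slope p q ν k lam A B D x) x :=
    fun x hx => hasDerivAt_reduced (hs.trans_le hx.1)
  refine monotoneOn_of_deriv_nonneg (convex_Icc s t)
    (fun x hx => (hd x hx).continuousAt.continuousWithinAt)
    (fun x hx => (hd x (interior_subset hx)).differentiableAt.differentiableWithinAt)
    (fun x hx => ?_) (left_mem_Icc.2 hst) (right_mem_Icc.2 hst) hst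
  have hx' := interior_subset hx
  rw [(hd x hx').deriv]
  exact mul_nonneg (Real.rpow_nonneg (hs.le.trans hx'.1) _)
    (h.trans (slope_antitone E hlam hA hD (hs.trans_le hx'.1) hx'.2))

lemma reduced_antitone (hlam : 0 < lam) (hA : 0 ≤ A) (hD : 0 ≤ D) {s t : ℝ} (hs : 0 < s)
    (hst : s ≤ t) (h : slope p q ν k lam A B D s ≤ 0) :
    reduced p q ν k lam A B D t ≤ reduced p q ν k lam A B D s := by
  have hd : ∀ x ∈ Icc s t, HasDerivAt (reduced p q ν k lam A B D)
      (x ^ (q - 2 + ν) * slope p q ν k lam A B D x) x :=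
    fun x hx => hasDerivAt_reduced (hs.trans_le hx.1)
  refine antitoneOn_of_deriv_nonpos (convex_Icc s t)
    (fun x hx => (hd x hx).continuousAt.continuousWithinAt)
    (fun x hx => (hd x (interior_subset hx)).differentiableAt.differentiableWithinAt)
    (fun x hx => ?_) (left_mem_Icc.2 hst) (right_mem_Icc.2 hst) hst
  have hx' := interior_subset hx
  rw [(hd x hx').deriv]
  exact mul_nonpos_of_nonneg_of_nonpos (Real.rpow_nonneg (hs.le.trans hx'.1) _)
    ((slope_antitone E hlam hA hD hs hx'.1).trans h)

/-- As `slope` changes sign at most once, from positive to negative, `reduced` increases up to some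
point and decreases afterwards. -/
lemma reduced_quasiconcave (hlam : 0 < lam) (hA : 0 ≤ A) (hD : 0 ≤ D) {a t b c : ℝ} (ha : 0 < a)
    (hat : a ≤ t) (htb : t ≤ b) (h1 : c ≤ reduced p q ν k lam A B D a)
    (h2 : c ≤ reduced p q ν k lam A B D b) : c ≤ reduced p q ν k lam A B D t := by
  rcases le_total 0 (slope p q ν k lam A B D t) with h | h
  · exact h1.trans (reduced_monotone E hlam hA hD ha hat h)
  · exact h2.trans (reduced_antitone E hlam hA hD (ha.trans_le hat) htb h)

lemma fib_monotone {s t : ℝ} (hs : 0 < s) (hst : s ≤ t)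
    (h : ∀ x ∈ Icc s t, C ≤ reduced p q ν k lam A B D x) :
    fib p q ν k lam A B C D s ≤ fib p q ν k lam A B C D t := by
  obtain ⟨h1, h2, h3, h4, h5⟩ := E
  have hd : ∀ x ∈ Icc s t, HasDerivAt (fib p q ν k lam A B C D) _ x :=
    fun x hx => hasDerivAt_fib (by linarith) (by linarith) (by linarith) (hs.trans_le hx.1)
  refine monotoneOn_of_deriv_nonneg (convex_Icc s t)
    (fun x hx => (hd x hx).continuousAt.continuousWithinAt)
    (fun x hx => (hd x (interior_subset hx)).differentiableAt.differentiableWithinAt)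
    (fun x hx => ?_) (left_mem_Icc.2 hst) (right_mem_Icc.2 hst) hst
  have hx' := interior_subset hx
  rw [(hd x hx').deriv]
  exact mul_nonneg (Real.rpow_nonneg (hs.le.trans hx'.1) _) (sub_nonneg.2 (h x hx'))

lemma fib_antitone {s t : ℝ} (hs : 0 < s) (hst : s ≤ t)
    (h : ∀ x ∈ Icc s t, reduced p q ν k lam A B D x ≤ C) :
    fib p q ν k lam A B C D t ≤ fib p q ν k lam A B C D s := by
  obtain ⟨h1, h2, h3, h4, h5⟩ := E
  have hd : ∀ x ∈ Icc s t, HasDerivAt (fib p q ν k lam A B C D) _ x :=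
    fun x hx => hasDerivAt_fib (by linarith) (by linarith) (by linarith) (hs.trans_le hx.1)
  refine antitoneOn_of_deriv_nonpos (convex_Icc s t)
    (fun x hx => (hd x hx).continuousAt.continuousWithinAt)
    (fun x hx => (hd x (interior_subset hx)).differentiableAt.differentiableWithinAt)
    (fun x hx => ?_) (left_mem_Icc.2 hst) (right_mem_Icc.2 hst) hst
  have hx' := interior_subset hx
  rw [(hd x hx').deriv]
  exact mul_nonpos_of_nonneg_of_nonpos (Real.rpow_nonneg (hs.le.trans hx'.1) _)
    (sub_nonpos.2 (h x hx'))

lemma continuous_fib : Continuous (fib p q ν k lam A B C D) := by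
  obtain ⟨h1, h2, h3, h4, h5⟩ := E
  have h (r : ℝ) (hr : 0 ≤ r) : Continuous (fun t : ℝ => t ^ r) := Real.continuous_rpow_const hr
  unfold fib
  have := h p (by linarith)
  have := h q (by linarith)
  have := h k (by linarith)
  have := h (1 - ν) (by linarith)
  fun_prop

lemma fib_zero : fib p q ν k lam A B C D 0 = 0 := by
  obtain ⟨h1, h2, h3, h4, h5⟩ := E
  unfold fib
  rw [Real.zero_rpow (by linarith), Real.zero_rpow (by linarith), Real.zero_rpow (by linarith),
    Real.zero_rpow (by linarith)]
  simp

/-- On `N⁻` the fibering map has its global maximum over `(0, ∞)` at `1`, provided that its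
derivative and its value are positive somewhere. -/
lemma fib_le_fib_one (hlam : 0 < lam) (hA : 0 ≤ A) (hD : 0 ≤ D)
    (h : FibMinus p q ν k lam A B C D) {t₀ : ℝ} (ht₀ : 0 < t₀)
    (h0 : C < reduced p q ν k lam A B D t₀) (h0' : 0 < fib p q ν k lam A B C D t₀) :
    0 < fib p q ν k lam A B C D 1 ∧
      ∀ t, 0 < t → fib p q ν k lam A B C D t ≤ fib p q ν k lam A B C D 1 := by
  have m1 : reduced p q ν k lam A B D 1 = C := by
    simp only [reduced, Real.one_rpow]; linarith [h.1]
  have s1 : slope p q ν k lam A B D 1 < 0 := by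
    simp only [slope, Real.one_rpow]; linarith [h.2]
  have hge : ∀ x, 1 ≤ x → reduced p q ν k lam A B D x ≤ C := fun x hx =>
    m1 ▸ reduced_antitone E hlam hA hD one_pos hx s1.le
  have ht1 : t₀ < 1 := by
    by_contra hcon
    exact absurd (hge t₀ (not_lt.1 hcon)) (not_le.2 h0)
  have hpos : 0 < fib p q ν k lam A B C D 1 :=
    h0'.trans_le (fib_monotone E ht₀ ht1.le fun x hx =>
      reduced_quasiconcave E hlam hA hD ht₀ hx.1 hx.2 h0.le m1.ge)
  refine ⟨hpos, fun t ht => ?_⟩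
  rcases le_total 1 t with h1t | h1t
  · exact fib_antitone E one_pos h1t fun x hx => hge x hx.1
  by_cases hm : C ≤ reduced p q ν k lam A B D t
  · exact fib_monotone E ht h1t fun x hx =>
      reduced_quasiconcave E hlam hA hD ht hx.1 hx.2 hm m1.ge
  · push Not at hm
    have hlt : ∀ s, 0 < s → s ≤ t → reduced p q ν k lam A B D s ≤ C := by
      intro s hs hst
      by_contra hcon
      push Not at hcon
      exact absurd (reduced_quasiconcave E hlam hA hD hs hst h1t hcon.le m1.ge) (not_le.2 hm)
    -- here `reduced ≤ C` on all of `(0, t]`, so the fibering map decreases there, from its value `0`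
    -- at `0`
    have : fib p q ν k lam A B C D t ≤ 0 := by
      have hlim : Tendsto (fib p q ν k lam A B C D) (𝓝[>] 0) (𝓝 0) := by
        have := (continuous_fib (A := A) (B := B) (C := C) (D := D) (lam := lam) E).tendsto 0
        rw [fib_zero E] at this
        exact this.mono_left nhdsWithin_le_nhds
      refine ge_of_tendsto hlim ?_
      filter_upwards [Ioo_mem_nhdsGT ht] with s hs
      exact fib_antitone E hs.1 hs.2.le fun x hx => hlt x (hs.1.trans_le hx.1) hx.2
    exact this.trans hpos.le

omit E in
/-- The coefficients on the left are those of the dilated pair `t y`. -/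
lemma fibMinus_scale_iff {t : ℝ} (ht : 0 < t) :
    FibMinus p q ν k lam (t ^ p * A) (t ^ q * B) (t ^ (1 - ν) * C) (t ^ k * D) ↔
      reduced p q ν k lam A B D t = C ∧ slope p q ν k lam A B D t < 0 := by
  have e (r : ℝ) : t ^ (1 - ν) * t ^ (r - 1 + ν) = t ^ r := by
    rw [← Real.rpow_add ht]; ring_nf
  have e' (r : ℝ) : t ^ q * t ^ (r - q) = t ^ r := by
    rw [← Real.rpow_add ht]; ring_nf
  have h1 : t ^ p * A + t ^ q * B - t ^ (1 - ν) * C - lam * k * (t ^ k * D)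
      = t ^ (1 - ν) * (reduced p q ν k lam A B D t - C) := by
    unfold reduced; rw [← e p, ← e q, ← e k]; ring
  have h2 : (p - 1 + ν) * (t ^ p * A) + (q - 1 + ν) * (t ^ q * B)
      - lam * k * (k - 1 + ν) * (t ^ k * D) = t ^ q * slope p q ν k lam A B D t := by
    unfold slope; rw [← e' p, ← e' k]; ring
  unfold FibMinus
  rw [h1, h2, mul_eq_zero_iff_left (Real.rpow_pos_of_pos ht _).ne', sub_eq_zero]
  refine and_congr_right fun _ => ⟨fun h => ?_, fun h => ?_⟩
  · exact neg_of_mul_neg_right h (Real.rpow_pos_of_pos ht _).le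
  · exact mul_neg_of_pos_of_neg (Real.rpow_pos_of_pos ht _) h

/-- If `reduced` exceeds `C` somewhere then some dilation lies in `N⁻`. -/
lemma exists_fibMinus_scale (hlam : 0 < lam) (hA : 0 ≤ A) (hD : 0 < D) {t₀ : ℝ} (ht₀ : 0 < t₀)
    (h0 : C < reduced p q ν k lam A B D t₀) :
    ∃ t, 0 < t ∧ FibMinus p q ν k lam (t ^ p * A) (t ^ q * B) (t ^ (1 - ν) * C) (t ^ k * D) := by
  have hcont : ContinuousOn (reduced p q ν k lam A B D) (Ioi 0) := fun x hx =>
    (hasDerivAt_reduced hx).continuousAt.continuousWithinAt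
  have hlim : Tendsto (fun t : ℝ => t ^ (q - 1 + ν) *
      (t ^ (p - q) * A + B - lam * k * t ^ (k - q) * D)) atTop atBot := by
    obtain ⟨h1, h2, h3, h4, h5⟩ := E
    refine (tendsto_rpow_atTop (by linarith)).atTop_mul_atBot₀ ?_
    have a1 : Tendsto (fun t : ℝ => t ^ (p - q) * A + B) atTop (𝓝 (0 * A + B)) := by
      have := tendsto_rpow_neg_atTop (y := q - p) (by linarith)
      rw [neg_sub] at this
      exact (this.mul_const A).add_const B
    have a2 : Tendsto (fun t : ℝ => lam * k * D * t ^ (k - q)) atTop atTop :=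
      (tendsto_rpow_atTop (by linarith)).const_mul_atTop
        (mul_pos (mul_pos hlam (by linarith)) hD)
    have := a1.add_atBot (tendsto_neg_atTop_atBot.comp a2)
    refine this.congr fun t => ?_
    simp only [Function.comp]; ring
  obtain ⟨T, hT, hTt⟩ := ((hlim.eventually_lt_atBot C).and (eventually_gt_atTop t₀)).exists
  have hT0 : 0 < T := ht₀.trans hTt
  have hTC : reduced p q ν k lam A B D T < C := by
    refine lt_of_eq_of_lt ?_ hT
    have e (r : ℝ) : T ^ (q - 1 + ν) * T ^ (r - q) = T ^ (r - 1 + ν) := by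
      rw [← Real.rpow_add hT0]; ring_nf
    unfold reduced; rw [← e p, ← e k]; ring
  -- `reduced` crosses the level `C` downwards between `t₀` and `T`
  obtain ⟨t, ht, hteq⟩ := intermediate_value_Icc' hTt.le
    (hcont.mono fun x hx => ht₀.trans_le hx.1) ⟨hTC.le, h0.le⟩
  have htpos : 0 < t := ht₀.trans_le ht.1
  refine ⟨t, htpos, (fibMinus_scale_iff htpos).2 ⟨hteq, ?_⟩⟩
  by_contra hcon
  push Not at hcon
  exact absurd (reduced_monotone E hlam hA hD.le ht₀ ht.1 hcon) (by rw [hteq]; exact not_le.2 h0)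

/-- The source of `λ*`: when `C ≤ c A^{(1-ν)/p}` and `D ≤ S A^{k/p}` and `λ` is small, the
fibering map has a positive value and a positive derivative at `t = s A^{-1/p}`, where `s` only
depends on `c`. -/
lemma exists_lamStar (c S : ℝ) (hc : 0 ≤ c) (hS : 0 ≤ S) : ∃ lamStar : ℝ, 0 < lamStar ∧
    ∀ lam A B C D : ℝ, 0 < lam → lam < lamStar → 0 < A → 0 ≤ B → C ≤ c * A ^ ((1 - ν) / p) →
      D ≤ S * A ^ (k / p) → ∃ t, 0 < t ∧ C < reduced p q ν k lam A B D t ∧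
        0 < fib p q ν k lam A B C D t := by
  obtain ⟨h1, h2, h3, h4, h5⟩ := E
  have hk : 0 < k := by linarith
  -- `s ^ (p - 1 + ν)` is so large that `s ^ p` dominates the bound for the singular term in both `ψ`
  -- and `ψ'`, with a margin of `s ^ (1 - ν)` which small `λ` leaves for the coupling term
  obtain ⟨s, hs, hs0⟩ := (((tendsto_rpow_atTop (by linarith : 0 < p - 1 + ν)).eventually_gt_atTop
    (p * ((c + 1) / (1 - ν)))).and (eventually_gt_atTop 0)).exists
  have hsk : 0 < s ^ k := Real.rpow_pos_of_pos hs0 _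
  have hsν : 0 < s ^ (1 - ν) := Real.rpow_pos_of_pos hs0 _
  refine ⟨s ^ (1 - ν) / (k * s ^ k * (S + 1)), by positivity, ?_⟩
  intro lam A B C D hlam hlt hA hB hC hD
  have hlt' : lam * k * s ^ k * S < s ^ (1 - ν) := by
    rw [lt_div_iff₀ (by positivity)] at hlt
    have : 0 < lam * k * s ^ k := by positivity
    linarith [mul_add (lam * k * s ^ k) S 1]
  have hsp : p * ((c + 1) / (1 - ν)) * s ^ (1 - ν) < s ^ p := by
    have : s ^ p = s ^ (p - 1 + ν) * s ^ (1 - ν) := by rw [← Real.rpow_add hs0]; ring_nf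
    rw [this]
    exact mul_lt_mul_of_pos_right hs hsν
  set t := s * A ^ (-(1 / p)) with htdef
  have hAp : 0 < A ^ (-(1 / p)) := Real.rpow_pos_of_pos hA _
  have ht : 0 < t := mul_pos hs0 hAp
  have e (r : ℝ) : t ^ r * A ^ (r / p) = s ^ r := by
    rw [htdef, Real.mul_rpow hs0.le hAp.le, ← Real.rpow_mul hA.le, mul_assoc, ← Real.rpow_add hA]
    have : -(1 / p) * r + r / p = 0 := by ring
    rw [this]; simp
  have eA : t ^ p * A = s ^ p := by
    have := e p; rwa [div_self (by linarith), Real.rpow_one] at this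
  have eC : t ^ (1 - ν) * C ≤ c * s ^ (1 - ν) := by
    rw [← e (1 - ν)]
    have := mul_le_mul_of_nonneg_left hC (Real.rpow_pos_of_pos ht (1 - ν)).le
    linarith
  have eD : lam * k * (t ^ k * D) ≤ lam * k * s ^ k * S := by
    rw [← e k]
    have := mul_le_mul_of_nonneg_left (mul_le_mul_of_nonneg_left hD
      (Real.rpow_pos_of_pos ht k).le) (mul_pos hlam hk).le
    linarith
  have eB : 0 ≤ t ^ q * B := mul_nonneg (Real.rpow_pos_of_pos ht _).le hB
  have h1ν : 0 < 1 - ν := by linarith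
  refine ⟨t, ht, ?_, ?_⟩
  · have e2 (r : ℝ) : t ^ (1 - ν) * t ^ (r - 1 + ν) = t ^ r := by
      rw [← Real.rpow_add ht]; ring_nf
    have h1 : t ^ p * A + t ^ q * B - t ^ (1 - ν) * C - lam * k * (t ^ k * D)
        = t ^ (1 - ν) * (reduced p q ν k lam A B D t - C) := by
      unfold reduced; rw [← e2 p, ← e2 q, ← e2 k]; ring
    have h2 : (c + 1) * s ^ (1 - ν) ≤ s ^ p := by
      refine le_trans ?_ hsp.le
      refine mul_le_mul_of_nonneg_right ?_ hsν.le
      have : c + 1 ≤ (c + 1) / (1 - ν) := by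
        rw [le_div_iff₀ h1ν]; nlinarith
      nlinarith [this]
    have h3 : 0 < t ^ (1 - ν) * (reduced p q ν k lam A B D t - C) := by
      rw [← h1, eA]; linarith
    exact sub_pos.1 (pos_of_mul_pos_right h3 (Real.rpow_pos_of_pos ht _).le)
  · have hp0 : 0 < p := by linarith
    have h6 : (c + 1) / (1 - ν) * s ^ (1 - ν) < s ^ p / p := by
      rw [lt_div_iff₀ hp0]; linarith
    have h7 : t ^ (1 - ν) / (1 - ν) * C ≤ c * s ^ (1 - ν) / (1 - ν) := by
      rw [div_mul_eq_mul_div]; gcongr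
    have h8 : lam * t ^ k * D < s ^ (1 - ν) := by
      rcases le_or_gt D 0 with hD0 | hD0
      · exact lt_of_le_of_lt (mul_nonpos_of_nonneg_of_nonpos (by positivity) hD0) hsν
      · have : 0 ≤ lam * (t ^ k * D) := by positivity
        nlinarith
    have h9 : s ^ (1 - ν) ≤ s ^ (1 - ν) / (1 - ν) := by
      rw [le_div_iff₀ h1ν]; nlinarith
    have h10 : (c + 1) / (1 - ν) * s ^ (1 - ν)
      = c * s ^ (1 - ν) / (1 - ν) + s ^ (1 - ν) / (1 - ν) := by ring
    have h11 : t ^ p / p * A = s ^ p / p := by rw [← eA]; ring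
    have h12 : 0 ≤ t ^ q / q * B := by
      rw [div_mul_eq_mul_div]; exact div_nonneg eB (by linarith)
    unfold fib
    linarith

omit E in
/-- Being in `N⁻` up to a dilation close to `1` is stable under small perturbations of the
coefficients. -/
lemma FibMinus.exists_scale_of_tendsto {ι : Type*} {l : Filter ι} {a b c d : ι → ℝ}
    (h : FibMinus p q ν k lam A B C D) (ha : Tendsto a l (𝓝 A)) (hb : Tendsto b l (𝓝 B))
    (hc : Tendsto c l (𝓝 C)) (hd : Tendsto d l (𝓝 D)) {δ : ℝ} (hδ : 0 < δ) (hδ1 : δ < 1) :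
    ∀ᶠ i in l, ∃ t, t ∈ Ioo (1 - δ) (1 + δ) ∧
      FibMinus p q ν k lam (t ^ p * a i) (t ^ q * b i) (t ^ (1 - ν) * c i) (t ^ k * d i) := by
  -- `f1` and `f2` are the two expressions in `FibMinus` for the dilation by `t`
  let f1 : ℝ → ℝ × ℝ × ℝ × ℝ → ℝ := fun t z =>
    t ^ p * z.1 + t ^ q * z.2.1 - t ^ (1 - ν) * z.2.2.1 - lam * k * (t ^ k * z.2.2.2)
  let f2 : ℝ × ℝ × ℝ × ℝ × ℝ → ℝ := fun w =>
    (p - 1 + ν) * (w.1 ^ p * w.2.1) + (q - 1 + ν) * (w.1 ^ q * w.2.2.1)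
      - lam * k * (k - 1 + ν) * (w.1 ^ k * w.2.2.2.2)
  let Z : ℝ × ℝ × ℝ × ℝ := (A, B, C, D)
  have hz : Tendsto (fun i => (a i, b i, c i, d i)) l (𝓝 Z) :=
    ha.prodMk_nhds (hb.prodMk_nhds (hc.prodMk_nhds hd))
  have hf2 : ContinuousAt f2 (1, Z) := by
    have hr (r : ℝ) : ContinuousAt (fun w : ℝ × ℝ × ℝ × ℝ × ℝ => w.1 ^ r) (1, Z) :=
      continuousAt_fst.rpow_const (Or.inl one_ne_zero)
    have := hr p
    have := hr q
    have := hr k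
    fun_prop
  have hf20 : f2 (1, Z) < 0 := by simp only [f2, Z, Real.one_rpow]; linarith [h.2]
  have hev : ∀ᶠ w in 𝓝 ((1 : ℝ), Z), f2 w < 0 := hf2.eventually_lt continuousAt_const hf20
  rw [nhds_prod_eq] at hev
  obtain ⟨U, hU, V, hV, hUV⟩ := eventually_prod_iff.1 hev
  obtain ⟨ε, hε, hεU⟩ := Metric.eventually_nhds_iff.1 hU
  set r := min δ ε with hr
  have hr0 : 0 < r := lt_min hδ hε
  have hderiv : HasDerivAt (fun t => f1 t Z)
      (p * A + q * B - (1 - ν) * C - lam * k * (k * D)) 1 := by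
    have h (r : ℝ) : HasDerivAt (fun t : ℝ => t ^ r) r 1 := by
      simpa using Real.hasDerivAt_rpow_const (x := 1) (p := r) (Or.inl one_ne_zero)
    exact ((((h p).mul_const A).add ((h q).mul_const B)).sub ((h (1 - ν)).mul_const C)).sub
      (((h k).mul_const D).const_mul (lam * k))
  have hneg : p * A + q * B - (1 - ν) * C - lam * k * (k * D) < 0 := by
    have h1 := h.1
    have h2 := h.2
    have : C = A + B - lam * k * D := by linarith
    rw [this]; linarith
  have hf11 : f1 1 Z = 0 := by simp only [f1, Z, Real.one_rpow]; linarith [h.1]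
  -- the derivative at `1` is negative, so `f1 · Z` changes sign at `1`
  obtain ⟨s, hs, hs1⟩ : ∃ s ∈ Ioo (1 - r) 1, 0 < f1 s Z := by
    have hev := (hasDerivAt_iff_tendsto_slope.1 hderiv).eventually_lt_const hneg
    have hev' : ∀ᶠ x in 𝓝[<] (1 : ℝ), _root_.slope (fun t => f1 t Z) 1 x < 0 :=
      hev.filter_mono (nhdsWithin_mono _ fun x hx => ne_of_lt hx)
    obtain ⟨s, hs, hs'⟩ := (hev'.and (Ioo_mem_nhdsLT (by linarith : 1 - r < 1))).exists
    refine ⟨s, hs', ?_⟩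
    rw [slope_def_field, hf11, sub_zero] at hs
    by_contra hcon
    exact absurd hs (not_lt.2 (div_nonneg_of_nonpos (not_lt.1 hcon) (by linarith [hs'.2])))
  obtain ⟨u, hu, hu1⟩ : ∃ u ∈ Ioo 1 (1 + r), f1 u Z < 0 := by
    have hev := (hasDerivAt_iff_tendsto_slope.1 hderiv).eventually_lt_const hneg
    have hev' : ∀ᶠ x in 𝓝[>] (1 : ℝ), _root_.slope (fun t => f1 t Z) 1 x < 0 :=
      hev.filter_mono (nhdsWithin_mono _ fun x hx => ne_of_gt hx)
    obtain ⟨s, hs, hs'⟩ := (hev'.and (Ioo_mem_nhdsGT (by linarith : 1 < 1 + r))).exists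
    refine ⟨s, hs', ?_⟩
    rw [slope_def_field, hf11, sub_zero] at hs
    by_contra hcon
    exact absurd hs (not_lt.2 (div_nonneg (not_lt.1 hcon) (by linarith [hs'.1])))
  have hfc (t : ℝ) : Continuous (f1 t) := by fun_prop
  have hes := (((hfc s).tendsto Z).comp hz).eventually_const_lt hs1
  have heu := (((hfc u).tendsto Z).comp hz).eventually_lt_const hu1
  filter_upwards [hes, heu, hz.eventually hV] with i his hiu hiV
  have hs0 : 0 < s := by linarith [hs.1, min_le_left δ ε]
  have hcont : ContinuousOn (fun t => f1 t (a i, b i, c i, d i)) (Icc s u) := by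
    intro x hx
    have hr (r : ℝ) : ContinuousWithinAt (fun t : ℝ => t ^ r) (Icc s u) x :=
      continuousWithinAt_id.rpow_const (Or.inl (hs0.trans_le hx.1).ne')
    have := hr p
    have := hr q
    have := hr k
    have := hr (1 - ν)
    fun_prop
  obtain ⟨t, ht, hteq⟩ := intermediate_value_Icc' (by linarith [hs.2, hu.1] : s ≤ u) hcont
    ⟨hiu.le, his.le⟩
  have hd1 : |t - 1| < r := by
    rw [abs_lt]; constructor <;> linarith [ht.1, ht.2, hs.1, hu.2]
  have hδt := hd1.trans_le (min_le_left δ ε)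
  rw [abs_lt] at hδt
  refine ⟨t, ⟨by linarith [hδt.1], by linarith [hδt.2]⟩, hteq, ?_⟩
  exact hUV (hεU (by rw [Real.dist_eq]; exact hd1.trans_le (min_le_right δ ε))) hiV

end Fibering

end DoublePhase

/-! ### Homogeneous integrands and uniform convexity of `L^r` -/

namespace DoublePhase

section Homogeneous

variable {V : Type*} [NormedAddCommGroup V] [NormedSpace ℝ V]

/-- `F` is positively homogeneous of degree `r`. -/
def PosHomogeneous (r : ℝ) (F : V → ℝ) : Prop := ∀ (t : ℝ) (z : V), 0 < t → F (t • z) = t ^ r * F z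

lemma posHomogeneous_norm_rpow (r : ℝ) : PosHomogeneous r (fun z : V => ‖z‖ ^ r) := by
  intro t z ht
  beta_reduce
  rw [norm_smul, Real.norm_of_nonneg ht.le, Real.mul_rpow ht.le (norm_nonneg _)]

lemma PosHomogeneous.map_zero {r : ℝ} {F : V → ℝ} (hF : PosHomogeneous r F) (hr : 0 < r) :
    F 0 = 0 := by
  have h := hF 2 0 two_pos
  rw [smul_zero] at h
  have : (1 : ℝ) < 2 ^ r := Real.one_lt_rpow one_lt_two hr
  nlinarith

lemma PosHomogeneous.le_of_unit {r : ℝ} {F G : V → ℝ} (hF : PosHomogeneous r F)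
    (hG : PosHomogeneous r G) (hr : 0 < r) (h : ∀ z, ‖z‖ = 1 → F z ≤ G z) (z : V) :
    F z ≤ G z := by
  rcases eq_or_ne z 0 with rfl | hz
  · rw [hF.map_zero hr, hG.map_zero hr]
  have hz' : 0 < ‖z‖ := norm_pos_iff.2 hz
  have h1 : z = ‖z‖ • (‖z‖⁻¹ • z) := by rw [smul_smul, mul_inv_cancel₀ hz'.ne', one_smul]
  rw [h1, hF _ _ hz', hG _ _ hz']
  exact mul_le_mul_of_nonneg_left (h _ (by rw [norm_smul, norm_inv, norm_norm,
    inv_mul_cancel₀ hz'.ne'])) (Real.rpow_nonneg hz'.le _)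

/-- Compactness of the unit sphere: a homogeneous function `G` is controlled by any homogeneous
`H ≥ 0` that is positive wherever `G` is, up to an arbitrarily small multiple of `‖z‖ ^ r`. -/
lemma PosHomogeneous.exists_le [FiniteDimensional ℝ V] {r : ℝ} {G H : V → ℝ}
    (hG : PosHomogeneous r G) (hH : PosHomogeneous r H) (hr : 0 < r) (hGc : Continuous G)
    (hHc : Continuous H) (hH0 : ∀ z, 0 ≤ H z) (h : ∀ z, H z = 0 → G z ≤ 0) {ε : ℝ} (hε : 0 < ε) :
    ∃ C, 0 ≤ C ∧ ∀ z, G z ≤ ε * ‖z‖ ^ r + C * H z := by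
  have : ProperSpace V := FiniteDimensional.proper ℝ V
  set K : Set V := Metric.sphere 0 1 ∩ {z | ε ≤ G z} with hK
  have hKc : IsCompact K := (isCompact_sphere _ _).inter_right (isClosed_le continuous_const hGc)
  obtain ⟨C, hC0, hC⟩ : ∃ C, 0 ≤ C ∧ ∀ z ∈ K, G z ≤ C * H z := by
    rcases K.eq_empty_or_nonempty with hKe | hKn
    · exact ⟨0, le_rfl, by simp [hKe]⟩
    obtain ⟨z₁, hz₁, hz₁'⟩ := hKc.exists_isMinOn hKn hHc.continuousOn
    obtain ⟨z₂, hz₂, hz₂'⟩ := hKc.exists_isMaxOn hKn hGc.continuousOn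
    have hpos : 0 < H z₁ := (hH0 z₁).lt_of_ne fun h0 =>
      absurd (h z₁ h0.symm) (not_le.2 (hε.trans_le hz₁.2))
    have hpos2 : 0 ≤ G z₂ := hε.le.trans hz₂.2
    refine ⟨G z₂ / H z₁, div_nonneg hpos2 hpos.le, fun z hz => (hz₂' hz).trans ?_⟩
    rw [div_mul_eq_mul_div, le_div_iff₀ hpos]
    exact mul_le_mul_of_nonneg_left (hz₁' hz) hpos2
  refine ⟨C, hC0, hG.le_of_unit (G := fun z => ε * ‖z‖ ^ r + C * H z) (fun t z ht => ?_) hr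
    fun z hz => ?_⟩
  · have h1 : ‖t • z‖ ^ r = t ^ r * ‖z‖ ^ r := posHomogeneous_norm_rpow r t z ht
    beta_reduce
    rw [h1, hH t z ht]; ring
  · by_cases hzK : z ∈ K
    · have := hC z hzK
      rw [hz, Real.one_rpow]; linarith
    · have : G z < ε := by
        by_contra hcon
        exact hzK ⟨by simpa using hz, not_lt.1 hcon⟩
      have := mul_nonneg hC0 (hH0 z)
      rw [hz, Real.one_rpow]; linarith

lemma PosHomogeneous.exists_abs_le [FiniteDimensional ℝ V] {r : ℝ} {G : V → ℝ}
    (hG : PosHomogeneous r G) (hr : 0 < r) (hGc : Continuous G) :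
    ∃ C, 0 ≤ C ∧ ∀ z, |G z| ≤ C * ‖z‖ ^ r := by
  have hG' : PosHomogeneous r (fun z => |G z|) := fun t z ht => by
    beta_reduce
    rw [hG t z ht, abs_mul, abs_of_nonneg (Real.rpow_nonneg ht.le _)]
  obtain ⟨C, hC, h⟩ := hG'.exists_le (posHomogeneous_norm_rpow r) hr hGc.abs
    (continuous_norm.rpow_const fun _ => Or.inr hr.le) (fun z => Real.rpow_nonneg (norm_nonneg z) _)
    (fun z hz => by
      have : z = 0 := by
        by_contra h0
        exact (Real.rpow_pos_of_pos (norm_pos_iff.2 h0) r).ne' hz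
      rw [this, hG.map_zero hr, abs_zero]) one_pos
  exact ⟨1 + C, by linarith, fun z => (h z).trans_eq (by ring)⟩

variable {α : Type*} {mα : MeasurableSpace α} {m : Measure α}

omit [NormedSpace ℝ V] in
lemma integrable_norm_rpow {r : ℝ} (hr : 0 < r) {z : α → V} (hz : MemLp z (ENNReal.ofReal r) m) :
    Integrable (fun x => ‖z x‖ ^ r) m := by
  have := hz.integrable_norm_rpow (by simpa using hr) ENNReal.ofReal_ne_top
  rwa [ENNReal.toReal_ofReal hr.le] at this

lemma PosHomogeneous.integrable [FiniteDimensional ℝ V] {r : ℝ} {G : V → ℝ}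
    (hG : PosHomogeneous r G) (hr : 0 < r) (hGc : Continuous G) {z : α → V}
    (hz : MemLp z (ENNReal.ofReal r) m) : Integrable (fun x => G (z x)) m := by
  obtain ⟨C, -, h⟩ := hG.exists_abs_le hr hGc
  exact ((integrable_norm_rpow hr hz).const_mul C).mono'
    (hGc.comp_aestronglyMeasurable hz.1) (ae_of_all _ fun x => h (z x))

/-- If `G` vanishes wherever `H` does, then along sequences bounded in `L^r`, convergence `∫ H → 0`
implies `∫ G → 0`. With `H` a convexity defect this yields uniform convexity, with `H` a power of a
difference it yields continuity of homogeneous integral functionals. -/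
lemma PosHomogeneous.tendsto_integral [FiniteDimensional ℝ V] {r : ℝ} {G H : V → ℝ}
    (hG : PosHomogeneous r G) (hH : PosHomogeneous r H) (hr : 0 < r) (hGc : Continuous G)
    (hHc : Continuous H) (hG0 : ∀ z, 0 ≤ G z) (hH0 : ∀ z, 0 ≤ H z) (h : ∀ z, H z = 0 → G z = 0)
    {ι : Type*} {l : Filter ι} {z : ι → α → V} (hz : ∀ i, MemLp (z i) (ENNReal.ofReal r) m)
    {M : ℝ} (hM : ∀ i, ∫ x, ‖z i x‖ ^ r ∂m ≤ M)
    (hlim : Tendsto (fun i => ∫ x, H (z i x) ∂m) l (𝓝 0)) :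
    Tendsto (fun i => ∫ x, G (z i x) ∂m) l (𝓝 0) := by
  rw [tendsto_order]
  refine ⟨fun a ha => Eventually.of_forall fun i => ha.trans_le (integral_nonneg fun x => hG0 _),
    fun ε hε => ?_⟩
  have hM1 : 0 < |M| + 1 := by positivity
  -- `G ≤ (ε / 2) / (|M| + 1) ‖·‖ ^ r + C H`
  obtain ⟨C, hC0, hC⟩ := hG.exists_le hH hr hGc hHc hH0 (fun z hz => (h z hz).le)
    (ε := ε / 2 / (|M| + 1)) (by positivity)
  have hev : ∀ᶠ i in l, C * ∫ x, H (z i x) ∂m < ε / 2 := by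
    have := hlim.const_mul C
    rw [mul_zero] at this
    exact this.eventually_lt_const (by positivity)
  filter_upwards [hev] with i hi
  have hn := integrable_norm_rpow hr (hz i)
  have hHi := hH.integrable hr hHc (hz i)
  calc ∫ x, G (z i x) ∂m ≤ ∫ x, (ε / 2 / (|M| + 1) * ‖z i x‖ ^ r + C * H (z i x)) ∂m :=
        integral_mono (hG.integrable hr hGc (hz i)) ((hn.const_mul _).add (hHi.const_mul _))
          fun x => hC (z i x)
    _ = ε / 2 / (|M| + 1) * ∫ x, ‖z i x‖ ^ r ∂m + C * ∫ x, H (z i x) ∂m := by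
        rw [integral_add (hn.const_mul _) (hHi.const_mul _), integral_const_mul,
          integral_const_mul]
    _ < ε / 2 / (|M| + 1) * (|M| + 1) + ε / 2 := by
        refine add_lt_add_of_le_of_lt (mul_le_mul_of_nonneg_left ?_ (by positivity)) hi
        linarith [hM i, le_abs_self M]
    _ = ε := by field_simp; ring

end Homogeneous

section UniformConvexity

variable {F : Type*} [NormedAddCommGroup F] [InnerProductSpace ℝ F]

/-- The midpoint convexity defect of `‖·‖ ^ r`. -/
noncomputable def convexityDefect (r : ℝ) (z : F × F) : ℝ :=
  (‖z.1‖ ^ r + ‖z.2‖ ^ r) / 2 - ‖(1 / 2 : ℝ) • (z.1 + z.2)‖ ^ r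

lemma norm_midpoint_le (a b : F) : ‖(1 / 2 : ℝ) • (a + b)‖ ≤ (‖a‖ + ‖b‖) / 2 := by
  rw [norm_smul, Real.norm_of_nonneg (by norm_num)]
  linarith [norm_add_le a b]

lemma rpow_midpoint_le {r : ℝ} (hr : 1 < r) {a b : ℝ} (ha : 0 ≤ a) (hb : 0 ≤ b) :
    ((a + b) / 2) ^ r ≤ (a ^ r + b ^ r) / 2 := by
  have := (convexOn_rpow hr.le).2 ha hb (by norm_num : (0 : ℝ) ≤ 1 / 2)
    (by norm_num : (0 : ℝ) ≤ 1 / 2) (by norm_num)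
  simp only [smul_eq_mul] at this
  have e : (a + b) / 2 = 1 / 2 * a + 1 / 2 * b := by ring
  rw [e]; linarith

lemma convexityDefect_nonneg {r : ℝ} (hr : 1 < r) (z : F × F) : 0 ≤ convexityDefect r z := by
  unfold convexityDefect
  have := Real.rpow_le_rpow (norm_nonneg _) (norm_midpoint_le z.1 z.2) (by linarith : 0 ≤ r)
  linarith [rpow_midpoint_le hr (norm_nonneg z.1) (norm_nonneg z.2)]

/-- Strict convexity of `‖·‖ ^ r`. -/
lemma eq_of_convexityDefect_eq_zero {r : ℝ} (hr : 1 < r) {z : F × F}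
    (h : convexityDefect r z = 0) : z.1 = z.2 := by
  have h0 : (‖z.1‖ ^ r + ‖z.2‖ ^ r) / 2 = ‖(1 / 2 : ℝ) • (z.1 + z.2)‖ ^ r := sub_eq_zero.1 h
  have h1 := Real.rpow_le_rpow (norm_nonneg _) (norm_midpoint_le z.1 z.2) (by linarith : 0 ≤ r)
  have h2 := rpow_midpoint_le hr (norm_nonneg z.1) (norm_nonneg z.2)
  have hn : ‖z.1‖ = ‖z.2‖ := by
    by_contra hne
    have := (strictConvexOn_rpow hr).2 (norm_nonneg z.1) (norm_nonneg z.2) hne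
      (by norm_num : (0 : ℝ) < 1 / 2) (by norm_num : (0 : ℝ) < 1 / 2) (by norm_num)
    simp only [smul_eq_mul] at this
    have e : 1 / 2 * ‖z.1‖ + 1 / 2 * ‖z.2‖ = (‖z.1‖ + ‖z.2‖) / 2 := by ring
    rw [e] at this
    linarith
  have h3 : ‖(1 / 2 : ℝ) • (z.1 + z.2)‖ = (‖z.1‖ + ‖z.2‖) / 2 := by
    refine Real.rpow_left_injOn (by linarith : r ≠ 0) (norm_nonneg _)
      (by positivity : 0 ≤ (‖z.1‖ + ‖z.2‖) / 2) (le_antisymm h1 (h2.trans h0.le))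
  rw [norm_smul, Real.norm_of_nonneg (by norm_num)] at h3
  exact (sameRay_iff_of_norm_eq hn).1 (sameRay_iff_norm_add.2 (by linarith))

lemma posHomogeneous_convexityDefect (r : ℝ) :
    PosHomogeneous r (convexityDefect r : F × F → ℝ) := by
  intro t z ht
  have h := fun w : F => posHomogeneous_norm_rpow r t w ht
  have e : (1 / 2 : ℝ) • (t • z.1 + t • z.2) = t • ((1 / 2 : ℝ) • (z.1 + z.2)) := by
    rw [← smul_add, smul_comm]
  simp only [convexityDefect, Prod.smul_fst, Prod.smul_snd, e] at h ⊢
  rw [h, h, h]; ring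

lemma continuous_convexityDefect {r : ℝ} (hr : 0 ≤ r) :
    Continuous (convexityDefect r : F × F → ℝ) := by
  have h : Continuous fun x : ℝ => x ^ r := Real.continuous_rpow_const hr
  unfold convexityDefect
  fun_prop

variable [FiniteDimensional ℝ F] {α : Type*} {mα : MeasurableSpace α} {m : Measure α}

lemma norm_prod_rpow_le {r : ℝ} {V W : Type*} [NormedAddCommGroup V]
    [NormedAddCommGroup W] (z : V × W) : ‖z‖ ^ r ≤ ‖z.1‖ ^ r + ‖z.2‖ ^ r := by
  have h1 := Real.rpow_nonneg (norm_nonneg z.1) r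
  have h2 := Real.rpow_nonneg (norm_nonneg z.2) r
  rcases le_total ‖z.1‖ ‖z.2‖ with h | h
  · rw [Prod.norm_def, max_eq_right h]; linarith
  · rw [Prod.norm_def, max_eq_left h]; linarith

lemma memLp_prodMk {V W : Type*} [NormedAddCommGroup V] [NormedAddCommGroup W] {r : ℝ}
    {f : α → V} {g : α → W}
    (hf : MemLp f (ENNReal.ofReal r) m) (hg : MemLp g (ENNReal.ofReal r) m) :
    MemLp (fun x => (f x, g x)) (ENNReal.ofReal r) m := by
  refine (hf.norm.add hg.norm).mono (hf.1.prodMk hg.1) (ae_of_all _ fun x => ?_)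
  rw [Pi.add_apply, Real.norm_of_nonneg (by positivity), Prod.norm_def]
  exact max_le (le_add_of_nonneg_right (norm_nonneg _)) (le_add_of_nonneg_left (norm_nonneg _))

/-- Uniform convexity of `L^r`, `r > 1`: bounded pairs of functions whose midpoints have
asymptotically the average energy get close. -/
lemma tendsto_integral_norm_sub_rpow {r : ℝ} (hr : 1 < r) {ι : Type*} {l : Filter ι}
    {a b : ι → α → F} (ha : ∀ i, MemLp (a i) (ENNReal.ofReal r) m)
    (hb : ∀ i, MemLp (b i) (ENNReal.ofReal r) m) {M : ℝ}
    (hMa : ∀ i, ∫ x, ‖a i x‖ ^ r ∂m ≤ M) (hMb : ∀ i, ∫ x, ‖b i x‖ ^ r ∂m ≤ M)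
    (h : Tendsto (fun i => ∫ x, convexityDefect r (a i x, b i x) ∂m) l (𝓝 0)) :
    Tendsto (fun i => ∫ x, ‖a i x - b i x‖ ^ r ∂m) l (𝓝 0) := by
  have hr0 : 0 < r := by linarith
  refine PosHomogeneous.tendsto_integral (V := F × F) (r := r) (G := fun z => ‖z.1 - z.2‖ ^ r)
    (H := convexityDefect r) (z := fun i x => (a i x, b i x)) (M := M + M) ?_
    (posHomogeneous_convexityDefect r) hr0 ?_ (continuous_convexityDefect hr0.le)
    (fun z => by positivity) (convexityDefect_nonneg hr) ?_
    (fun i => memLp_prodMk (ha i) (hb i)) ?_ h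
  · intro t z ht
    simp only [Prod.smul_fst, Prod.smul_snd, ← smul_sub]
    exact posHomogeneous_norm_rpow r t (z.1 - z.2) ht
  · have h : Continuous fun x : ℝ => x ^ r := Real.continuous_rpow_const hr0.le
    fun_prop
  · intro z hz
    simp [eq_of_convexityDefect_eq_zero hr hz, hr0.ne']
  · intro i
    have h1 := integrable_norm_rpow hr0 (ha i)
    have h2 := integrable_norm_rpow hr0 (hb i)
    calc _ ≤ ∫ x, (‖a i x‖ ^ r + ‖b i x‖ ^ r) ∂m :=
          integral_mono (integrable_norm_rpow hr0 (memLp_prodMk (ha i) (hb i))) (h1.add h2)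
            fun x => norm_prod_rpow_le _
      _ ≤ _ := by rw [integral_add h1 h2]; exact add_le_add (hMa i) (hMb i)

omit [FiniteDimensional ℝ F] in
lemma integral_convexityDefect {r : ℝ} (hr : 1 < r) {a b : α → F}
    (ha : MemLp a (ENNReal.ofReal r) m) (hb : MemLp b (ENNReal.ofReal r) m) :
    ∫ x, convexityDefect r (a x, b x) ∂m = (∫ x, ‖a x‖ ^ r ∂m + ∫ x, ‖b x‖ ^ r ∂m) / 2
      - ∫ x, ‖(1 / 2 : ℝ) • (a x + b x)‖ ^ r ∂m := by
  have hr0 : 0 < r := by linarith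
  have h1 := integrable_norm_rpow hr0 ha
  have h2 := integrable_norm_rpow hr0 hb
  have h3 := integrable_norm_rpow hr0 ((ha.add hb).const_smul (1 / 2 : ℝ))
  unfold convexityDefect
  rw [← integral_add h1 h2, ← integral_div]
  exact integral_sub ((h1.add h2).div_const 2) h3

end UniformConvexity

section Coupling

variable {α : Type*} {mα : MeasurableSpace α} {m : Measure α}

lemma posHomogeneous_coupling (b c : ℝ) :
    PosHomogeneous (b + c) (fun z : ℝ × ℝ => |z.1| ^ b * |z.2| ^ c) := by
  intro t z ht
  simp only [Prod.smul_fst, Prod.smul_snd, smul_eq_mul, abs_mul, abs_of_pos ht]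
  rw [Real.mul_rpow ht.le (abs_nonneg _), Real.mul_rpow ht.le (abs_nonneg _), Real.rpow_add ht]
  ring

lemma continuous_coupling {b c : ℝ} (hb : 0 ≤ b) (hc : 0 ≤ c) :
    Continuous (fun z : ℝ × ℝ => |z.1| ^ b * |z.2| ^ c) := by
  have h1 : Continuous fun x : ℝ => x ^ b := Real.continuous_rpow_const hb
  have h2 : Continuous fun x : ℝ => x ^ c := Real.continuous_rpow_const hc
  fun_prop

lemma integrable_coupling {b c : ℝ} (hb : 0 < b) (hc : 0 < c) {u v : α → ℝ}
    (hu : MemLp u (ENNReal.ofReal (b + c)) m) (hv : MemLp v (ENNReal.ofReal (b + c)) m) :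
    Integrable (fun x => |u x| ^ b * |v x| ^ c) m :=
  (posHomogeneous_coupling b c).integrable (by linarith) (continuous_coupling hb.le hc.le)
    (memLp_prodMk hu hv)

/-- Continuity of the coupling term on `L^{b+c} × L^{b+c}`, as an instance of
`PosHomogeneous.tendsto_integral` for quadruples `((u, v), (u₀, v₀))`. -/
lemma tendsto_integral_coupling {b c : ℝ} (hb : 0 < b) (hc : 0 < c) {ι : Type*} {l : Filter ι}
    {u v : ι → α → ℝ} {u₀ v₀ : α → ℝ} (hu : ∀ i, MemLp (u i) (ENNReal.ofReal (b + c)) m)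
    (hv : ∀ i, MemLp (v i) (ENNReal.ofReal (b + c)) m)
    (hu₀ : MemLp u₀ (ENNReal.ofReal (b + c)) m) (hv₀ : MemLp v₀ (ENNReal.ofReal (b + c)) m)
    {M : ℝ} (hMu : ∀ i, ∫ x, ‖u i x‖ ^ (b + c) ∂m ≤ M) (hMv : ∀ i, ∫ x, ‖v i x‖ ^ (b + c) ∂m ≤ M)
    (hlu : Tendsto (fun i => ∫ x, ‖u i x - u₀ x‖ ^ (b + c) ∂m) l (𝓝 0))
    (hlv : Tendsto (fun i => ∫ x, ‖v i x - v₀ x‖ ^ (b + c) ∂m) l (𝓝 0)) :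
    Tendsto (fun i => ∫ x, |u i x| ^ b * |v i x| ^ c ∂m) l
      (𝓝 (∫ x, |u₀ x| ^ b * |v₀ x| ^ c ∂m)) := by
  have hr : 0 < b + c := by linarith
  have hcont : Continuous fun x : ℝ => x ^ (b + c) := Real.continuous_rpow_const hr.le
  have hcp := continuous_coupling hb.le hc.le
  have key := PosHomogeneous.tendsto_integral (m := m) (V := (ℝ × ℝ) × (ℝ × ℝ)) (r := b + c) (l := l)
    (G := fun z => |(|z.1.1| ^ b * |z.1.2| ^ c) - (|z.2.1| ^ b * |z.2.2| ^ c)|)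
    (H := fun z => ‖z.1.1 - z.2.1‖ ^ (b + c) + ‖z.1.2 - z.2.2‖ ^ (b + c))
    (z := fun i x => ((u i x, v i x), (u₀ x, v₀ x)))
    (M := M + M + (∫ x, ‖u₀ x‖ ^ (b + c) ∂m + ∫ x, ‖v₀ x‖ ^ (b + c) ∂m)) ?_ ?_ hr ?_ ?_ ?_ ?_ ?_ ?_ ?_ ?_
  · rw [tendsto_iff_norm_sub_tendsto_zero]
    refine squeeze_zero (fun i => norm_nonneg _) (fun i => ?_) key
    rw [← integral_sub (integrable_coupling hb hc (hu i) (hv i))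
      (integrable_coupling hb hc hu₀ hv₀)]
    exact norm_integral_le_integral_norm _
  · intro t z ht
    have h := posHomogeneous_coupling b c t
    have h1 := h z.1 ht
    have h2 := h z.2 ht
    simp only [Prod.smul_fst, Prod.smul_snd] at h1 h2 ⊢
    rw [h1, h2, ← mul_sub, abs_mul, abs_of_nonneg (Real.rpow_nonneg ht.le _)]
  · intro t z ht
    have h := fun w : ℝ => posHomogeneous_norm_rpow (b + c) t w ht
    simp only at h
    simp only [Prod.smul_fst, Prod.smul_snd, ← smul_sub, h]
    ring
  · exact ((hcp.comp continuous_fst).sub (hcp.comp continuous_snd)).abs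
  · fun_prop
  · exact fun z => abs_nonneg _
  · exact fun z => by positivity
  · intro z hz
    have h1 : 0 ≤ ‖z.1.1 - z.2.1‖ ^ (b + c) := by positivity
    have h2 : 0 ≤ ‖z.1.2 - z.2.2‖ ^ (b + c) := by positivity
    have e1 : ‖z.1.1 - z.2.1‖ ^ (b + c) = 0 := by linarith
    have e2 : ‖z.1.2 - z.2.2‖ ^ (b + c) = 0 := by linarith
    rw [Real.rpow_eq_zero (norm_nonneg _) hr.ne', norm_eq_zero, sub_eq_zero] at e1 e2
    simp [e1, e2]
  · exact fun i => memLp_prodMk (memLp_prodMk (hu i) (hv i)) (memLp_prodMk hu₀ hv₀)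
  · intro i
    have i1 := integrable_norm_rpow hr (hu i)
    have i2 := integrable_norm_rpow hr (hv i)
    have i3 := integrable_norm_rpow hr hu₀
    have i4 := integrable_norm_rpow hr hv₀
    calc _ ≤ ∫ x, ((‖u i x‖ ^ (b + c) + ‖v i x‖ ^ (b + c))
            + (‖u₀ x‖ ^ (b + c) + ‖v₀ x‖ ^ (b + c))) ∂m := by
          refine integral_mono (integrable_norm_rpow hr (memLp_prodMk
            (memLp_prodMk (hu i) (hv i)) (memLp_prodMk hu₀ hv₀)))
            ((i1.add i2).add (i3.add i4)) fun x => ?_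
          exact (norm_prod_rpow_le _).trans (add_le_add (norm_prod_rpow_le _)
            (norm_prod_rpow_le _))
      _ ≤ _ := by
          have e := integral_add (i1.add i2) (i3.add i4)
          have e1 := integral_add i1 i2
          have e2 := integral_add i3 i4
          simp only [Pi.add_apply] at e e1 e2
          rw [e, e1, e2]
          linarith [hMu i, hMv i]
  · have := hlu.add hlv
    rw [add_zero] at this
    refine this.congr fun i => ?_
    exact (integral_add (integrable_norm_rpow hr ((hu i).sub hu₀))
      (integrable_norm_rpow hr ((hv i).sub hv₀))).symm

end Coupling

end DoublePhase

/-! ### Test functions, weak gradients and the Luxemburg norm -/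

namespace DoublePhase

section TestFunctions

variable {n : ℕ} {Ω : Set (EuclideanSpace ℝ (Fin n))}
  {φ ψ : EuclideanSpace ℝ (Fin n) → ℝ}

namespace IsTestFunction

lemma differentiable (h : IsTestFunction Ω φ) : Differentiable ℝ φ :=
  h.1.differentiable (by simp)

lemma continuous_fderiv (h : IsTestFunction Ω φ) : Continuous (fderiv ℝ φ) :=
  h.1.continuous_fderiv (by simp)

lemma continuous_gradient (h : IsTestFunction Ω φ) : Continuous (gradient φ) :=
  (InnerProductSpace.toDual ℝ _).symm.continuous.comp h.continuous_fderiv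

lemma hasCompactSupport_gradient (h : IsTestFunction Ω φ) : HasCompactSupport (gradient φ) :=
  (h.2.1.fderiv ℝ).comp_left (g := (InnerProductSpace.toDual ℝ _).symm) (map_zero _)

lemma add (h : IsTestFunction Ω φ) (h' : IsTestFunction Ω ψ) :
    IsTestFunction Ω (fun x => φ x + ψ x) :=
  ⟨h.1.add h'.1, h.2.1.add h'.2.1, (tsupport_add φ ψ).trans (union_subset h.2.2 h'.2.2)⟩

lemma const_mul (h : IsTestFunction Ω φ) (c : ℝ) : IsTestFunction Ω (fun x => c * φ x) :=
  ⟨contDiff_const.mul h.1, h.2.1.mul_left, (tsupport_mul_subset_right).trans h.2.2⟩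

lemma gradient_add (h : IsTestFunction Ω φ) (h' : IsTestFunction Ω ψ) (x) :
    gradient (fun x => φ x + ψ x) x = gradient φ x + gradient ψ x := by
  unfold gradient
  rw [fderiv_fun_add (h.differentiable x) (h'.differentiable x), map_add]

lemma gradient_const_mul (h : IsTestFunction Ω φ) (c : ℝ) (x) :
    gradient (fun x => c * φ x) x = c • gradient φ x := by
  unfold gradient
  rw [fderiv_const_mul (h.differentiable x)]
  simp

lemma memLp (h : IsTestFunction Ω φ) (r : ℝ≥0∞) (m : Measure (EuclideanSpace ℝ (Fin n)))
    [IsFiniteMeasureOnCompacts m] : MemLp φ r m :=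
  h.1.continuous.memLp_of_hasCompactSupport h.2.1

lemma memLp_gradient (h : IsTestFunction Ω φ) (r : ℝ≥0∞)
    (m : Measure (EuclideanSpace ℝ (Fin n))) [IsFiniteMeasureOnCompacts m] :
    MemLp (gradient φ) r m :=
  h.continuous_gradient.memLp_of_hasCompactSupport h.hasCompactSupport_gradient

lemma exists_bound (h : IsTestFunction Ω φ) : ∃ C, ∀ x, ‖φ x‖ ≤ C :=
  h.2.1.exists_bound_of_continuous h.1.continuous

lemma exists_bound_gradient (h : IsTestFunction Ω φ) : ∃ C, ∀ x, ‖gradient φ x‖ ≤ C :=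
  h.hasCompactSupport_gradient.exists_bound_of_continuous h.continuous_gradient

lemma isWeakGradient (h : IsTestFunction Ω φ) : IsWeakGradient Ω φ (gradient φ) := by
  refine ⟨h.1.continuous.locallyIntegrable.locallyIntegrableOn _,
    h.continuous_gradient.locallyIntegrable.locallyIntegrableOn _, fun ψ hψ v => ?_⟩
  have e1 : ∫ x in Ω, φ x * fderiv ℝ ψ x v = ∫ x, φ x * fderiv ℝ ψ x v :=
    setIntegral_eq_integral_of_forall_compl_eq_zero fun x hx => by
      rw [image_eq_zero_of_notMem_tsupport (fun h' => hx (h.2.2 h')), zero_mul]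
  have e2 : ∫ x in Ω, inner ℝ (gradient φ x) v * ψ x = ∫ x, fderiv ℝ φ x v * ψ x := by
    rw [setIntegral_eq_integral_of_forall_compl_eq_zero fun x hx => by
      rw [image_eq_zero_of_notMem_tsupport (fun h' => hx (hψ.2.2 h')), mul_zero]]
    simp_rw [inner_gradient_left]
  rw [e1, e2]
  have c1 : Continuous fun x => fderiv ℝ φ x v := h.continuous_fderiv.clm_apply continuous_const
  have c2 : Continuous fun x => fderiv ℝ ψ x v := hψ.continuous_fderiv.clm_apply continuous_const
  refine integral_mul_fderiv_eq_neg_fderiv_mul_of_integrable ?_ ?_ ?_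
    (fun x _ => h.differentiable x) (fun x _ => hψ.differentiable x)
  · exact (c1.mul hψ.1.continuous).integrable_of_hasCompactSupport hψ.2.1.mul_left
  · exact (h.1.continuous.mul c2).integrable_of_hasCompactSupport h.2.1.mul_right
  · exact (h.1.continuous.mul hψ.1.continuous).integrable_of_hasCompactSupport h.2.1.mul_right

end IsTestFunction

/-- Weak gradients are unique almost everywhere. -/
lemma IsWeakGradient.ae_eq (hΩ : IsOpen Ω) {y : EuclideanSpace ℝ (Fin n) → ℝ}
    {g g' : EuclideanSpace ℝ (Fin n) → EuclideanSpace ℝ (Fin n)}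
    (h : IsWeakGradient Ω y g) (h' : IsWeakGradient Ω y g') :
    g =ᵐ[volume.restrict Ω] g' := by
  have hli : LocallyIntegrableOn (fun x => g x - g' x) Ω := h.2.1.sub h'.2.1
  have key := hΩ.ae_eq_zero_of_integral_contDiff_smul_eq_zero hli fun φ h1 h2 h3 => ?_
  · refine (ae_restrict_iff' hΩ.measurableSet).2 ?_
    filter_upwards [key] with x hx hxΩ using sub_eq_zero.1 (hx hxΩ)
  have hφ : IsTestFunction Ω φ := ⟨h1, h2, h3⟩
  have hint : ∀ {f : EuclideanSpace ℝ (Fin n) → EuclideanSpace ℝ (Fin n)},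
      LocallyIntegrableOn f Ω → Integrable (fun x => φ x • f x) (volume.restrict Ω) := by
    intro f hf
    have hc : IntegrableOn f (tsupport φ) := hf.integrableOn_compact_subset h3 h2
    obtain ⟨C, hC⟩ := hφ.exists_bound
    have : IntegrableOn (fun x => φ x • f x) (tsupport φ) :=
      hc.bdd_smul C h1.continuous.aestronglyMeasurable (ae_of_all _ hC)
    have h4 : Integrable (fun x => φ x • f x) := by
      refine (integrableOn_iff_integrable_of_support_subset ?_).1 this
      exact (Function.support_smul_subset_left φ f).trans (subset_tsupport φ)
    exact h4.restrict
  rw [← setIntegral_eq_integral_of_forall_compl_eq_zero (s := Ω) fun x hx => by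
      rw [image_eq_zero_of_notMem_tsupport (fun h' => hx (h3 h')), zero_smul]]
  refine ext_inner_right ℝ fun v => ?_
  have e (f : EuclideanSpace ℝ (Fin n) → EuclideanSpace ℝ (Fin n))
      (hf : LocallyIntegrableOn f Ω) : inner ℝ (∫ x in Ω, φ x • f x) v
        = ∫ x in Ω, inner ℝ (f x) v * φ x := by
    rw [real_inner_comm, ← integral_inner (hint hf)]
    simp_rw [inner_smul_right, real_inner_comm v, mul_comm]
  rw [e _ hli, inner_zero_left]
  have e1 := h.2.2 φ hφ v
  have e2 := h'.2.2 φ hφ v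
  have := e g h.2.1
  have := e g' h'.2.1
  have e3 : ∫ x in Ω, φ x • (g x - g' x) = (∫ x in Ω, φ x • g x) - ∫ x in Ω, φ x • g' x := by
    rw [← integral_sub (hint h.2.1) (hint h'.2.1)]; simp_rw [smul_sub]
  rw [← e _ hli, e3, inner_sub_left, e _ h.2.1, e _ h'.2.1]
  linarith

lemma IsWeakGradient.sub {y y' : EuclideanSpace ℝ (Fin n) → ℝ}
    {g g' : EuclideanSpace ℝ (Fin n) → EuclideanSpace ℝ (Fin n)}
    (h : IsWeakGradient Ω y g) (h' : IsWeakGradient Ω y' g')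
    (hy : Integrable y (volume.restrict Ω)) (hy' : Integrable y' (volume.restrict Ω))
    (hg : Integrable g (volume.restrict Ω)) (hg' : Integrable g' (volume.restrict Ω)) :
    IsWeakGradient Ω (fun x => y x - y' x) (fun x => g x - g' x) := by
  refine ⟨h.1.sub h'.1, h.2.1.sub h'.2.1, fun φ hφ v => ?_⟩
  obtain ⟨C, hC⟩ := hφ.exists_bound
  obtain ⟨C', hC'⟩ := hφ.exists_bound_gradient
  have i1 {f : EuclideanSpace ℝ (Fin n) → ℝ} (hf : Integrable f (volume.restrict Ω)) :
      Integrable (fun x => f x * fderiv ℝ φ x v) (volume.restrict Ω) := by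
    refine Integrable.mul_bdd (c := C' * ‖v‖) hf
      (hφ.continuous_fderiv.clm_apply continuous_const).aestronglyMeasurable
      (ae_of_all _ fun x => ?_)
    rw [← inner_gradient_left]
    exact (norm_inner_le_norm _ _).trans (mul_le_mul_of_nonneg_right (hC' x) (norm_nonneg _))
  have i2 {f : EuclideanSpace ℝ (Fin n) → EuclideanSpace ℝ (Fin n)}
      (hf : Integrable f (volume.restrict Ω)) :
      Integrable (fun x => inner ℝ (f x) v * φ x) (volume.restrict Ω) :=
    Integrable.mul_bdd (c := C) (hf.inner_const v) hφ.1.continuous.aestronglyMeasurable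
      (ae_of_all _ hC)
  simp_rw [sub_mul, inner_sub_left, sub_mul]
  rw [integral_sub (i1 hy) (i1 hy'), integral_sub (i2 hg) (i2 hg'), h.2.2 φ hφ v, h'.2.2 φ hφ v]
  ring

lemma isWeakGradient_weakGrad {y : EuclideanSpace ℝ (Fin n) → ℝ}
    (h : ∃ g, IsWeakGradient Ω y g) : IsWeakGradient Ω y (weakGrad Ω y) := by
  unfold weakGrad
  rw [dif_pos h]
  exact h.choose_spec

end TestFunctions

namespace Data

variable {n : ℕ} (P : Data n)

/-- The degree `k = κ₁ + κ₂ + 2` of homogeneity of the coupling term. -/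
def deg : ℝ := P.κ₁ + 1 + (P.κ₂ + 1)

/-- The measure `η dz` on `Ω`; the space `L^H(Ω)` is `L^p(μ) ∩ L^q(μη)`. -/
noncomputable def μη : Measure (EuclideanSpace ℝ (Fin n)) :=
  P.μ.withDensity fun x => ENNReal.ofReal (P.η x)

/-- The standing assumptions on the data of the system. -/
structure Admissible : Prop where
  isOpen : IsOpen P.Ω
  nonempty : P.Ω.Nonempty
  bounded : Bornology.IsBounded P.Ω
  exps : Exponents P.p P.q P.ν P.deg
  p_lt_n : P.p < n
  q_lt₁ : P.q < P.κ₁ + 1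
  q_lt₂ : P.q < P.κ₂ + 1
  crit : P.deg < critExp n P.p
  η_memLp : MemLp P.η ⊤ P.μ
  η_nonneg : ∀ᵐ x ∂P.μ, 0 ≤ P.η x
  a₁_memLp : MemLp P.a₁ ⊤ P.μ
  a₁_pos : ∀ᵐ x ∂P.μ, 0 < P.a₁ x
  a₂_memLp : MemLp P.a₂ ⊤ P.μ
  a₂_pos : ∀ᵐ x ∂P.μ, 0 < P.a₂ x

variable {P}

namespace Admissible

variable (hP : P.Admissible)
include hP

lemma p_pos : 0 < P.p := by linarith [hP.exps.p_gt]
lemma q_pos : 0 < P.q := by linarith [hP.exps.p_gt, hP.exps.p_lt]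
lemma deg_pos : 0 < P.deg := by linarith [hP.q_pos, hP.exps.q_lt]

lemma one_le_p : (1 : ℝ≥0∞) ≤ ENNReal.ofReal P.p := by
  rw [← ENNReal.ofReal_one]; exact ENNReal.ofReal_le_ofReal hP.exps.p_gt.le

lemma one_le_q : (1 : ℝ≥0∞) ≤ ENNReal.ofReal P.q :=
  hP.one_le_p.trans (ENNReal.ofReal_le_ofReal hP.exps.p_lt.le)

lemma isFiniteMeasure : IsFiniteMeasure P.μ :=
  ⟨by rw [μ, Measure.restrict_apply_univ]; exact hP.bounded.measure_lt_top⟩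

omit hP in
lemma μη_ac : P.μη ≪ P.μ := withDensity_absolutelyContinuous _ _

lemma exists_μη_le : ∃ c : NNReal, P.μη ≤ (c : ℝ≥0∞) • P.μ := by
  refine ⟨(eLpNorm P.η ⊤ P.μ).toNNReal, ?_⟩
  rw [ENNReal.coe_toNNReal hP.η_memLp.2.ne, ← withDensity_const]
  refine withDensity_mono ?_
  filter_upwards [ae_le_eLpNormEssSup (f := P.η) (μ := P.μ)] with x hx
  rw [eLpNorm_exponent_top]
  exact (Real.ofReal_le_enorm (P.η x)).trans hx

lemma exists_eLpNorm_μη_le {V : Type*} [NormedAddCommGroup V] (r : ℝ≥0∞) : ∃ c : ℝ≥0∞, c ≠ ⊤ ∧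
    ∀ f : EuclideanSpace ℝ (Fin n) → V, eLpNorm f r P.μη ≤ c * eLpNorm f r P.μ := by
  obtain ⟨c, hc⟩ := hP.exists_μη_le
  refine ⟨(c : ℝ≥0∞) ^ (1 / r).toReal, by simp, fun f => ?_⟩
  have := eLpNorm_le_of_measure_le_smul (f := f) (p := r) hc
  simpa using this

lemma isFiniteMeasure_μη : IsFiniteMeasure P.μη := by
  obtain ⟨c, hc⟩ := hP.exists_μη_le
  have := hP.isFiniteMeasure
  have : IsFiniteMeasure ((c : ℝ≥0∞) • P.μ) := Measure.smul_finite _ ENNReal.coe_ne_top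
  exact isFiniteMeasure_of_le _ hc

lemma η_toReal : (fun x => (ENNReal.ofReal (P.η x)).toReal) =ᵐ[P.μ] P.η := by
  filter_upwards [hP.η_nonneg] with x hx using ENNReal.toReal_ofReal hx

lemma η_aemeasurable : AEMeasurable (fun x => ENNReal.ofReal (P.η x)) P.μ :=
  hP.η_memLp.1.aemeasurable.ennreal_ofReal

lemma integral_μη (f : EuclideanSpace ℝ (Fin n) → ℝ) :
    ∫ x, f x ∂P.μη = ∫ x, P.η x * f x ∂P.μ := by
  rw [μη, integral_withDensity_eq_integral_toReal_smul₀ hP.η_aemeasurable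
    (ae_of_all _ fun x => ENNReal.ofReal_lt_top)]
  refine integral_congr_ae ?_
  filter_upwards [hP.η_toReal] with x hx
  rw [hx, smul_eq_mul]

end Admissible

lemma eLpNorm_rpow_eq {α V : Type*} [NormedAddCommGroup V] {mα : MeasurableSpace α}
    (m : Measure α) {r : ℝ} (hr : 0 < r) (f : α → V) :
    (eLpNorm f (ENNReal.ofReal r) m) ^ r = ∫⁻ x, ‖f x‖ₑ ^ r ∂m := by
  rw [eLpNorm_eq_lintegral_rpow_enorm_toReal (by simpa using hr) ENNReal.ofReal_ne_top,
    ENNReal.toReal_ofReal hr.le, ← ENNReal.rpow_mul, one_div, inv_mul_cancel₀ hr.ne',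
    ENNReal.rpow_one]

/-- The modular in terms of the norms of `L^p(μ)` and `L^q(μη)`. -/
lemma Admissible.modular_eq (hP : P.Admissible) {u : EuclideanSpace ℝ (Fin n) → ℝ}
    (hu : AEStronglyMeasurable u P.μ) :
    P.modular u = (eLpNorm u (ENNReal.ofReal P.p) P.μ) ^ P.p
      + (eLpNorm u (ENNReal.ofReal P.q) P.μη) ^ P.q := by
  rw [eLpNorm_rpow_eq _ hP.p_pos, eLpNorm_rpow_eq _ hP.q_pos, μη,
    lintegral_withDensity_eq_lintegral_mul₀ hP.η_aemeasurable
      (hu.enorm.pow_const _),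
    ← lintegral_add_left' (hu.enorm.pow_const _)]
  refine lintegral_congr_ae ?_
  filter_upwards [hP.η_nonneg] with x hx
  have h1 : 0 ≤ |u x| ^ P.p := by positivity
  have h2 : 0 ≤ P.η x * |u x| ^ P.q := by positivity
  rw [ENNReal.ofReal_add h1 h2, ENNReal.ofReal_mul hx, Pi.mul_apply,
    ← ENNReal.ofReal_rpow_of_nonneg (abs_nonneg _) hP.p_pos.le,
    ← ENNReal.ofReal_rpow_of_nonneg (abs_nonneg _) hP.q_pos.le, ← Real.enorm_eq_ofReal_abs]

/-- Membership of a vector-valued function in `L^H(Ω)`, read as `L^p(μ) ∩ L^q(μη)`. -/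
def MemH {V : Type*} [NormedAddCommGroup V] (P : Data n) (f : EuclideanSpace ℝ (Fin n) → V) :
    Prop :=
  MemLp f (ENNReal.ofReal P.p) P.μ ∧ MemLp f (ENNReal.ofReal P.q) P.μη

lemma Admissible.memLH_iff (hP : P.Admissible) {u : EuclideanSpace ℝ (Fin n) → ℝ} :
    P.MemLH u ↔ P.MemH u := by
  constructor
  · rintro ⟨h1, h2⟩
    rw [hP.modular_eq h1, ENNReal.add_lt_top, ENNReal.rpow_lt_top_iff_of_pos hP.p_pos,
      ENNReal.rpow_lt_top_iff_of_pos hP.q_pos] at h2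
    exact ⟨⟨h1, h2.1⟩, ⟨h1.mono_ac Admissible.μη_ac, h2.2⟩⟩
  · rintro ⟨h1, h2⟩
    refine ⟨h1.1, ?_⟩
    rw [hP.modular_eq h1.1, ENNReal.add_lt_top, ENNReal.rpow_lt_top_iff_of_pos hP.p_pos,
      ENNReal.rpow_lt_top_iff_of_pos hP.q_pos]
    exact ⟨h1.2, h2.2⟩

lemma eLpNorm_div_const {α : Type*} {mα : MeasurableSpace α} (m : Measure α) (r : ℝ≥0∞)
    (u : α → ℝ) {τ : ℝ} (hτ : 0 < τ) :
    eLpNorm (fun x => u x / τ) r m = eLpNorm u r m / ENNReal.ofReal τ := by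
  have : (fun x => u x / τ) = τ⁻¹ • u := by
    ext x; simp [div_eq_inv_mul]
  rw [this, eLpNorm_const_smul, ENNReal.div_eq_inv_mul, Real.enorm_of_nonneg (by positivity),
    ENNReal.ofReal_inv_of_pos hτ]

lemma Admissible.modular_div_eq (hP : P.Admissible) {u : EuclideanSpace ℝ (Fin n) → ℝ}
    (hu : AEStronglyMeasurable u P.μ) {τ : ℝ} (hτ : 0 < τ) :
    P.modular (fun x => u x / τ) = (eLpNorm u (ENNReal.ofReal P.p) P.μ / ENNReal.ofReal τ) ^ P.p
      + (eLpNorm u (ENNReal.ofReal P.q) P.μη / ENNReal.ofReal τ) ^ P.q := by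
  rw [hP.modular_eq (by simpa only [div_eq_mul_inv] using hu.mul_const _),
    eLpNorm_div_const _ _ _ hτ, eLpNorm_div_const _ _ _ hτ]

/-- Here `τ / 2` suffices because `2 ^ (-r) ≤ 1 / 2` for the exponents `r = p, q ≥ 1`. -/
lemma Admissible.modular_div_le_one (hP : P.Admissible) {u : EuclideanSpace ℝ (Fin n) → ℝ}
    (hu : AEStronglyMeasurable u P.μ) {τ : ℝ} (hτ : 0 < τ)
    (h1 : eLpNorm u (ENNReal.ofReal P.p) P.μ ≤ ENNReal.ofReal (τ / 2))
    (h2 : eLpNorm u (ENNReal.ofReal P.q) P.μη ≤ ENNReal.ofReal (τ / 2)) :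
    P.modular (fun x => u x / τ) ≤ 1 := by
  rw [hP.modular_div_eq hu hτ, ← ENNReal.inv_two_add_inv_two]
  have key : ∀ (a : ℝ≥0∞) (r : ℝ), 1 ≤ r → a ≤ ENNReal.ofReal (τ / 2) →
      (a / ENNReal.ofReal τ) ^ r ≤ 2⁻¹ := by
    intro a r hr ha
    have h3 : a / ENNReal.ofReal τ ≤ 2⁻¹ := by
      refine ENNReal.div_le_of_le_mul (ha.trans_eq ?_)
      rw [div_eq_inv_mul, ENNReal.ofReal_mul (by norm_num), ENNReal.ofReal_inv_of_pos two_pos]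
      simp
    calc (a / ENNReal.ofReal τ) ^ r ≤ (2⁻¹ : ℝ≥0∞) ^ r :=
          ENNReal.rpow_le_rpow h3 (by linarith)
      _ ≤ (2⁻¹ : ℝ≥0∞) ^ (1 : ℝ) := ENNReal.rpow_le_rpow_of_exponent_ge (by simp) hr
      _ = 2⁻¹ := ENNReal.rpow_one _
  exact add_le_add (key _ _ hP.exps.p_gt.le h1)
    (key _ _ (hP.exps.p_gt.trans hP.exps.p_lt).le h2)

lemma Admissible.luxNorm_le (hP : P.Admissible) {u : EuclideanSpace ℝ (Fin n) → ℝ}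
    (hu : AEStronglyMeasurable u P.μ) {τ : ℝ} (hτ : 0 < τ)
    (h1 : eLpNorm u (ENNReal.ofReal P.p) P.μ ≤ ENNReal.ofReal (τ / 2))
    (h2 : eLpNorm u (ENNReal.ofReal P.q) P.μη ≤ ENNReal.ofReal (τ / 2)) :
    P.luxNorm u ≤ τ :=
  csInf_le ⟨0, fun _ h => h.1.le⟩ ⟨hτ, hP.modular_div_le_one hu hτ h1 h2⟩

lemma luxNorm_nonneg (u : EuclideanSpace ℝ (Fin n) → ℝ) : 0 ≤ P.luxNorm u :=
  Real.sInf_nonneg fun _ h => h.1.le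

lemma Admissible.eLpNorm_le_of_luxNorm_lt (hP : P.Admissible)
    {u : EuclideanSpace ℝ (Fin n) → ℝ} (hu : P.MemH u) {τ : ℝ} (h : P.luxNorm u < τ) :
    eLpNorm u (ENNReal.ofReal P.p) P.μ ≤ ENNReal.ofReal τ ∧
      eLpNorm u (ENNReal.ofReal P.q) P.μη ≤ ENNReal.ofReal τ := by
  -- for an empty set the infimum `luxNorm u` would be the junk value `0`
  have hne : {τ : ℝ | 0 < τ ∧ P.modular (fun x => u x / τ) ≤ 1}.Nonempty := by
    set a := (eLpNorm u (ENNReal.ofReal P.p) P.μ).toReal with ha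
    set b := (eLpNorm u (ENNReal.ofReal P.q) P.μη).toReal with hb
    have ha0 : 0 ≤ a := ENNReal.toReal_nonneg
    have hb0 : 0 ≤ b := ENNReal.toReal_nonneg
    refine ⟨2 * (a + b + 1), by positivity, hP.modular_div_le_one hu.1.1 (by positivity) ?_ ?_⟩
    · rw [← ENNReal.ofReal_toReal hu.1.2.ne]
      exact ENNReal.ofReal_le_ofReal (by linarith)
    · rw [← ENNReal.ofReal_toReal hu.2.2.ne]
      exact ENNReal.ofReal_le_ofReal (by linarith)
  obtain ⟨σ, ⟨hσ, hmod⟩, hστ⟩ := exists_lt_of_csInf_lt hne h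
  rw [hP.modular_div_eq hu.1.1 hσ] at hmod
  have key : ∀ (a : ℝ≥0∞) (r : ℝ), 0 < r → (a / ENNReal.ofReal σ) ^ r ≤ 1 →
      a ≤ ENNReal.ofReal τ := by
    intro a r hr ha
    have h1 : a / ENNReal.ofReal σ ≤ 1 := by
      rwa [← ENNReal.rpow_le_rpow_iff hr, ENNReal.one_rpow]
    have hσ' : ENNReal.ofReal σ ≠ 0 := by simpa using hσ
    rw [ENNReal.div_le_iff hσ' ENNReal.ofReal_ne_top, one_mul] at h1
    exact h1.trans (ENNReal.ofReal_le_ofReal hστ.le)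
  exact ⟨key _ _ hP.p_pos (le_trans le_self_add hmod),
    key _ _ hP.q_pos (le_trans le_add_self hmod)⟩

end Data

end DoublePhase

/-! ### The space `W_0^{1,H}(Ω)` and Sobolev's inequality -/

namespace DoublePhase

section Approximation

variable {α V : Type*} {mα : MeasurableSpace α} {m : Measure α} [NormedAddCommGroup V]

/-- Fatou's lemma for `L^s`-approximation: norm bounds pass to the limit. -/
lemma eLpNorm_le_of_approx {r s : ℝ≥0∞} (hs : s ≠ 0) {f : α → V} (hf : AEStronglyMeasurable f m)
    {M : ℝ≥0∞} (h : ∀ ε : ℝ≥0∞, ε ≠ 0 → ∃ f' : α → V, AEStronglyMeasurable f' m ∧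
      eLpNorm (fun x => f x - f' x) s m ≤ ε ∧ eLpNorm f' r m ≤ M) : eLpNorm f r m ≤ M := by
  choose F hF1 hF2 hF3 using fun j : ℕ => h ((j : ℝ≥0∞) + 1)⁻¹ (by simp)
  have h0 : Tendsto (fun j => eLpNorm (F j - f) s m) atTop (𝓝 0) := by
    refine tendsto_of_tendsto_of_tendsto_of_le_of_le tendsto_const_nhds
      (ENNReal.tendsto_inv_nat_nhds_zero.comp (tendsto_add_atTop_nat 1)) (fun _ => zero_le)
      fun j => ?_
    rw [eLpNorm_sub_comm]
    refine (hF2 j).trans (le_of_eq ?_)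
    simp
  obtain ⟨ns, -, hns⟩ := (tendstoInMeasure_of_tendsto_eLpNorm hs hF1 hf h0).exists_seq_tendsto_ae
  refine (Lp.eLpNorm_lim_le_liminf_eLpNorm (fun j => hF1 (ns j)) f hns).trans ?_
  exact (liminf_le_liminf (Eventually.of_forall fun j => hF3 (ns j))).trans_eq
    (liminf_const M)

lemma exists_ofReal_le {c ε : ℝ≥0∞} (hc : c ≠ ⊤) (hε : ε ≠ 0) :
    ∃ τ : ℝ, 0 < τ ∧ ENNReal.ofReal τ ≤ ε ∧ c * ENNReal.ofReal τ ≤ ε := by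
  have h1 : ε / (c + 1) ≠ 0 := by
    simp [ENNReal.div_eq_zero_iff, hε, hc]
  obtain ⟨δ, hδ0, hδ⟩ := ENNReal.lt_iff_exists_nnreal_btwn.1 (pos_iff_ne_zero.2 h1)
  have h2 : (c + 1) * (δ : ℝ≥0∞) ≤ ε := by
    rw [mul_comm]
    exact ENNReal.mul_le_of_le_div hδ.le
  have h3 : ENNReal.ofReal (δ : ℝ) = δ := ENNReal.ofReal_coe_nnreal
  refine ⟨δ, by exact_mod_cast hδ0, ?_, ?_⟩
  · rw [h3]; refine le_trans ?_ h2; rw [add_mul, one_mul]; exact le_add_self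
  · rw [h3]; refine le_trans ?_ h2; rw [add_mul, one_mul]; exact le_self_add

lemma exists_eLpNorm_one_le [IsFiniteMeasure m] {r : ℝ≥0∞} (hr : 1 ≤ r) : ∃ c : ℝ≥0∞, c ≠ ⊤ ∧
    ∀ f : α → V, AEStronglyMeasurable f m → eLpNorm f 1 m ≤ c * eLpNorm f r m := by
  refine ⟨m univ ^ (1 / (1 : ℝ≥0∞).toReal - 1 / r.toReal), ?_, fun f hf => ?_⟩
  · refine ENNReal.rpow_ne_top_of_nonneg ?_ (measure_ne_top _ _)
    rcases eq_or_ne r ⊤ with rfl | hr'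
    · simp
    · have : 1 ≤ r.toReal := by
        rw [← ENNReal.toReal_one]; exact ENNReal.toReal_mono hr' hr
      simp only [ENNReal.toReal_one, div_one, sub_nonneg]
      rw [one_div]
      exact inv_le_one_of_one_le₀ this
  · rw [mul_comm]
    exact eLpNorm_le_eLpNorm_mul_rpow_measure_univ hr hf

end Approximation

namespace Data

variable {n : ℕ} {P : Data n}

/-- `y ∈ W_0^{1,H}(Ω)` with weak gradient `g`: the pair is a limit of pairs `(φ, ∇φ)` with test
functions `φ`, in `L¹` for the first component and in `L^p(μ) ∩ L^q(μη)` for the second one.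
By Sobolev's inequality this controls the full norm, see `Admissible.exists_memH_le`. -/
structure IsW0 (P : Data n) (y : EuclideanSpace ℝ (Fin n) → ℝ)
    (g : EuclideanSpace ℝ (Fin n) → EuclideanSpace ℝ (Fin n)) : Prop where
  meas : AEStronglyMeasurable y P.μ
  meas_grad : AEStronglyMeasurable g P.μ
  approx : ∀ ε : ℝ≥0∞, ε ≠ 0 → ∃ φ, IsTestFunction P.Ω φ ∧
    eLpNorm (fun x => y x - φ x) 1 P.μ ≤ ε ∧
    eLpNorm (fun x => g x - gradient φ x) (ENNReal.ofReal P.p) P.μ ≤ ε ∧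
    eLpNorm (fun x => g x - gradient φ x) (ENNReal.ofReal P.q) P.μη ≤ ε

lemma isFiniteMeasureOnCompacts_μ : IsFiniteMeasureOnCompacts P.μ := by
  unfold μ; infer_instance

namespace IsW0

variable {y y' : EuclideanSpace ℝ (Fin n) → ℝ}
  {g g' : EuclideanSpace ℝ (Fin n) → EuclideanSpace ℝ (Fin n)}

lemma of_test {φ : EuclideanSpace ℝ (Fin n) → ℝ} (h : IsTestFunction P.Ω φ) :
    P.IsW0 φ (gradient φ) :=
  ⟨h.1.continuous.aestronglyMeasurable, h.continuous_gradient.aestronglyMeasurable,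
    fun ε _ => ⟨φ, h, by simp⟩⟩

lemma congr (h : P.IsW0 y g) (hy : y =ᵐ[P.μ] y') (hg : g =ᵐ[P.μ] g') : P.IsW0 y' g' := by
  refine ⟨h.meas.congr hy, h.meas_grad.congr hg, fun ε hε => ?_⟩
  obtain ⟨φ, h1, h2, h3, h4⟩ := h.approx ε hε
  have hg' : g =ᵐ[P.μη] g' := Admissible.μη_ac.ae_eq hg
  exact ⟨φ, h1, (eLpNorm_congr_ae (hy.sub (EventuallyEq.refl _ φ))).symm.trans_le h2,
    (eLpNorm_congr_ae (hg.sub (EventuallyEq.refl _ (gradient φ)))).symm.trans_le h3,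
    (eLpNorm_congr_ae (hg'.sub (EventuallyEq.refl _ (gradient φ)))).symm.trans_le h4⟩

lemma integrable (h : P.IsW0 y g) : Integrable y P.μ := by
  obtain ⟨φ, h1, h2, -⟩ := h.approx 1 one_ne_zero
  have := isFiniteMeasureOnCompacts_μ (P := P)
  have h3 : MemLp (fun x => y x - φ x) 1 P.μ :=
    ⟨h.meas.sub h1.1.continuous.aestronglyMeasurable, h2.trans_lt ENNReal.one_lt_top⟩
  rw [← memLp_one_iff_integrable]
  exact (h3.add (h1.memLp 1 P.μ)).ae_eq (ae_of_all _ fun x => by simp)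

lemma memH (hP : P.Admissible) (h : P.IsW0 y g) : P.MemH g := by
  obtain ⟨φ, h1, -, h2, h3⟩ := h.approx 1 one_ne_zero
  have := isFiniteMeasureOnCompacts_μ (P := P)
  have := hP.isFiniteMeasure_μη
  have hm : AEStronglyMeasurable (fun x => g x - gradient φ x) P.μ :=
    h.meas_grad.sub h1.continuous_gradient.aestronglyMeasurable
  have h4 : MemLp (fun x => g x - gradient φ x) (ENNReal.ofReal P.p) P.μ :=
    ⟨hm, h2.trans_lt ENNReal.one_lt_top⟩
  have h5 : MemLp (fun x => g x - gradient φ x) (ENNReal.ofReal P.q) P.μη :=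
    ⟨hm.mono_ac Admissible.μη_ac, h3.trans_lt ENNReal.one_lt_top⟩
  exact ⟨(h4.add (h1.memLp_gradient _ P.μ)).ae_eq (ae_of_all _ fun x => by simp),
    (h5.add (h1.memLp_gradient _ P.μη)).ae_eq (ae_of_all _ fun x => by simp)⟩

/-- `W_0` is closed. -/
lemma of_approx (hP : P.Admissible) (hy : AEStronglyMeasurable y P.μ)
    (hg : AEStronglyMeasurable g P.μ)
    (h : ∀ ε : ℝ≥0∞, ε ≠ 0 → ∃ y' g', P.IsW0 y' g' ∧ eLpNorm (fun x => y x - y' x) 1 P.μ ≤ ε ∧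
      eLpNorm (fun x => g x - g' x) (ENNReal.ofReal P.p) P.μ ≤ ε ∧
      eLpNorm (fun x => g x - g' x) (ENNReal.ofReal P.q) P.μη ≤ ε) : P.IsW0 y g := by
  refine ⟨hy, hg, fun ε hε => ?_⟩
  have hε2 : ε / 2 ≠ 0 := by simp [hε]
  obtain ⟨y', g', hW, h1, h2, h3⟩ := h (ε / 2) hε2
  obtain ⟨φ, hφ, h4, h5, h6⟩ := hW.approx (ε / 2) hε2
  have hφ1 : AEStronglyMeasurable φ P.μ := hφ.1.continuous.aestronglyMeasurable
  have hφ2 : AEStronglyMeasurable (gradient φ) P.μ := hφ.continuous_gradient.aestronglyMeasurable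
  refine ⟨φ, hφ, ?_, ?_, ?_⟩
  · have := eLpNorm_add_le (hy.sub hW.meas) (hW.meas.sub hφ1) (le_refl 1)
    refine le_trans (le_of_eq ?_) (this.trans ((add_le_add h1 h4).trans_eq (ENNReal.add_halves ε)))
    congr 1; ext x; simp
  · have := eLpNorm_add_le (hg.sub hW.meas_grad) (hW.meas_grad.sub hφ2) hP.one_le_p
    refine le_trans (le_of_eq ?_) (this.trans ((add_le_add h2 h5).trans_eq (ENNReal.add_halves ε)))
    congr 1; ext x; simp
  · have := eLpNorm_add_le ((hg.sub hW.meas_grad).mono_ac Admissible.μη_ac)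
      ((hW.meas_grad.sub hφ2).mono_ac Admissible.μη_ac) hP.one_le_q
    refine le_trans (le_of_eq ?_) (this.trans ((add_le_add h3 h6).trans_eq (ENNReal.add_halves ε)))
    congr 1; ext x; simp

lemma add (hP : P.Admissible) (h : P.IsW0 y g) (h' : P.IsW0 y' g') :
    P.IsW0 (fun x => y x + y' x) (fun x => g x + g' x) := by
  refine ⟨h.meas.add h'.meas, h.meas_grad.add h'.meas_grad, fun ε hε => ?_⟩
  have hε2 : ε / 2 ≠ 0 := by simp [hε]
  obtain ⟨φ, hφ, h1, h2, h3⟩ := h.approx (ε / 2) hε2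
  obtain ⟨ψ, hψ, h4, h5, h6⟩ := h'.approx (ε / 2) hε2
  have m1 : AEStronglyMeasurable φ P.μ := hφ.1.continuous.aestronglyMeasurable
  have m2 : AEStronglyMeasurable (gradient φ) P.μ := hφ.continuous_gradient.aestronglyMeasurable
  have m3 : AEStronglyMeasurable ψ P.μ := hψ.1.continuous.aestronglyMeasurable
  have m4 : AEStronglyMeasurable (gradient ψ) P.μ := hψ.continuous_gradient.aestronglyMeasurable
  refine ⟨_, hφ.add hψ, ?_, ?_, ?_⟩
  · have := eLpNorm_add_le (h.meas.sub m1) (h'.meas.sub m3) (le_refl 1)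
    refine le_trans (le_of_eq ?_) (this.trans ((add_le_add h1 h4).trans_eq (ENNReal.add_halves ε)))
    congr 1; ext x; simp only [Pi.add_apply, Pi.sub_apply]; ring
  · have := eLpNorm_add_le (h.meas_grad.sub m2) (h'.meas_grad.sub m4) hP.one_le_p
    refine le_trans (le_of_eq ?_) (this.trans ((add_le_add h2 h5).trans_eq (ENNReal.add_halves ε)))
    congr 1; funext x; rw [hφ.gradient_add hψ, Pi.add_apply, Pi.sub_apply, Pi.sub_apply]; abel
  · have := eLpNorm_add_le ((h.meas_grad.sub m2).mono_ac Admissible.μη_ac)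
      ((h'.meas_grad.sub m4).mono_ac Admissible.μη_ac) hP.one_le_q
    refine le_trans (le_of_eq ?_) (this.trans ((add_le_add h3 h6).trans_eq (ENNReal.add_halves ε)))
    congr 1; funext x; rw [hφ.gradient_add hψ, Pi.add_apply, Pi.sub_apply, Pi.sub_apply]; abel

lemma const_mul (h : P.IsW0 y g) (c : ℝ) :
    P.IsW0 (fun x => c * y x) (fun x => c • g x) := by
  refine ⟨h.meas.const_mul c, h.meas_grad.const_smul c, fun ε hε => ?_⟩
  obtain ⟨τ, hτ, -, hτε⟩ := exists_ofReal_le (c := ‖c‖ₑ) enorm_ne_top hε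
  obtain ⟨φ, hφ, h1, h2, h3⟩ := h.approx (ENNReal.ofReal τ) (by simpa using hτ)
  refine ⟨_, hφ.const_mul c, ?_, ?_, ?_⟩
  · have : (fun x => c * y x - c * φ x) = c • fun x => y x - φ x := by
      ext x; simp [mul_sub]
    rw [this, eLpNorm_const_smul]
    exact (mul_le_mul_right h1 _).trans hτε
  · have : (fun x => c • g x - gradient (fun x => c * φ x) x) = c • fun x => g x - gradient φ x := by
      funext x; rw [hφ.gradient_const_mul, Pi.smul_apply, smul_sub]
    rw [this, eLpNorm_const_smul]
    exact (mul_le_mul_right h2 _).trans hτε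
  · have : (fun x => c • g x - gradient (fun x => c * φ x) x) = c • fun x => g x - gradient φ x := by
      funext x; rw [hφ.gradient_const_mul, Pi.smul_apply, smul_sub]
    rw [this, eLpNorm_const_smul]
    exact (mul_le_mul_right h3 _).trans hτε

lemma sub (hP : P.Admissible) (h : P.IsW0 y g) (h' : P.IsW0 y' g') :
    P.IsW0 (fun x => y x - y' x) (fun x => g x - g' x) :=
  (h.add hP (h'.const_mul (-1))).congr (ae_of_all _ fun x => by ring)
    (ae_of_all _ fun x => by simp [sub_eq_add_neg])

lemma integrable_grad (hP : P.Admissible) (h : P.IsW0 y g) : Integrable g P.μ := by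
  have := hP.isFiniteMeasure
  exact (h.memH hP).1.integrable hP.one_le_p

lemma isWeakGradient (hP : P.Admissible) (h : P.IsW0 y g) : IsWeakGradient P.Ω y g := by
  have hy : Integrable y P.μ := h.integrable
  have hg : Integrable g P.μ := h.integrable_grad hP
  have hfin := hP.isFiniteMeasure
  refine ⟨IntegrableOn.locallyIntegrableOn hy, IntegrableOn.locallyIntegrableOn hg,
    fun ψ hψ v => ?_⟩
  obtain ⟨C, hC⟩ := hψ.exists_bound
  obtain ⟨C', hC'⟩ := hψ.exists_bound_gradient
  have hC0 : 0 ≤ C := (norm_nonneg _).trans (hC 0)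
  have hC0' : 0 ≤ C' := (norm_nonneg _).trans (hC' 0)
  have b1 : ∀ x, ‖fderiv ℝ ψ x v‖ ≤ C' * ‖v‖ := fun x => by
    rw [← inner_gradient_left]
    exact (norm_inner_le_norm _ _).trans (mul_le_mul_of_nonneg_right (hC' x) (norm_nonneg _))
  have m1 : AEStronglyMeasurable (fun x => fderiv ℝ ψ x v) P.μ :=
    (hψ.continuous_fderiv.clm_apply continuous_const).aestronglyMeasurable
  obtain ⟨c, hc, hcle⟩ := exists_eLpNorm_one_le (V := EuclideanSpace ℝ (Fin n)) (m := P.μ)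
    hP.one_le_p
  rw [← sub_eq_zero, sub_neg_eq_add]
  refine abs_nonpos_iff.1 (le_of_forall_pos_le_add fun ε hε => ?_)
  rw [zero_add]
  set K := C' * ‖v‖ + C * ‖v‖ + 1 with hK
  have hK0 : 0 < K := by positivity
  obtain ⟨τ, hτ, hτ1, hτ2⟩ := exists_ofReal_le hc (ε := ENNReal.ofReal (ε / K))
    (by simpa using div_pos hε hK0)
  obtain ⟨φ, hφ, h1, h2, -⟩ := h.approx (ENNReal.ofReal τ) (by simpa using hτ)
  have i1 : Integrable (fun x => y x - φ x) P.μ :=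
    hy.sub (memLp_one_iff_integrable.1 (hφ.memLp 1 _))
  have i2 : Integrable (fun x => g x - gradient φ x) P.μ :=
    hg.sub (memLp_one_iff_integrable.1 (hφ.memLp_gradient 1 _))
  have n1 : ∫ x, ‖y x - φ x‖ ∂P.μ ≤ ε / K := by
    have := h1.trans hτ1
    rw [eLpNorm_one_eq_lintegral_enorm, ← ofReal_integral_norm_eq_lintegral_enorm i1] at this
    exact (ENNReal.ofReal_le_ofReal_iff (by positivity)).1 this
  have n2 : ∫ x, ‖g x - gradient φ x‖ ∂P.μ ≤ ε / K := by
    have := ((hcle _ i2.1).trans (mul_le_mul_right h2 _)).trans hτ2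
    rw [eLpNorm_one_eq_lintegral_enorm, ← ofReal_integral_norm_eq_lintegral_enorm i2] at this
    exact (ENNReal.ofReal_le_ofReal_iff (by positivity)).1 this
  have hφw := (hφ.isWeakGradient).2.2 ψ hψ v
  have j1 {f : EuclideanSpace ℝ (Fin n) → ℝ} (hf : Integrable f P.μ) :
      Integrable (fun x => f x * fderiv ℝ ψ x v) P.μ :=
    Integrable.mul_bdd (c := C' * ‖v‖) hf m1 (ae_of_all _ b1)
  have j2 {f : EuclideanSpace ℝ (Fin n) → EuclideanSpace ℝ (Fin n)} (hf : Integrable f P.μ) :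
      Integrable (fun x => inner ℝ (f x) v * ψ x) P.μ :=
    Integrable.mul_bdd (c := C) (hf.inner_const v) hψ.1.continuous.aestronglyMeasurable
      (ae_of_all _ hC)
  have e1 : ∫ x in P.Ω, y x * fderiv ℝ ψ x v =
      (∫ x, (y x - φ x) * fderiv ℝ ψ x v ∂P.μ) + ∫ x, φ x * fderiv ℝ ψ x v ∂P.μ := by
    rw [← integral_add (j1 i1) (j1 (memLp_one_iff_integrable.1 (hφ.memLp 1 _)))]
    exact integral_congr_ae (ae_of_all _ fun x => by ring)
  have e2 : ∫ x in P.Ω, inner ℝ (g x) v * ψ x =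
      (∫ x, inner ℝ (g x - gradient φ x) v * ψ x ∂P.μ)
        + ∫ x, inner ℝ (gradient φ x) v * ψ x ∂P.μ := by
    rw [← integral_add (j2 i2) (j2 (memLp_one_iff_integrable.1 (hφ.memLp_gradient 1 _)))]
    refine integral_congr_ae (ae_of_all _ fun x => ?_)
    beta_reduce
    rw [inner_sub_left]; ring
  have q1 : |∫ x, (y x - φ x) * fderiv ℝ ψ x v ∂P.μ| ≤ ε / K * (C' * ‖v‖) := by
    rw [← Real.norm_eq_abs]
    refine (norm_integral_le_of_norm_le (i1.norm.mul_const (C' * ‖v‖)) (ae_of_all _ fun x => ?_)).trans ?_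
    · rw [norm_mul]; exact mul_le_mul_of_nonneg_left (b1 x) (norm_nonneg _)
    · rw [integral_mul_const]; exact mul_le_mul_of_nonneg_right n1 (by positivity)
  have q2 : |∫ x, inner ℝ (g x - gradient φ x) v * ψ x ∂P.μ| ≤ ε / K * (C * ‖v‖) := by
    rw [← Real.norm_eq_abs]
    refine (norm_integral_le_of_norm_le (i2.norm.mul_const (C * ‖v‖)) (ae_of_all _ fun x => ?_)).trans ?_
    · rw [norm_mul]
      calc _ ≤ (‖g x - gradient φ x‖ * ‖v‖) * C :=
            mul_le_mul (norm_inner_le_norm _ _) (hC x) (norm_nonneg _) (by positivity)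
        _ = _ := by ring
    · rw [integral_mul_const]; exact mul_le_mul_of_nonneg_right n2 (by positivity)
  have hw : (∫ x, φ x * fderiv ℝ ψ x v ∂P.μ) + ∫ x, inner ℝ (gradient φ x) v * ψ x ∂P.μ = 0 := by
    have : ∫ x, φ x * fderiv ℝ ψ x v ∂P.μ = -∫ x, inner ℝ (gradient φ x) v * ψ x ∂P.μ := hφw
    linarith
  have hsum : (∫ x in P.Ω, y x * fderiv ℝ ψ x v) + ∫ x in P.Ω, inner ℝ (g x) v * ψ x
      = (∫ x, (y x - φ x) * fderiv ℝ ψ x v ∂P.μ)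
        + ∫ x, inner ℝ (g x - gradient φ x) v * ψ x ∂P.μ := by
    rw [e1, e2]; linarith
  have hs2 : |(∫ x, (y x - φ x) * fderiv ℝ ψ x v ∂P.μ)
        + ∫ x, inner ℝ (g x - gradient φ x) v * ψ x ∂P.μ| ≤ ε := by
    refine (abs_add_le _ _).trans ((add_le_add q1 q2).trans ?_)
    rw [← mul_add, div_mul_eq_mul_div, div_le_iff₀ hK0]
    exact mul_le_mul_of_nonneg_left (by linarith) hε.le
  rw [← hsum] at hs2
  exact hs2

end IsW0

namespace Admissible

/-- Sobolev's inequality for test functions, in the range `r ≤ p*` since `Ω` is bounded. -/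
lemma sobolev_test (hP : P.Admissible) {r : ℝ} (hr1 : 1 ≤ r) (hr : r ≤ critExp n P.p) :
    ∃ c : NNReal, ∀ φ, IsTestFunction P.Ω φ →
      eLpNorm φ (ENNReal.ofReal r) P.μ ≤ c * eLpNorm (gradient φ) (ENNReal.ofReal P.p) P.μ := by
  refine ⟨eLpNormLESNormFDerivOfLeConst ℝ volume P.Ω P.p.toNNReal r.toNNReal, fun φ hφ => ?_⟩
  have hn : Module.finrank ℝ (EuclideanSpace ℝ (Fin n)) = n := by simp
  have hp0 := hP.p_pos
  have hpn := hP.p_lt_n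
  have hn0 : (0 : ℝ) < n := by linarith
  have h1 := eLpNorm_le_eLpNorm_fderiv_of_le (F := ℝ) (volume : Measure (EuclideanSpace ℝ (Fin n)))
    (u := φ) (s := P.Ω) (hφ.1.of_le (by simp)) ((subset_tsupport φ).trans hφ.2.2)
    (p := P.p.toNNReal) (q := r.toNNReal) (by
      rw [Real.one_le_toNNReal]; exact hP.exps.p_gt.le) (by
      rw [hn, ← NNReal.coe_lt_coe, Real.coe_toNNReal _ hp0.le]; exact_mod_cast hpn) (by
      rw [hn, Real.coe_toNNReal _ (by linarith), NNReal.coe_inv, Real.coe_toNNReal _ hp0.le]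
      unfold critExp at hr
      have h2 : r⁻¹ ≥ (n * P.p / (n - P.p))⁻¹ := inv_anti₀ (by linarith) hr
      refine le_trans (le_of_eq ?_) h2
      have : (n : ℝ) - P.p ≠ 0 := by linarith
      field_simp) hP.bounded
  refine (eLpNorm_mono_measure φ Measure.restrict_le_self).trans (h1.trans (le_of_eq ?_))
  have h3 : Function.support (gradient φ) ⊆ P.Ω := by
    refine (Function.support_subset_iff'.2 fun x hx => ?_)
    unfold gradient
    rw [image_eq_zero_of_notMem_tsupport
      (fun h' => hx (hφ.2.2 (tsupport_fderiv_subset ℝ h'))), map_zero]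
  congr 1
  rw [μ, eLpNorm_restrict_eq_of_support_subset h3]
  exact eLpNorm_congr_norm_ae (ae_of_all _ fun x => by simp [gradient])

/-- The Sobolev inequality on `W_0`. -/
lemma sobolev (hP : P.Admissible) {r : ℝ} (hr1 : 1 ≤ r) (hr : r ≤ critExp n P.p) :
    ∃ c : NNReal, ∀ y g, P.IsW0 y g →
      eLpNorm y (ENNReal.ofReal r) P.μ ≤ c * eLpNorm g (ENNReal.ofReal P.p) P.μ := by
  obtain ⟨c, hc⟩ := hP.sobolev_test hr1 hr
  refine ⟨c, fun y g h => ?_⟩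
  refine ENNReal.le_of_forall_pos_le_add fun ε hε _ => ?_
  obtain ⟨τ, hτ, -, hτ2⟩ := exists_ofReal_le (c := (c : ℝ≥0∞)) ENNReal.coe_ne_top
    (ε := (ε : ℝ≥0∞)) (by simpa using hε.ne')
  refine eLpNorm_le_of_approx one_ne_zero h.meas fun δ hδ => ?_
  obtain ⟨φ, hφ, h1, h2, -⟩ := h.approx (min δ (ENNReal.ofReal τ)) (by
    rw [ne_eq, ← bot_eq_zero, min_eq_bot, not_or]
    exact ⟨hδ, by simpa using hτ⟩)
  refine ⟨φ, hφ.1.continuous.aestronglyMeasurable, h1.trans (min_le_left _ _), ?_⟩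
  have hg : eLpNorm (gradient φ) (ENNReal.ofReal P.p) P.μ
      ≤ eLpNorm g (ENNReal.ofReal P.p) P.μ + ENNReal.ofReal τ := by
    have m2 : AEStronglyMeasurable (gradient φ) P.μ := hφ.continuous_gradient.aestronglyMeasurable
    have := eLpNorm_sub_le h.meas_grad (h.meas_grad.sub m2) hP.one_le_p
    refine le_trans (le_of_eq ?_) (this.trans (add_le_add le_rfl (h2.trans (min_le_right _ _))))
    congr 1; ext x; simp
  calc _ ≤ c * eLpNorm (gradient φ) (ENNReal.ofReal P.p) P.μ := hc φ hφ
    _ ≤ c * (eLpNorm g (ENNReal.ofReal P.p) P.μ + ENNReal.ofReal τ) := mul_le_mul_right hg _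
    _ ≤ _ := by rw [mul_add]; exact add_le_add le_rfl hτ2

lemma p_le_critExp (hP : P.Admissible) : P.p ≤ critExp n P.p := by
  linarith [hP.crit, hP.exps.p_lt, hP.exps.q_lt]

lemma q_le_critExp (hP : P.Admissible) : P.q ≤ critExp n P.p := by
  linarith [hP.crit, hP.exps.q_lt]

/-- Both norms entering the Luxemburg norm of a `W_0` function are controlled by its gradient. -/
lemma exists_memH_le (hP : P.Admissible) : ∃ c : ℝ≥0∞, c ≠ ⊤ ∧ ∀ y g, P.IsW0 y g →
    eLpNorm y (ENNReal.ofReal P.p) P.μ ≤ c * eLpNorm g (ENNReal.ofReal P.p) P.μ ∧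
    eLpNorm y (ENNReal.ofReal P.q) P.μη ≤ c * eLpNorm g (ENNReal.ofReal P.p) P.μ := by
  obtain ⟨c₁, h1⟩ := hP.sobolev hP.exps.p_gt.le hP.p_le_critExp
  obtain ⟨c₂, h2⟩ := hP.sobolev (hP.exps.p_gt.trans hP.exps.p_lt).le hP.q_le_critExp
  obtain ⟨c₃, hc₃, h3⟩ := hP.exists_eLpNorm_μη_le (V := ℝ) (ENNReal.ofReal P.q)
  refine ⟨c₁ + c₃ * c₂, by finiteness, fun y g h => ⟨?_, ?_⟩⟩
  · exact (h1 y g h).trans (mul_le_mul_left le_self_add _)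
  · refine (h3 y).trans ((mul_le_mul_right (h2 y g h) _).trans ?_)
    rw [← mul_assoc]
    exact mul_le_mul_left le_add_self _

end Admissible

lemma IsW0.memH_fun (hP : P.Admissible) {y g} (h : P.IsW0 y g) : P.MemH y := by
  obtain ⟨c, hc, h1⟩ := hP.exists_memH_le
  have h2 := (h.memH hP).1.2
  exact ⟨⟨h.meas, (h1 y g h).1.trans_lt (ENNReal.mul_lt_top hc.lt_top h2)⟩,
    ⟨h.meas.mono_ac Admissible.μη_ac, (h1 y g h).2.trans_lt (ENNReal.mul_lt_top hc.lt_top h2)⟩⟩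

lemma IsW0.weakGrad_ae_eq (hP : P.Admissible) {y g} (h : P.IsW0 y g) :
    weakGrad P.Ω y =ᵐ[P.μ] g :=
  (isWeakGradient_weakGrad ⟨g, h.isWeakGradient hP⟩).ae_eq hP.isOpen (h.isWeakGradient hP)

lemma IsW0.memW1H (hP : P.Admissible) {y g} (h : P.IsW0 y g) : P.MemW1H y := by
  have hg := h.memH hP
  have he := h.weakGrad_ae_eq hP
  refine ⟨hP.memLH_iff.2 (h.memH_fun hP), ⟨g, h.isWeakGradient hP⟩, hP.memLH_iff.2 ⟨?_, ?_⟩⟩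
  · exact (hg.1.ae_eq he.symm).norm
  · exact (hg.2.ae_eq (Admissible.μη_ac.ae_eq he.symm)).norm

/-- Convergence of the gradients suffices for convergence in the norm of `W^{1,H}`, by Sobolev's
inequality. -/
lemma IsW0.memW01H (hP : P.Admissible) {y g} (h : P.IsW0 y g) : P.MemW01H y := by
  refine ⟨h.memW1H hP, ?_⟩
  choose φ h1 h2 h3 h4 using fun k : ℕ => h.approx ((k : ℝ≥0∞) + 1)⁻¹ (by simp)
  refine ⟨φ, h1, ?_⟩
  obtain ⟨c, hc, hcle⟩ := hP.exists_memH_le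
  rw [Metric.tendsto_atTop]
  intro ε hε
  obtain ⟨τ, hτ, hτ1, hτ2⟩ := exists_ofReal_le hc (ε := ENNReal.ofReal (ε / 4 / 2))
    (by simpa using hε)
  obtain ⟨N, hN⟩ := ENNReal.exists_inv_nat_lt (a := ENNReal.ofReal τ) (by simpa using hτ)
  refine ⟨N, fun k hk => ?_⟩
  have hk' : ((k : ℝ≥0∞) + 1)⁻¹ ≤ ENNReal.ofReal τ := by
    refine le_trans (ENNReal.inv_le_inv.2 ?_) hN.le
    have : (N : ℝ≥0∞) ≤ k := by exact_mod_cast hk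
    exact this.trans le_self_add
  have hW := h.sub hP (IsW0.of_test (h1 k))
  have he := hW.weakGrad_ae_eq hP
  have n1 := (h3 k).trans hk'
  have n2 := (h4 k).trans hk'
  have l1 : P.luxNorm (fun x => ‖weakGrad P.Ω (fun x => y x - φ k x) x‖) ≤ ε / 4 := by
    refine hP.luxNorm_le (hW.meas_grad.congr he.symm).norm (by positivity) ?_ ?_
    · rw [eLpNorm_norm, eLpNorm_congr_ae he]; exact n1.trans hτ1
    · rw [eLpNorm_norm, eLpNorm_congr_ae (Admissible.μη_ac.ae_eq he)]; exact n2.trans hτ1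
  have l2 : P.luxNorm (fun x => y x - φ k x) ≤ ε / 4 :=
    hP.luxNorm_le hW.meas (by positivity)
      ((hcle _ _ hW).1.trans ((mul_le_mul_right n1 _).trans hτ2))
      ((hcle _ _ hW).2.trans ((mul_le_mul_right n1 _).trans hτ2))
  have h5 : 0 ≤ P.normW1H (fun x => y x - φ k x) :=
    add_nonneg (luxNorm_nonneg _) (luxNorm_nonneg _)
  rw [Real.dist_eq, sub_zero, abs_of_nonneg h5]
  unfold normW1H
  linarith

/-- Converse of `IsW0.memW01H`: closeness in the Luxemburg norm implies closeness in `L^p(μ)` and in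
`L^q(μη)`. -/
lemma MemW01H.isW0 (hP : P.Admissible) {y} (h : P.MemW01H y) : P.IsW0 y (weakGrad P.Ω y) := by
  obtain ⟨⟨hy, hex, hg⟩, φ, hφ, hlim⟩ := h
  rw [hP.memLH_iff] at hy hg
  have hfin := hP.isFiniteMeasure
  have hw := isWeakGradient_weakGrad hex
  have hgm : AEStronglyMeasurable (weakGrad P.Ω y) P.μ :=
    hw.2.1.aestronglyMeasurable
  have hgi : Integrable (weakGrad P.Ω y) P.μ :=
    (integrable_norm_iff hgm).1 (hg.1.integrable hP.one_le_p)
  have hyi : Integrable y P.μ := hy.1.integrable hP.one_le_p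
  refine ⟨hy.1.1, hgm, fun ε hε => ?_⟩
  obtain ⟨c, hc, hcle⟩ := exists_eLpNorm_one_le (V := ℝ) (m := P.μ) hP.one_le_p
  obtain ⟨τ, hτ, hτ1, hτ2⟩ := exists_ofReal_le hc hε
  obtain ⟨k, hk⟩ := (hlim.eventually_lt_const hτ).exists
  have hsub : IsWeakGradient P.Ω (fun x => y x - φ k x)
      (fun x => weakGrad P.Ω y x - gradient (φ k) x) :=
    hw.sub (hφ k).isWeakGradient hyi (memLp_one_iff_integrable.1 ((hφ k).memLp 1 _)) hgi
      (memLp_one_iff_integrable.1 ((hφ k).memLp_gradient 1 _))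
  have he : weakGrad P.Ω (fun x => y x - φ k x)
      =ᵐ[P.μ] fun x => weakGrad P.Ω y x - gradient (φ k) x :=
    (isWeakGradient_weakGrad ⟨_, hsub⟩).ae_eq hP.isOpen hsub
  have hηfin := hP.isFiniteMeasure_μη
  have g1 : MemLp (weakGrad P.Ω y) (ENNReal.ofReal P.p) P.μ := (memLp_norm_iff hgm).1 hg.1
  have g2 : MemLp (weakGrad P.Ω y) (ENNReal.ofReal P.q) P.μη :=
    (memLp_norm_iff (hgm.mono_ac Admissible.μη_ac)).1 hg.2
  have hm1 : P.MemH fun x => ‖weakGrad P.Ω (fun x => y x - φ k x) x‖ :=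
    ⟨((g1.sub ((hφ k).memLp_gradient _ _)).ae_eq he.symm).norm,
      ((g2.sub ((hφ k).memLp_gradient _ _)).ae_eq (Admissible.μη_ac.ae_eq he.symm)).norm⟩
  have hm2 : P.MemH fun x => y x - φ k x :=
    ⟨hy.1.sub ((hφ k).memLp _ _), hy.2.sub ((hφ k).memLp _ _)⟩
  have hadd : P.luxNorm (fun x => ‖weakGrad P.Ω (fun x => y x - φ k x) x‖)
      + P.luxNorm (fun x => y x - φ k x) < τ := hk
  have l1 := hP.eLpNorm_le_of_luxNorm_lt hm1
    (lt_of_le_of_lt (le_add_of_nonneg_right (luxNorm_nonneg _)) hadd)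
  have l2 := hP.eLpNorm_le_of_luxNorm_lt hm2
    (lt_of_le_of_lt (le_add_of_nonneg_left (luxNorm_nonneg _)) hadd)
  rw [eLpNorm_norm, eLpNorm_norm, eLpNorm_congr_ae he,
    eLpNorm_congr_ae (Admissible.μη_ac.ae_eq he)] at l1
  exact ⟨φ k, hφ k, (hcle _ hm2.1.1).trans ((mul_le_mul_right l2.1 _).trans hτ2),
    l1.1.trans hτ1, l1.2.trans hτ1⟩

end Data

end DoublePhase

/-! ### Lower semicontinuity of the energy and absolute values -/

namespace DoublePhase

section LpEnergy

variable {α V : Type*} {mα : MeasurableSpace α} {m : Measure α} [NormedAddCommGroup V]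

lemma integral_norm_rpow_eq {r : ℝ} (hr : 0 < r) {f : α → V}
    (hf : MemLp f (ENNReal.ofReal r) m) :
    ∫ x, ‖f x‖ ^ r ∂m = (eLpNorm f (ENNReal.ofReal r) m).toReal ^ r := by
  have h0 : 0 ≤ ∫ x, ‖f x‖ ^ r ∂m := integral_nonneg fun x => by positivity
  rw [hf.eLpNorm_eq_integral_rpow_norm (by simpa using hr) ENNReal.ofReal_ne_top,
    ENNReal.toReal_ofReal hr.le, ENNReal.toReal_ofReal (by positivity), ← Real.rpow_mul h0,
    inv_mul_cancel₀ hr.ne', Real.rpow_one]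

lemma tendsto_eLpNorm_of_integral {r : ℝ} (hr : 0 < r) {ι : Type*} {l : Filter ι}
    {f : ι → α → V} (hf : ∀ i, MemLp (f i) (ENNReal.ofReal r) m)
    (h : Tendsto (fun i => ∫ x, ‖f i x‖ ^ r ∂m) l (𝓝 0)) :
    Tendsto (fun i => eLpNorm (f i) (ENNReal.ofReal r) m) l (𝓝 0) := by
  have h1 : Tendsto (fun i => ENNReal.ofReal ((∫ x, ‖f i x‖ ^ r ∂m) ^ r⁻¹)) l (𝓝 0) := by
    have h2 := h.rpow_const (p := r⁻¹) (Or.inr (by positivity))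
    rw [Real.zero_rpow (by positivity)] at h2
    simpa using ENNReal.tendsto_ofReal h2
  refine h1.congr fun i => ?_
  rw [(hf i).eLpNorm_eq_integral_rpow_norm (by simpa using hr) ENNReal.ofReal_ne_top,
    ENNReal.toReal_ofReal hr.le]

lemma tendsto_integral_norm_rpow {r : ℝ} (hr : 1 ≤ r) {ι : Type*} {l : Filter ι}
    {f : ι → α → V} {g : α → V} (hf : ∀ i, MemLp (f i) (ENNReal.ofReal r) m)
    (hg : MemLp g (ENNReal.ofReal r) m)
    (h : Tendsto (fun i => eLpNorm (f i - g) (ENNReal.ofReal r) m) l (𝓝 0)) :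
    Tendsto (fun i => ∫ x, ‖f i x‖ ^ r ∂m) l (𝓝 (∫ x, ‖g x‖ ^ r ∂m)) := by
  have hr0 : 0 < r := by linarith
  have : Fact (1 ≤ ENNReal.ofReal r) := ⟨by simpa using ENNReal.ofReal_le_ofReal hr⟩
  have h1 := ((Lp.tendsto_Lp_iff_tendsto_eLpNorm'' f hf g hg).2 h).norm
  simp_rw [Lp.norm_toLp] at h1
  have h2 := h1.rpow_const (p := r) (Or.inr hr0.le)
  simp_rw [integral_norm_rpow_eq hr0 (hf _), integral_norm_rpow_eq hr0 hg]
  exact h2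

end LpEnergy

namespace Data

variable {n : ℕ} (P : Data n)

/-- `∫_Ω |g|^p`. -/
noncomputable def energyP (g : EuclideanSpace ℝ (Fin n) → EuclideanSpace ℝ (Fin n)) : ℝ :=
  ∫ x, ‖g x‖ ^ P.p ∂P.μ

/-- `∫_Ω η |g|^q`. -/
noncomputable def energyQ (g : EuclideanSpace ℝ (Fin n) → EuclideanSpace ℝ (Fin n)) : ℝ :=
  ∫ x, ‖g x‖ ^ P.q ∂P.μη

variable {P}

lemma energyP_nonneg (g) : 0 ≤ P.energyP g := integral_nonneg fun x => by positivity
lemma energyQ_nonneg (g) : 0 ≤ P.energyQ g := integral_nonneg fun x => by positivity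

lemma energyP_congr {g g'} (h : g =ᵐ[P.μ] g') : P.energyP g = P.energyP g' :=
  integral_congr_ae (h.fun_comp fun v => ‖v‖ ^ P.p)

lemma energyQ_congr {g g'} (h : g =ᵐ[P.μ] g') : P.energyQ g = P.energyQ g' :=
  integral_congr_ae ((Admissible.μη_ac.ae_eq h).fun_comp fun v => ‖v‖ ^ P.q)

lemma energyP_smul (c : ℝ) (hc : 0 ≤ c) (g) :
    P.energyP (fun x => c • g x) = c ^ P.p * P.energyP g := by
  unfold energyP
  simp_rw [norm_smul, Real.norm_of_nonneg hc, Real.mul_rpow hc (norm_nonneg _)]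
  exact integral_const_mul _ _

lemma energyQ_smul (c : ℝ) (hc : 0 ≤ c) (g) :
    P.energyQ (fun x => c • g x) = c ^ P.q * P.energyQ g := by
  unfold energyQ
  simp_rw [norm_smul, Real.norm_of_nonneg hc, Real.mul_rpow hc (norm_nonneg _)]
  exact integral_const_mul _ _

/-- Weak closedness of `W_0` and weak lower semicontinuity of the energy `α A + β B`, without weak
topologies: among the admissible pairs `L¹`-close to `y`, those almost minimizing the energy form a
Cauchy sequence by uniform convexity. -/
lemma Admissible.exists_isW0_energy_le (hP : P.Admissible) {y : EuclideanSpace ℝ (Fin n) → ℝ}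
    (hy : AEStronglyMeasurable y P.μ) {α β M : ℝ} (hα : 0 < α) (hβ : 0 < β)
    (h : ∀ ε : ℝ≥0∞, ε ≠ 0 → ∃ y' g', P.IsW0 y' g' ∧ eLpNorm (fun x => y x - y' x) 1 P.μ ≤ ε ∧
      α * P.energyP g' + β * P.energyQ g' ≤ M) :
    ∃ g, P.IsW0 y g ∧ α * P.energyP g + β * P.energyQ g ≤ M := by
  set Φ : (EuclideanSpace ℝ (Fin n) → EuclideanSpace ℝ (Fin n)) → ℝ := fun g =>
    α * P.energyP g + β * P.energyQ g with hΦ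
  have hΦ0 : ∀ g, 0 ≤ Φ g := fun g =>
    add_nonneg (mul_nonneg hα.le (energyP_nonneg g)) (mul_nonneg hβ.le (energyQ_nonneg g))
  have hp := hP.exps.p_gt
  have hq : 1 < P.q := hp.trans hP.exps.p_lt
  let S : ℕ → Set ((EuclideanSpace ℝ (Fin n) → ℝ) ×
      (EuclideanSpace ℝ (Fin n) → EuclideanSpace ℝ (Fin n))) := fun j =>
    {z | P.IsW0 z.1 z.2 ∧ eLpNorm (fun x => y x - z.1 x) 1 P.μ ≤ ((j : ℝ≥0∞) + 1)⁻¹ ∧ Φ z.2 ≤ M}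
  have hSne : ∀ j, (S j).Nonempty := fun j => by
    obtain ⟨y', g', h1, h2, h3⟩ := h ((j : ℝ≥0∞) + 1)⁻¹ (by simp)
    exact ⟨(y', g'), h1, h2, h3⟩
  have hSanti : Antitone S := fun i j hij z hz => by
    refine ⟨hz.1, hz.2.1.trans (ENNReal.inv_le_inv.2 ?_), hz.2.2⟩
    have : (i : ℝ≥0∞) ≤ j := by exact_mod_cast hij
    exact add_le_add this le_rfl
  -- `K j` increases to a finite limit, so midpoints of almost minimizers `z i`, `z j` cannot have
  -- much smaller energy than `z i` and `z j` themselves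
  set K : ℕ → ℝ := fun j => sInf ((fun z => Φ z.2) '' S j) with hK
  have hbdd : ∀ j, BddBelow ((fun z => Φ z.2) '' S j) := fun j =>
    ⟨0, by rintro _ ⟨z, -, rfl⟩; exact hΦ0 _⟩
  have hKle : ∀ j, ∀ z ∈ S j, K j ≤ Φ z.2 := fun j z hz => csInf_le (hbdd j) ⟨z, hz, rfl⟩
  have hKmono : Monotone K := fun i j hij =>
    csInf_le_csInf (hbdd i) ((hSne j).image _) (image_mono (hSanti hij))
  have hKM : ∀ j, K j ≤ M := fun j => by
    obtain ⟨z, hz⟩ := hSne j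
    exact (hKle j z hz).trans hz.2.2
  obtain ⟨L, hL⟩ : ∃ L, Tendsto K atTop (𝓝 L) :=
    ⟨_, tendsto_atTop_ciSup hKmono ⟨M, by rintro _ ⟨j, rfl⟩; exact hKM j⟩⟩
  have hex : ∀ j : ℕ, ∃ z ∈ S j, Φ z.2 < K j + 1 / ((j : ℝ) + 1) := fun j => by
    obtain ⟨_, ⟨z, hz, rfl⟩, hlt⟩ := exists_lt_of_csInf_lt ((hSne j).image _)
      (lt_add_of_pos_right (K j) (by positivity : (0 : ℝ) < 1 / ((j : ℝ) + 1)))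
    exact ⟨z, hz, hlt⟩
  choose z hzS hzK using hex
  set g : ℕ → EuclideanSpace ℝ (Fin n) → EuclideanSpace ℝ (Fin n) := fun j => (z j).2 with hg
  have hgW : ∀ j, P.IsW0 (z j).1 (g j) := fun j => (hzS j).1
  have hgp : ∀ j, MemLp (g j) (ENNReal.ofReal P.p) P.μ := fun j => ((hgW j).memH hP).1
  have hgq : ∀ j, MemLp (g j) (ENNReal.ofReal P.q) P.μη := fun j => ((hgW j).memH hP).2
  -- the midpoint of `z i` and `z j` is again admissible
  have hmid : ∀ i j, K (min i j) ≤ Φ (fun x => (1 / 2 : ℝ) • (g i x + g j x)) := by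
    intro i j
    have hi := hSanti (min_le_left i j) (hzS i)
    have hj := hSanti (min_le_right i j) (hzS j)
    have hconv : Φ (fun x => (1 / 2 : ℝ) • (g i x + g j x)) ≤ (Φ (g i) + Φ (g j)) / 2 := by
      have d1 : 0 ≤ ∫ x, convexityDefect P.p (g i x, g j x) ∂P.μ :=
        integral_nonneg fun x => convexityDefect_nonneg hp _
      have d2 : 0 ≤ ∫ x, convexityDefect P.q (g i x, g j x) ∂P.μη :=
        integral_nonneg fun x => convexityDefect_nonneg hq _
      rw [integral_convexityDefect hp (hgp i) (hgp j)] at d1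
      rw [integral_convexityDefect hq (hgq i) (hgq j)] at d2
      have := mul_nonneg hα.le d1
      have := mul_nonneg hβ.le d2
      simp only [hΦ, energyP, energyQ]
      linarith
    refine hKle _ (fun x => (1 / 2 : ℝ) * ((z i).1 x + (z j).1 x),
      fun x => (1 / 2 : ℝ) • (g i x + g j x)) ⟨((hgW i).add hP (hgW j)).const_mul _, ?_, ?_⟩
    · have e : (fun x => y x - (1 / 2 : ℝ) * ((z i).1 x + (z j).1 x))
          = (1 / 2 : ℝ) • ((fun x => y x - (z i).1 x) + fun x => y x - (z j).1 x) := by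
        ext x; simp only [Pi.smul_apply, Pi.add_apply, smul_eq_mul]; ring
      simp only [e]
      rw [eLpNorm_const_smul]
      have h2 : ‖(1 / 2 : ℝ)‖ₑ = 2⁻¹ := by
        rw [Real.enorm_of_nonneg (by norm_num), one_div, ENNReal.ofReal_inv_of_pos two_pos]
        simp
      rw [h2]
      refine (mul_le_mul_right ((eLpNorm_add_le (hy.sub (hgW i).meas) (hy.sub (hgW j).meas)
        le_rfl).trans (add_le_add hi.2.1 hj.2.1)) _).trans ?_
      rw [← two_mul, ← mul_assoc, ENNReal.inv_mul_cancel two_ne_zero ENNReal.ofNat_ne_top,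
        one_mul]
    · exact hconv.trans (by linarith [hi.2.2, hj.2.2])
  have hdef : Tendsto (fun ij : ℕ × ℕ => α * (∫ x, convexityDefect P.p (g ij.1 x, g ij.2 x) ∂P.μ)
      + β * ∫ x, convexityDefect P.q (g ij.1 x, g ij.2 x) ∂P.μη) atTop (𝓝 0) := by
    have t1 : Tendsto (fun ij : ℕ × ℕ => ij.1) atTop atTop := by
      rw [← prod_atTop_atTop_eq]; exact tendsto_fst
    have t2 : Tendsto (fun ij : ℕ × ℕ => ij.2) atTop atTop := by
      rw [← prod_atTop_atTop_eq]; exact tendsto_snd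
    have t3 : Tendsto (fun ij : ℕ × ℕ => min ij.1 ij.2) atTop atTop :=
      tendsto_atTop.2 fun b => by
        filter_upwards [t1.eventually_ge_atTop b, t2.eventually_ge_atTop b] with ij h1 h2
        exact le_min h1 h2
    have hinv := tendsto_one_div_add_atTop_nhds_zero_nat (𝕜 := ℝ)
    have hub : Tendsto (fun ij : ℕ × ℕ => ((K ij.1 + 1 / ((ij.1 : ℝ) + 1))
        + (K ij.2 + 1 / ((ij.2 : ℝ) + 1))) / 2 - K (min ij.1 ij.2)) atTop (𝓝 0) := by
      have := ((((hL.comp t1).add (hinv.comp t1)).add ((hL.comp t2).add (hinv.comp t2))).div_const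
        2).sub (hL.comp t3)
      have e : ((L + 0) + (L + 0)) / 2 - L = 0 := by ring
      rw [e] at this
      exact this
    refine squeeze_zero (fun ij => ?_) (fun ij => ?_) hub
    · exact add_nonneg (mul_nonneg hα.le (integral_nonneg fun x => convexityDefect_nonneg hp _))
        (mul_nonneg hβ.le (integral_nonneg fun x => convexityDefect_nonneg hq _))
    · rw [integral_convexityDefect hp (hgp _) (hgp _), integral_convexityDefect hq (hgq _) (hgq _)]
      have h1 := hmid ij.1 ij.2
      have h2 := hzK ij.1
      have h3 := hzK ij.2
      simp only [hΦ, energyP, energyQ] at h1 h2 h3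
      linarith
  have hdp : Tendsto (fun ij : ℕ × ℕ => ∫ x, convexityDefect P.p (g ij.1 x, g ij.2 x) ∂P.μ)
      atTop (𝓝 0) := by
    have := hdef.const_mul α⁻¹
    rw [mul_zero] at this
    refine squeeze_zero (fun ij => integral_nonneg fun x => convexityDefect_nonneg hp _)
      (fun ij => ?_) this
    have : 0 ≤ β * ∫ x, convexityDefect P.q (g ij.1 x, g ij.2 x) ∂P.μη :=
      mul_nonneg hβ.le (integral_nonneg fun x => convexityDefect_nonneg hq _)
    rw [mul_add, ← mul_assoc, inv_mul_cancel₀ hα.ne', one_mul]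
    exact le_add_of_nonneg_right (mul_nonneg (by positivity) this)
  have hdq : Tendsto (fun ij : ℕ × ℕ => ∫ x, convexityDefect P.q (g ij.1 x, g ij.2 x) ∂P.μη)
      atTop (𝓝 0) := by
    have := hdef.const_mul β⁻¹
    rw [mul_zero] at this
    refine squeeze_zero (fun ij => integral_nonneg fun x => convexityDefect_nonneg hq _)
      (fun ij => ?_) this
    have : 0 ≤ α * ∫ x, convexityDefect P.p (g ij.1 x, g ij.2 x) ∂P.μ :=
      mul_nonneg hα.le (integral_nonneg fun x => convexityDefect_nonneg hp _)
    rw [mul_add, ← mul_assoc β⁻¹ β, inv_mul_cancel₀ hβ.ne', one_mul]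
    exact le_add_of_nonneg_left (mul_nonneg (by positivity) this)
  have hMp : ∀ j, ∫ x, ‖g j x‖ ^ P.p ∂P.μ ≤ M / α := fun j => by
    rw [le_div_iff₀ hα]
    have h1 := (hzS j).2.2
    have h2 := mul_nonneg hβ.le (energyQ_nonneg (P := P) (g j))
    have h3 : α * P.energyP (g j) + β * P.energyQ (g j) ≤ M := h1
    have h4 : P.energyP (g j) = ∫ x, ‖g j x‖ ^ P.p ∂P.μ := rfl
    rw [← h4]; linarith
  have hMq : ∀ j, ∫ x, ‖g j x‖ ^ P.q ∂P.μη ≤ M / β := fun j => by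
    rw [le_div_iff₀ hβ]
    have h1 := (hzS j).2.2
    have h2 := mul_nonneg hα.le (energyP_nonneg (P := P) (g j))
    have h3 : α * P.energyP (g j) + β * P.energyQ (g j) ≤ M := h1
    have h4 : P.energyQ (g j) = ∫ x, ‖g j x‖ ^ P.q ∂P.μη := rfl
    rw [← h4]; linarith
  have hCp : Tendsto (fun ij : ℕ × ℕ => eLpNorm (g ij.1 - g ij.2) (ENNReal.ofReal P.p) P.μ)
      atTop (𝓝 0) :=
    tendsto_eLpNorm_of_integral hP.p_pos (fun ij => (hgp ij.1).sub (hgp ij.2))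
      (tendsto_integral_norm_sub_rpow hp (a := fun ij : ℕ × ℕ => g ij.1)
        (b := fun ij : ℕ × ℕ => g ij.2) (fun ij => hgp _) (fun ij => hgp _)
        (fun ij => hMp _) (fun ij => hMp _) hdp)
  have hCq : Tendsto (fun ij : ℕ × ℕ => eLpNorm (g ij.1 - g ij.2) (ENNReal.ofReal P.q) P.μη)
      atTop (𝓝 0) :=
    tendsto_eLpNorm_of_integral hP.q_pos (fun ij => (hgq ij.1).sub (hgq ij.2))
      (tendsto_integral_norm_sub_rpow hq (a := fun ij : ℕ × ℕ => g ij.1)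
        (b := fun ij : ℕ × ℕ => g ij.2) (fun ij => hgq _) (fun ij => hgq _)
        (fun ij => hMq _) (fun ij => hMq _) hdq)
  -- the `L^p` limit of the gradients
  have : Fact (1 ≤ ENNReal.ofReal P.p) := ⟨hP.one_le_p⟩
  obtain ⟨G, hGp, hlimp⟩ : ∃ G : EuclideanSpace ℝ (Fin n) → EuclideanSpace ℝ (Fin n),
      MemLp G (ENNReal.ofReal P.p) P.μ ∧
      Tendsto (fun j => eLpNorm (g j - G) (ENNReal.ofReal P.p) P.μ) atTop (𝓝 0) := by
    have hcs : CauchySeq fun j => (hgp j).toLp (g j) := by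
      rw [Lp.cauchySeq_Lp_iff_cauchySeq_eLpNorm]
      refine hCp.congr fun ij => ?_
      exact eLpNorm_congr_ae ((hgp ij.1).coeFn_toLp.sub (hgp ij.2).coeFn_toLp).symm
    obtain ⟨G, hG⟩ := cauchySeq_tendsto_of_complete hcs
    refine ⟨G, Lp.memLp G, ?_⟩
    rw [Lp.tendsto_Lp_iff_tendsto_eLpNorm'] at hG
    refine hG.congr fun j => ?_
    exact eLpNorm_congr_ae ((hgp j).coeFn_toLp.sub (EventuallyEq.refl _ _))
  obtain ⟨ns, hns, hae⟩ := (tendstoInMeasure_of_tendsto_eLpNorm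
    (by simpa using hP.p_pos) (fun j => (hgp j).1) hGp.1 hlimp).exists_seq_tendsto_ae
  -- the `L^q(μη)` limit is the same function `G`, by a.e. convergence of a subsequence and Fatou
  have hlimq : Tendsto (fun j => eLpNorm (g j - G) (ENNReal.ofReal P.q) P.μη) atTop (𝓝 0) := by
    rw [ENNReal.tendsto_atTop_zero]
    intro ε hε
    obtain ⟨N, hN⟩ := (ENNReal.tendsto_atTop_zero.1 hCq) ε hε
    refine ⟨max N.1 N.2, fun j hj => ?_⟩
    have hlim : ∀ᵐ x ∂P.μη, Tendsto (fun l => (g j - g (ns l)) x) atTop (𝓝 ((g j - G) x)) := by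
      filter_upwards [Admissible.μη_ac.ae_le hae] with x hx
      exact tendsto_const_nhds.sub hx
    refine (Lp.eLpNorm_lim_le_liminf_eLpNorm (fun l => ((hgq j).sub (hgq (ns l))).1) _ hlim).trans ?_
    refine liminf_le_of_frequently_le' (Eventually.frequently ?_)
    filter_upwards [hns.tendsto_atTop.eventually_ge_atTop (max N.1 N.2)] with l hl
    exact hN (j, ns l) ⟨(le_max_left _ _).trans hj, (le_max_right _ _).trans hl⟩
  have hGq : MemLp G (ENNReal.ofReal P.q) P.μη := by
    obtain ⟨j, hj⟩ := (hlimq.eventually_lt_const ENNReal.zero_lt_top).exists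
    have hm : AEStronglyMeasurable G P.μη := hGp.1.mono_ac Admissible.μη_ac
    have h1 : MemLp (g j - G) (ENNReal.ofReal P.q) P.μη := ⟨(hgq j).1.sub hm, hj⟩
    exact ((hgq j).sub h1).ae_eq (ae_of_all _ fun x => by simp)
  refine ⟨G, IsW0.of_approx hP hy hGp.1 fun ε hε => ?_, ?_⟩
  · have e1 := (hlimp.eventually_lt_const (pos_iff_ne_zero.2 hε))
    have e2 := (hlimq.eventually_lt_const (pos_iff_ne_zero.2 hε))
    have e3 := (ENNReal.tendsto_inv_nat_nhds_zero.comp (tendsto_add_atTop_nat 1)).eventually_lt_const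
      (pos_iff_ne_zero.2 hε)
    obtain ⟨j, h1, h2, h3⟩ := (e1.and (e2.and e3)).exists
    refine ⟨(z j).1, g j, hgW j, (hzS j).2.1.trans (le_trans (le_of_eq ?_) h3.le), ?_, ?_⟩
    · simp
    · rw [eLpNorm_sub_comm] at h1; exact h1.le
    · rw [eLpNorm_sub_comm] at h2; exact h2.le
  · have l1 := tendsto_integral_norm_rpow hp.le hgp hGp hlimp
    have l2 := tendsto_integral_norm_rpow hq.le hgq hGq hlimq
    exact le_of_tendsto ((l1.const_mul α).add (l2.const_mul β))
      (Eventually.of_forall fun j => (hzS j).2.2)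

/-- Version of `exists_isW0_energy_le` with one gradient for all weights. -/
lemma Admissible.exists_isW0_forall_energy_le (hP : P.Admissible)
    {y : EuclideanSpace ℝ (Fin n) → ℝ} (hy : AEStronglyMeasurable y P.μ) {a b : ℝ}
    (h : ∀ α β M : ℝ, 0 < α → 0 < β → α * a + β * b < M → ∀ ε : ℝ≥0∞, ε ≠ 0 →
      ∃ y' g', P.IsW0 y' g' ∧ eLpNorm (fun x => y x - y' x) 1 P.μ ≤ ε ∧
      α * P.energyP g' + β * P.energyQ g' ≤ M) :
    ∃ g, P.IsW0 y g ∧ ∀ α β : ℝ, 0 < α → 0 < β →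
      α * P.energyP g + β * P.energyQ g ≤ α * a + β * b := by
  obtain ⟨g, hg, -⟩ := hP.exists_isW0_energy_le hy one_pos one_pos
    (h 1 1 (1 * a + 1 * b + 1) one_pos one_pos (by linarith))
  refine ⟨g, hg, fun α β hα hβ => le_of_forall_pos_le_add fun δ hδ => ?_⟩
  obtain ⟨g', hg', hle⟩ := hP.exists_isW0_energy_le hy hα hβ
    (h α β (α * a + β * b + δ) hα hβ (by linarith))
  have he : g =ᵐ[P.μ] g' := (hg.isWeakGradient hP).ae_eq hP.isOpen (hg'.isWeakGradient hP)
  rwa [energyP_congr he, energyQ_congr he]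

/-- Test functions are dense in energy. -/
lemma IsW0.exists_test_energy_lt (hP : P.Admissible) {y g} (h : P.IsW0 y g) {α β M : ℝ}
    (hM : α * P.energyP g + β * P.energyQ g < M) {ε : ℝ≥0∞} (hε : ε ≠ 0) :
    ∃ φ, IsTestFunction P.Ω φ ∧ eLpNorm (fun x => y x - φ x) 1 P.μ ≤ ε ∧
      α * P.energyP (gradient φ) + β * P.energyQ (gradient φ) < M := by
  have := isFiniteMeasureOnCompacts_μ (P := P)
  have := hP.isFiniteMeasure_μη
  choose φ h1 h2 h3 h4 using fun k : ℕ => h.approx ((k : ℝ≥0∞) + 1)⁻¹ (by simp)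
  have hinv : Tendsto (fun k : ℕ => ((k : ℝ≥0∞) + 1)⁻¹) atTop (𝓝 0) := by
    refine (ENNReal.tendsto_inv_nat_nhds_zero.comp (tendsto_add_atTop_nat 1)).congr fun k => ?_
    simp
  have l1 : Tendsto (fun k => eLpNorm (gradient (φ k) - g) (ENNReal.ofReal P.p) P.μ) atTop
      (𝓝 0) := by
    refine tendsto_of_tendsto_of_tendsto_of_le_of_le tendsto_const_nhds hinv
      (fun _ => zero_le) fun k => ?_
    rw [eLpNorm_sub_comm]; exact h3 k
  have l2 : Tendsto (fun k => eLpNorm (gradient (φ k) - g) (ENNReal.ofReal P.q) P.μη) atTop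
      (𝓝 0) := by
    refine tendsto_of_tendsto_of_tendsto_of_le_of_le tendsto_const_nhds hinv
      (fun _ => zero_le) fun k => ?_
    rw [eLpNorm_sub_comm]; exact h4 k
  have m1 := tendsto_integral_norm_rpow hP.exps.p_gt.le (fun k => (h1 k).memLp_gradient _ _)
    (h.memH hP).1 l1
  have m2 := tendsto_integral_norm_rpow (hP.exps.p_gt.trans hP.exps.p_lt).le
    (fun k => (h1 k).memLp_gradient _ _) (h.memH hP).2 l2
  obtain ⟨k, hk1, hk2⟩ := ((((m1.const_mul α).add (m2.const_mul β)).eventually_lt_const hM).and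
    (hinv.eventually_lt_const (pos_iff_ne_zero.2 hε))).exists
  exact ⟨φ k, h1 k, (h2 k).trans hk2.le, hk1⟩

/-- A smooth approximation of `|φ|` that keeps the support and does not increase the gradient. -/
lemma isTestFunction_sqrt {Ω : Set (EuclideanSpace ℝ (Fin n))}
    {φ : EuclideanSpace ℝ (Fin n) → ℝ} (h : IsTestFunction Ω φ) {δ : ℝ} (hδ : 0 < δ) :
    IsTestFunction Ω (fun x => √(φ x ^ 2 + δ ^ 2) - δ) ∧
      ∀ x, ‖gradient (fun x => √(φ x ^ 2 + δ ^ 2) - δ) x‖ ≤ ‖gradient φ x‖ := by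
  have hpos : ∀ x, 0 < φ x ^ 2 + δ ^ 2 := fun x => by positivity
  have hsupp : Function.support (fun x => √(φ x ^ 2 + δ ^ 2) - δ) ⊆ Function.support φ := by
    intro x hx hx0
    refine hx ?_
    have : φ x = 0 := hx0
    simp [this, Real.sqrt_sq hδ.le]
  refine ⟨⟨(((h.1.pow 2).add contDiff_const).sqrt fun x => (hpos x).ne').sub contDiff_const,
    h.2.1.mono hsupp, (closure_mono hsupp).trans h.2.2⟩, fun x => ?_⟩
  have hd : HasFDerivAt (fun x => √(φ x ^ 2 + δ ^ 2) - δ)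
      ((φ x / √(φ x ^ 2 + δ ^ 2)) • fderiv ℝ φ x) x := by
    have h1 := ((((h.differentiable x).hasFDerivAt.pow 2).add_const (δ ^ 2)).sqrt
      (hpos x).ne').sub_const δ
    refine h1.congr_fderiv ?_
    ext v
    simp only [_root_.smul_apply, smul_eq_mul, nsmul_eq_mul]
    field_simp
    simp
  have hg : gradient (fun x => √(φ x ^ 2 + δ ^ 2) - δ) x
      = (φ x / √(φ x ^ 2 + δ ^ 2)) • gradient φ x := by
    unfold gradient
    rw [hd.fderiv]; simp
  rw [hg, norm_smul]
  refine mul_le_of_le_one_left (norm_nonneg _) ?_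
  rw [Real.norm_eq_abs, abs_div, abs_of_nonneg (Real.sqrt_nonneg _),
    div_le_one (Real.sqrt_pos.2 (hpos x))]
  exact Real.abs_le_sqrt (by nlinarith [sq_nonneg δ])

/-- `W_0` is stable under absolute values, which do not increase the energy. -/
lemma IsW0.abs (hP : P.Admissible) {y g} (h : P.IsW0 y g) :
    ∃ w, P.IsW0 (fun x => |y x|) w ∧ ∀ α β : ℝ, 0 < α → 0 < β →
      α * P.energyP w + β * P.energyQ w ≤ α * P.energyP g + β * P.energyQ g := by
  have hfin := hP.isFiniteMeasure
  have hηfin := hP.isFiniteMeasure_μη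
  have hcpt := isFiniteMeasureOnCompacts_μ (P := P)
  have hmeas : AEStronglyMeasurable (fun x => |y x|) P.μ := h.meas.norm
  refine hP.exists_isW0_forall_energy_le hmeas fun α β M hα hβ hM ε hε => ?_
  have hε2 : ε / 2 ≠ 0 := by simp [hε]
  obtain ⟨φ, hφ, h1, h2⟩ := h.exists_test_energy_lt hP hM hε2
  obtain ⟨δ, hδ, -, hδ2⟩ := exists_ofReal_le (measure_ne_top P.μ univ) hε2
  obtain ⟨ht, hgrad⟩ := isTestFunction_sqrt hφ hδ
  refine ⟨_, _, IsW0.of_test ht, ?_, le_trans ?_ h2.le⟩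
  · have hm : AEStronglyMeasurable (fun x => y x - φ x) P.μ :=
      h.meas.sub hφ.1.continuous.aestronglyMeasurable
    calc eLpNorm (fun x => |y x| - (√(φ x ^ 2 + δ ^ 2) - δ)) 1 P.μ
        ≤ eLpNorm ((fun x => ‖y x - φ x‖) + fun _ => δ) 1 P.μ := by
          refine eLpNorm_mono_real fun x => ?_
          rw [Pi.add_apply, Real.norm_eq_abs, Real.norm_eq_abs, abs_le]
          have e1 := abs_le.1 (abs_abs_sub_abs_le_abs_sub (y x) (φ x))
          have e2 : |φ x| ≤ √(φ x ^ 2 + δ ^ 2) := Real.abs_le_sqrt (by nlinarith [sq_nonneg δ])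
          have e3 : √(φ x ^ 2 + δ ^ 2) ≤ |φ x| + δ := by
            rw [Real.sqrt_le_left (by positivity)]
            nlinarith [sq_abs (φ x), abs_nonneg (φ x)]
          constructor <;> linarith [e1.1, e1.2]
      _ ≤ eLpNorm (fun x => ‖y x - φ x‖) 1 P.μ + eLpNorm (fun _ => δ) 1 P.μ :=
          eLpNorm_add_le hm.norm aestronglyMeasurable_const le_rfl
      _ ≤ ε / 2 + ε / 2 := by
          refine add_le_add (by rw [eLpNorm_norm]; exact h1) ?_
          rw [eLpNorm_one_eq_lintegral_enorm, lintegral_const, mul_comm,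
            Real.enorm_of_nonneg hδ.le]
          exact hδ2
      _ = ε := ENNReal.add_halves ε
  · have k1 : P.energyP (gradient fun x => √(φ x ^ 2 + δ ^ 2) - δ) ≤ P.energyP (gradient φ) :=
      integral_mono (integrable_norm_rpow hP.p_pos (ht.memLp_gradient _ _))
        (integrable_norm_rpow hP.p_pos (hφ.memLp_gradient _ _)) fun x =>
        Real.rpow_le_rpow (norm_nonneg _) (hgrad x) hP.p_pos.le
    have k2 : P.energyQ (gradient fun x => √(φ x ^ 2 + δ ^ 2) - δ) ≤ P.energyQ (gradient φ) :=
      integral_mono (integrable_norm_rpow hP.q_pos (ht.memLp_gradient _ _))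
        (integrable_norm_rpow hP.q_pos (hφ.memLp_gradient _ _)) fun x =>
        Real.rpow_le_rpow (norm_nonneg _) (hgrad x) hP.q_pos.le
    exact add_le_add (mul_le_mul_of_nonneg_left k1 hα.le) (mul_le_mul_of_nonneg_left k2 hβ.le)

/-- Weak lower semicontinuity along sequences converging in `L¹`. -/
lemma Admissible.exists_isW0_of_tendsto (hP : P.Admissible)
    {y : EuclideanSpace ℝ (Fin n) → ℝ} (hy : AEStronglyMeasurable y P.μ)
    {u : ℕ → EuclideanSpace ℝ (Fin n) → ℝ}
    {g : ℕ → EuclideanSpace ℝ (Fin n) → EuclideanSpace ℝ (Fin n)}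
    (hu : ∀ j, P.IsW0 (u j) (g j))
    (hlim : Tendsto (fun j => eLpNorm (fun x => y x - u j x) 1 P.μ) atTop (𝓝 0)) {a b : ℝ}
    (ha : Tendsto (fun j => P.energyP (g j)) atTop (𝓝 a))
    (hb : Tendsto (fun j => P.energyQ (g j)) atTop (𝓝 b)) :
    ∃ w, P.IsW0 y w ∧ ∀ α β : ℝ, 0 < α → 0 < β →
      α * P.energyP w + β * P.energyQ w ≤ α * a + β * b := by
  refine hP.exists_isW0_forall_energy_le hy fun α β M hα hβ hM ε hε => ?_
  obtain ⟨j, h1, h2⟩ := ((((ha.const_mul α).add (hb.const_mul β)).eventually_lt_const hM).and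
    (hlim.eventually_lt_const (pos_iff_ne_zero.2 hε))).exists
  exact ⟨u j, g j, hu j, h2.le, h1.le⟩

end Data

end DoublePhase

/-! ### Compactness in `L¹` by mollification -/

namespace DoublePhase

section Mollification

variable {n : ℕ}

/-- The `L¹` modulus of continuity of a test function is controlled by its gradient. -/
lemma lintegral_enorm_sub_translate_le {φ : EuclideanSpace ℝ (Fin n) → ℝ} (hφ : ContDiff ℝ 1 φ)
    (z : EuclideanSpace ℝ (Fin n)) :
    ∫⁻ x, ‖φ x - φ (x - z)‖ₑ ≤ ‖z‖ₑ * ∫⁻ x, ‖gradient φ x‖ₑ := by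
  have hg : Continuous (gradient φ) :=
    (InnerProductSpace.toDual ℝ _).symm.continuous.comp (hφ.continuous_fderiv one_ne_zero)
  have hpt : ∀ x, ‖φ x - φ (x - z)‖ₑ
      ≤ ∫⁻ s in Ioc (0 : ℝ) 1, ‖gradient φ (x + (s - 1) • z)‖ₑ * ‖z‖ₑ := by
    intro x
    have hd : ∀ s : ℝ, HasDerivAt (fun s : ℝ => φ (x + (s - 1) • z))
        (inner ℝ (gradient φ (x + (s - 1) • z)) z) s := by
      intro s
      have h1 : HasDerivAt (fun s : ℝ => x + (s - 1) • z) z s := by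
        simpa using (((hasDerivAt_id s).sub_const 1).smul_const z).const_add x
      have h2 := ((hφ.differentiable one_ne_zero) (x + (s - 1) • z)).hasFDerivAt.comp_hasDerivAt s h1
      rw [inner_gradient_left]
      exact h2
    have hc : Continuous fun s : ℝ => inner ℝ (gradient φ (x + (s - 1) • z)) z := by fun_prop
    have h3 := intervalIntegral.integral_eq_sub_of_hasDerivAt (fun s _ => hd s)
      (hc.intervalIntegrable 0 1)
    have e : φ x - φ (x - z) = ∫ s in (0 : ℝ)..1, inner ℝ (gradient φ (x + (s - 1) • z)) z := by
      rw [h3]; simp [sub_eq_add_neg]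
    rw [e, intervalIntegral.integral_of_le zero_le_one]
    refine (enorm_integral_le_lintegral_enorm _).trans (lintegral_mono fun s => ?_)
    rw [← enorm_norm (gradient φ _), ← enorm_norm z, ← enorm_mul]
    exact enorm_le_iff_norm_le.2 (by
      rw [Real.norm_of_nonneg (by positivity : 0 ≤ ‖gradient φ (x + (s - 1) • z)‖ * ‖z‖)]
      exact norm_inner_le_norm _ _)
  calc ∫⁻ x, ‖φ x - φ (x - z)‖ₑ
      ≤ ∫⁻ x, ∫⁻ s in Ioc (0 : ℝ) 1, ‖gradient φ (x + (s - 1) • z)‖ₑ * ‖z‖ₑ := lintegral_mono hpt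
    _ = ∫⁻ s in Ioc (0 : ℝ) 1, ∫⁻ x, ‖gradient φ (x + (s - 1) • z)‖ₑ * ‖z‖ₑ := by
        refine lintegral_lintegral_swap (Measurable.aemeasurable ?_)
        have : Continuous fun w : EuclideanSpace ℝ (Fin n) × ℝ =>
          ‖gradient φ (w.1 + (w.2 - 1) • z)‖ₑ := by fun_prop
        exact this.measurable.mul_const _
    _ = ∫⁻ s in Ioc (0 : ℝ) 1, (∫⁻ x, ‖gradient φ x‖ₑ) * ‖z‖ₑ := by
        refine lintegral_congr fun s => ?_
        rw [lintegral_mul_const' _ _ enorm_ne_top,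
          lintegral_add_right_eq_self (fun x => ‖gradient φ x‖ₑ) ((s - 1) • z)]
    _ = ‖z‖ₑ * ∫⁻ x, ‖gradient φ x‖ₑ := by
        rw [setLIntegral_const]; simp [mul_comm]

/-- A bump function supported in the ball of radius `1 / (m + 1)`. -/
noncomputable def bump (n m : ℕ) : ContDiffBump (0 : EuclideanSpace ℝ (Fin n)) where
  rIn := 1 / (2 * ((m : ℝ) + 1))
  rOut := 1 / ((m : ℝ) + 1)
  rIn_pos := by positivity
  rIn_lt_rOut := by
    have : 0 < (m : ℝ) + 1 := by positivity
    rw [div_lt_div_iff_of_pos_left one_pos (by positivity) this]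
    linarith

/-- The mollifier of scale `1 / (m + 1)`. -/
noncomputable def mollifier (n m : ℕ) : EuclideanSpace ℝ (Fin n) → ℝ := (bump n m).normed volume

lemma continuous_mollifier (n m : ℕ) : Continuous (mollifier n m) := (bump n m).continuous_normed

lemma mollifier_nonneg (n m : ℕ) (x) : 0 ≤ mollifier n m x := (bump n m).nonneg_normed x

lemma hasCompactSupport_mollifier (n m : ℕ) : HasCompactSupport (mollifier n m) :=
  (bump n m).hasCompactSupport_normed

/-- Convolution with the mollifier of scale `1 / (m + 1)`. -/
noncomputable def mollify (m : ℕ) (φ : EuclideanSpace ℝ (Fin n) → ℝ)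
    (x : EuclideanSpace ℝ (Fin n)) : ℝ := ∫ z, mollifier n m (x - z) * φ z

lemma lintegral_enorm_mollifier (n m : ℕ) : ∫⁻ x, ‖mollifier n m x‖ₑ = 1 := by
  have h : Integrable (mollifier n m) := (bump n m).integrable_normed
  rw [← ofReal_integral_norm_eq_lintegral_enorm h]
  simp_rw [Real.norm_of_nonneg (mollifier_nonneg n m _)]
  rw [mollifier, (bump n m).integral_normed, ENNReal.ofReal_one]

/-- Mollification at scale `ε` moves a test function by at most `ε ∫|∇φ|` in `L¹`, uniformly over
sequences with bounded gradients. -/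
lemma lintegral_enorm_sub_mollify_le {φ : EuclideanSpace ℝ (Fin n) → ℝ} (hφ : ContDiff ℝ 1 φ)
    (m : ℕ) :
    ∫⁻ x, ‖φ x - mollify m φ x‖ₑ
      ≤ ENNReal.ofReal (1 / ((m : ℝ) + 1)) * ∫⁻ x, ‖gradient φ x‖ₑ := by
  have hmc := continuous_mollifier n m
  have hpt : ∀ x, ‖φ x - mollify m φ x‖ₑ ≤ ∫⁻ z, ‖mollifier n m z‖ₑ * ‖φ x - φ (x - z)‖ₑ := by
    intro x
    have e1 : mollify m φ x = ∫ z, mollifier n m z * φ (x - z) := by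
      unfold mollify
      rw [← integral_sub_left_eq_self _ volume x]
      simp
    have hi : Integrable (mollifier n m) := (bump n m).integrable_normed
    have e2 : φ x = ∫ z, mollifier n m z * φ x := by
      rw [integral_mul_const, mollifier, (bump n m).integral_normed, one_mul]
    have hi2 : Integrable fun z => mollifier n m z * φ (x - z) := by
      refine Continuous.integrable_of_hasCompactSupport ?_
        (hasCompactSupport_mollifier n m).mul_right
      have := hφ.continuous
      fun_prop
    have e3 : φ x - mollify m φ x = ∫ z, mollifier n m z * (φ x - φ (x - z)) := by
      rw [e1]
      conv_lhs => rw [e2]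
      rw [← integral_sub (hi.mul_const _) hi2]
      simp_rw [mul_sub]
    rw [e3]
    refine (enorm_integral_le_lintegral_enorm _).trans (le_of_eq ?_)
    simp_rw [enorm_mul]
  calc ∫⁻ x, ‖φ x - mollify m φ x‖ₑ
      ≤ ∫⁻ x, ∫⁻ z, ‖mollifier n m z‖ₑ * ‖φ x - φ (x - z)‖ₑ := lintegral_mono hpt
    _ = ∫⁻ z, ∫⁻ x, ‖mollifier n m z‖ₑ * ‖φ x - φ (x - z)‖ₑ := by
        refine lintegral_lintegral_swap (Measurable.aemeasurable ?_)
        have h := hφ.continuous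
        have h1 : Continuous fun w : EuclideanSpace ℝ (Fin n) × EuclideanSpace ℝ (Fin n) =>
          ‖mollifier n m w.2‖ₑ := by fun_prop
        have h2 : Continuous fun w : EuclideanSpace ℝ (Fin n) × EuclideanSpace ℝ (Fin n) =>
          ‖φ w.1 - φ (w.1 - w.2)‖ₑ := by fun_prop
        exact h1.measurable.mul h2.measurable
    _ ≤ ∫⁻ z, ‖mollifier n m z‖ₑ *
          (ENNReal.ofReal (1 / ((m : ℝ) + 1)) * ∫⁻ x, ‖gradient φ x‖ₑ) := by
        refine lintegral_mono fun z => ?_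
        rw [lintegral_const_mul' _ _ enorm_ne_top]
        by_cases hz : mollifier n m z = 0
        · simp [hz]
        refine mul_le_mul_right ((lintegral_enorm_sub_translate_le hφ z).trans
          (mul_le_mul_left ?_ _)) _
        have hz' : z ∈ Function.support ((bump n m).normed volume) := hz
        rw [(bump n m).support_normed_eq, mem_ball_zero_iff] at hz'
        rw [← ofReal_norm]
        exact ENNReal.ofReal_le_ofReal hz'.le
    _ = _ := by
        rw [lintegral_mul_const'', lintegral_enorm_mollifier, one_mul]
        exact hmc.enorm.aemeasurable

lemma abs_mollify_sub_le {φ : EuclideanSpace ℝ (Fin n) → ℝ} (hφ : Integrable φ) (m : ℕ)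
    {x x' : EuclideanSpace ℝ (Fin n)} {δ : ℝ}
    (h : ∀ z, |mollifier n m (x - z) - mollifier n m (x' - z)| ≤ δ) :
    |mollify m φ x - mollify m φ x'| ≤ δ * ∫ z, ‖φ z‖ := by
  obtain ⟨C, hC⟩ := (hasCompactSupport_mollifier n m).exists_bound_of_continuous
    (continuous_mollifier n m)
  have hi (x) : Integrable fun z => mollifier n m (x - z) * φ z := by
    refine Integrable.bdd_mul (c := C) hφ ?_ (ae_of_all _ fun z => hC _)
    have := continuous_mollifier n m
    exact Continuous.aestronglyMeasurable (by fun_prop)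
  unfold mollify
  rw [← integral_sub (hi x) (hi x'), ← Real.norm_eq_abs, ← integral_const_mul]
  refine norm_integral_le_of_norm_le (hφ.norm.const_mul δ) (ae_of_all _ fun z => ?_)
  rw [← sub_mul, norm_mul]
  exact mul_le_mul_of_nonneg_right (h z) (norm_nonneg _)

lemma exists_abs_mollify_le (n m : ℕ) : ∃ C : ℝ, 0 ≤ C ∧
    ∀ φ : EuclideanSpace ℝ (Fin n) → ℝ, Integrable φ → ∀ x, |mollify m φ x| ≤ C * ∫ z, ‖φ z‖ := by
  obtain ⟨C, hC⟩ := (hasCompactSupport_mollifier n m).exists_bound_of_continuous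
    (continuous_mollifier n m)
  refine ⟨C, (norm_nonneg _).trans (hC 0), fun φ hφ x => ?_⟩
  unfold mollify
  rw [← Real.norm_eq_abs, ← integral_const_mul]
  refine norm_integral_le_of_norm_le (hφ.norm.const_mul C) (ae_of_all _ fun z => ?_)
  rw [norm_mul]
  exact mul_le_mul_of_nonneg_right (hC _) (norm_nonneg _)

/-- Mollifications at a fixed scale of functions bounded in `L¹` are uniformly equicontinuous. -/
lemma equicontinuous_mollify (n m : ℕ) {N : ℝ} {ε : ℝ} (hε : 0 < ε) : ∃ δ > 0,
    ∀ φ : EuclideanSpace ℝ (Fin n) → ℝ, Integrable φ → ∫ z, ‖φ z‖ ≤ N → ∀ x x', dist x x' < δ →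
      |mollify m φ x - mollify m φ x'| ≤ ε := by
  have huc : UniformContinuous (mollifier n m) :=
    (continuous_mollifier n m).uniformContinuous_of_tendsto_cocompact
      (hasCompactSupport_mollifier n m).is_zero_at_infty
  obtain ⟨δ, hδ, h⟩ := Metric.uniformContinuous_iff.1 huc (ε / (|N| + 1)) (by positivity)
  refine ⟨δ, hδ, fun φ hφ hN x x' hx => ?_⟩
  have h0 : 0 ≤ ∫ z, ‖φ z‖ := integral_nonneg fun z => norm_nonneg _
  refine (abs_mollify_sub_le hφ m (δ := ε / (|N| + 1)) fun z => ?_).trans ?_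
  · have := h (a := x - z) (b := x' - z) (by rwa [dist_sub_right])
    exact this.le
  · rw [div_mul_eq_mul_div, div_le_iff₀ (by positivity)]
    exact mul_le_mul_of_nonneg_left (by linarith [le_abs_self N]) hε.le

/-- Along a subsequence the mollifications at every scale converge pointwise. -/
lemma exists_subseq_mollify_tendsto {φ : ℕ → EuclideanSpace ℝ (Fin n) → ℝ}
    (hφ : ∀ j, Integrable (φ j)) {N : ℝ} (hN : ∀ j, ∫ z, ‖φ j z‖ ≤ N) :
    ∃ σ : ℕ → ℕ, StrictMono σ ∧ ∀ m x, ∃ L, Tendsto (fun j => mollify m (φ (σ j)) x) atTop (𝓝 L) := by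
  choose C hC0 hC using exists_abs_mollify_le n
  have hb : ∀ m j x, |mollify m (φ j) x| ≤ C m * N := fun m j x =>
    (hC m (φ j) (hφ j) x).trans (mul_le_mul_of_nonneg_left (hN j) (hC0 m))
  -- diagonal extraction over all scales and all points of a dense sequence, by Tychonoff
  have hcomp : IsCompact (univ.pi fun mi : ℕ × ℕ => Icc (-(C mi.1 * N)) (C mi.1 * N)) :=
    isCompact_univ_pi fun mi => isCompact_Icc
  obtain ⟨F, -, σ, hσ, hF⟩ := hcomp.tendsto_subseq (x := fun j (mi : ℕ × ℕ) =>
    mollify mi.1 (φ j) (TopologicalSpace.denseSeq (EuclideanSpace ℝ (Fin n)) mi.2))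
    fun j mi _ => abs_le.1 (hb _ _ _)
  rw [tendsto_pi_nhds] at hF
  refine ⟨σ, hσ, fun m x => cauchySeq_tendsto_of_complete ?_⟩
  rw [Metric.cauchySeq_iff']
  intro ε hε
  obtain ⟨δ, hδ, hδ'⟩ := equicontinuous_mollify n m (N := N) (ε := ε / 4) (by positivity)
  obtain ⟨i, hi⟩ := (TopologicalSpace.denseRange_denseSeq (EuclideanSpace ℝ (Fin n))).exists_dist_lt
    x hδ
  obtain ⟨J, hJ⟩ := Metric.cauchySeq_iff'.1 (hF (m, i)).cauchySeq (ε / 4) (by positivity)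
  refine ⟨J, fun j hj => ?_⟩
  have h1 := hδ' (φ (σ j)) (hφ _) (hN _) x _ hi
  have h2 := hδ' (φ (σ J)) (hφ _) (hN _) x _ hi
  have h3 := hJ j hj
  simp only [Function.comp, Real.dist_eq] at h3 ⊢
  rw [abs_le] at h1 h2
  rw [abs_lt] at h3 ⊢
  constructor <;> linarith [h1.1, h1.2, h2.1, h2.2, h3.1, h3.2]

/-- Rellich–Kondrachov in `L¹` for test functions: a sequence of test functions bounded together
with their gradients in `L¹` has a subsequence converging in `L¹(Ω)`. -/
lemma exists_subseq_tendsto_eLpNorm_one {m₀ : Measure (EuclideanSpace ℝ (Fin n))}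
    [IsFiniteMeasure m₀] (hm₀ : m₀ ≤ volume) {φ : ℕ → EuclideanSpace ℝ (Fin n) → ℝ}
    (hφ : ∀ j, ContDiff ℝ 1 (φ j)) (hc : ∀ j, HasCompactSupport (φ j))
    {N : ℝ} (hN : ∀ j, ∫ z, ‖φ j z‖ ≤ N) {M : ℝ≥0∞} (hM : M ≠ ⊤)
    (hgrad : ∀ j, ∫⁻ x, ‖gradient (φ j) x‖ₑ ≤ M) :
    ∃ σ : ℕ → ℕ, StrictMono σ ∧ ∃ y : EuclideanSpace ℝ (Fin n) → ℝ, MemLp y 1 m₀ ∧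
      Tendsto (fun j => eLpNorm (fun x => y x - φ (σ j) x) 1 m₀) atTop (𝓝 0) := by
  have hint : ∀ j, Integrable (φ j) := fun j =>
    (hφ j).continuous.integrable_of_hasCompactSupport (hc j)
  obtain ⟨σ, hσ, hlim⟩ := exists_subseq_mollify_tendsto hint hN
  refine ⟨σ, hσ, ?_⟩
  choose Ψ hΨ using hlim
  have hmc : ∀ m j, Continuous (mollify m (φ j)) := by
    intro m j
    rw [Metric.continuous_iff]
    intro x ε hε
    obtain ⟨δ, hδ, h⟩ := equicontinuous_mollify n m (N := N) (ε := ε / 2) (by positivity)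
    exact ⟨δ, hδ, fun x' hx' => (h _ (hint j) (hN j) x' x hx').trans_lt (by linarith)⟩
  have hΨm : ∀ m, Measurable (Ψ m) := fun m =>
    measurable_of_tendsto_metrizable (fun j => (hmc m (σ j)).measurable)
      (tendsto_pi_nhds.2 fun x => hΨ m x)
  -- convergence in `L¹` at each scale, by dominated convergence
  have hL1 : ∀ m, Tendsto (fun j => ∫⁻ x, ‖mollify m (φ (σ j)) x - Ψ m x‖ₑ ∂m₀) atTop (𝓝 0) := by
    intro m
    obtain ⟨C, hC0, hC⟩ := exists_abs_mollify_le n m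
    have hb : ∀ j x, |mollify m (φ (σ j)) x| ≤ C * N := fun j x =>
      (hC _ (hint _) x).trans (mul_le_mul_of_nonneg_left (hN _) hC0)
    have hbΨ : ∀ x, |Ψ m x| ≤ C * N := fun x =>
      le_of_tendsto (hΨ m x).abs (Eventually.of_forall fun j => hb j x)
    have := tendsto_lintegral_of_dominated_convergence (μ := m₀)
      (F := fun j x => ‖mollify m (φ (σ j)) x - Ψ m x‖ₑ) (f := fun _ => 0)
      (fun _ => ENNReal.ofReal (C * N + C * N))
      (fun j => ((hmc m (σ j)).measurable.sub (hΨm m)).enorm) (fun j => ae_of_all _ fun x => ?_)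
      ?_ (ae_of_all _ fun x => ?_)
    · simpa using this
    · beta_reduce
      rw [Real.enorm_eq_ofReal_abs]
      exact ENNReal.ofReal_le_ofReal ((abs_sub _ _).trans (add_le_add (hb j x) (hbΨ x)))
    · rw [lintegral_const]
      exact (ENNReal.mul_lt_top ENNReal.ofReal_lt_top (measure_lt_top _ _)).ne
    · have h := ((hΨ m x).sub_const (Ψ m x)).enorm
      simpa using h
  have hmemLp : ∀ j, MemLp (φ j) 1 m₀ := fun j =>
    (memLp_one_iff_integrable.2 (hint j)).mono_measure hm₀
  have hmoll : ∀ m j, ∫⁻ x, ‖φ (σ j) x - mollify m (φ (σ j)) x‖ₑ ∂m₀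
      ≤ ENNReal.ofReal (1 / ((m : ℝ) + 1)) * M := fun m j =>
    (lintegral_mono' hm₀ le_rfl).trans ((lintegral_enorm_sub_mollify_le (hφ _) m).trans
      (mul_le_mul_right (hgrad _) _))
  -- the sequence is Cauchy in `L¹`: go from `φ` to its mollification at a fine scale `m` and back
  have hC : Tendsto (fun ij : ℕ × ℕ => eLpNorm (φ (σ ij.1) - φ (σ ij.2)) 1 m₀) atTop (𝓝 0) := by
    have t1 : Tendsto (fun ij : ℕ × ℕ => ij.1) atTop atTop := by
      rw [← prod_atTop_atTop_eq]; exact tendsto_fst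
    have t2 : Tendsto (fun ij : ℕ × ℕ => ij.2) atTop atTop := by
      rw [← prod_atTop_atTop_eq]; exact tendsto_snd
    have hb : ∀ (m : ℕ) (ij : ℕ × ℕ), eLpNorm (φ (σ ij.1) - φ (σ ij.2)) 1 m₀
        ≤ (ENNReal.ofReal (1 / ((m : ℝ) + 1)) * M + ENNReal.ofReal (1 / ((m : ℝ) + 1)) * M)
          + ((∫⁻ x, ‖mollify m (φ (σ ij.1)) x - Ψ m x‖ₑ ∂m₀)
            + ∫⁻ x, ‖mollify m (φ (σ ij.2)) x - Ψ m x‖ₑ ∂m₀) := by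
      intro m ij
      have a1 (j) : AEMeasurable (fun x => ‖φ (σ j) x - mollify m (φ (σ j)) x‖ₑ) m₀ :=
        ((hφ (σ j)).continuous.sub (hmc m (σ j))).enorm.aemeasurable
      have a2 (j) : AEMeasurable (fun x => ‖mollify m (φ (σ j)) x - Ψ m x‖ₑ) m₀ :=
        ((hmc m (σ j)).measurable.sub (hΨm m)).enorm.aemeasurable
      rw [eLpNorm_one_eq_lintegral_enorm]
      refine le_trans ?_ (add_le_add (add_le_add (hmoll m ij.1) (hmoll m ij.2)) le_rfl)
      have e0 := lintegral_add_left' ((a1 ij.1).add (a1 ij.2)) fun x =>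
        ‖mollify m (φ (σ ij.1)) x - Ψ m x‖ₑ + ‖mollify m (φ (σ ij.2)) x - Ψ m x‖ₑ
      simp only [Pi.add_apply] at e0
      rw [← lintegral_add_left' (a1 _), ← lintegral_add_left' (a2 _), ← e0]
      refine lintegral_mono fun x => ?_
      have e : φ (σ ij.1) x - φ (σ ij.2) x = ((φ (σ ij.1) x - mollify m (φ (σ ij.1)) x)
          - (φ (σ ij.2) x - mollify m (φ (σ ij.2)) x))
          + ((mollify m (φ (σ ij.1)) x - Ψ m x) - (mollify m (φ (σ ij.2)) x - Ψ m x)) := by ring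
      rw [Pi.sub_apply, e]
      exact (enorm_add_le _ _).trans (add_le_add (enorm_sub_le) (enorm_sub_le))
    rw [ENNReal.tendsto_nhds_zero]
    intro ε hε
    have hε2 : ε / 2 ≠ 0 := by simp [hε.ne']
    have hscale : Tendsto (fun m : ℕ => ENNReal.ofReal (1 / ((m : ℝ) + 1)) * M
        + ENNReal.ofReal (1 / ((m : ℝ) + 1)) * M) atTop (𝓝 0) := by
      have h := ENNReal.tendsto_ofReal (tendsto_one_div_add_atTop_nhds_zero_nat (𝕜 := ℝ))
      have h' := ENNReal.Tendsto.mul_const (b := M) h (Or.inr hM)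
      simpa using h'.add h'
    obtain ⟨m, hm⟩ := (hscale.eventually_lt_const (pos_iff_ne_zero.2 hε2)).exists
    have hsum := ((hL1 m).comp t1).add ((hL1 m).comp t2)
    rw [add_zero] at hsum
    filter_upwards [hsum.eventually_lt_const (pos_iff_ne_zero.2 hε2)] with ij hij
    exact (hb m ij).trans ((add_le_add hm.le hij.le).trans_eq (ENNReal.add_halves ε))
  have hcs : CauchySeq fun j => (hmemLp (σ j)).toLp (φ (σ j)) := by
    rw [Lp.cauchySeq_Lp_iff_cauchySeq_eLpNorm]
    refine hC.congr fun ij => ?_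
    exact eLpNorm_congr_ae ((hmemLp _).coeFn_toLp.sub (hmemLp _).coeFn_toLp).symm
  obtain ⟨y, hy⟩ := cauchySeq_tendsto_of_complete hcs
  refine ⟨y, Lp.memLp y, ?_⟩
  rw [Lp.tendsto_Lp_iff_tendsto_eLpNorm'] at hy
  refine hy.congr fun j => ?_
  rw [eLpNorm_sub_comm]
  exact eLpNorm_congr_ae ((EventuallyEq.refl _ _).sub (hmemLp _).coeFn_toLp)

end Mollification

section Interpolation

variable {α V : Type*} {mα : MeasurableSpace α} {m : Measure α} [NormedAddCommGroup V]

/-- Convergence in `L¹` and boundedness in `L^r` give convergence in `L^k` for `1 < k < r`. -/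
lemma tendsto_integral_norm_rpow_of_interpolation {k r : ℝ} (hk : 1 < k)
    (hkr : k < r) {f : ℕ → α → V} (hf1 : ∀ j, MemLp (f j) 1 m)
    (hf : ∀ j, MemLp (f j) (ENNReal.ofReal r) m)
    {R : ℝ} (hR : ∀ j, ∫ x, ‖f j x‖ ^ r ∂m ≤ R)
    (h1 : Tendsto (fun j => eLpNorm (f j) 1 m) atTop (𝓝 0)) :
    Tendsto (fun j => ∫ x, ‖f j x‖ ^ k ∂m) atTop (𝓝 0) := by
  have hint1 : ∀ j, Integrable (fun x => ‖f j x‖) m := fun j =>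
    (memLp_one_iff_integrable.1 (hf1 j)).norm
  have h1' : Tendsto (fun j => ∫ x, ‖f j x‖ ∂m) atTop (𝓝 0) := by
    have := (ENNReal.tendsto_toReal ENNReal.zero_ne_top).comp h1
    refine this.congr fun j => ?_
    simp only [Function.comp]
    rw [eLpNorm_one_eq_lintegral_enorm, ← ofReal_integral_norm_eq_lintegral_enorm
      (memLp_one_iff_integrable.1 (hf1 j)), ENNReal.toReal_ofReal
      (integral_nonneg fun x => norm_nonneg _)]
  have hintr : ∀ j, Integrable (fun x => ‖f j x‖ ^ r) m := fun j =>
    integrable_norm_rpow (by linarith) (hf j)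
  rw [tendsto_order]
  refine ⟨fun a ha => Eventually.of_forall fun j => ha.trans_le
    (integral_nonneg fun x => by positivity), fun ε hε => ?_⟩
  set δ := ε / 2 / (|R| + 1) with hδ
  have hδ0 : 0 < δ := by positivity
  obtain ⟨T, hT, hT0⟩ := ((tendsto_rpow_neg_atTop (by linarith : 0 < r - k)).eventually_lt_const
    hδ0 |>.and (eventually_gt_atTop 0)).exists
  -- the first term bounds `t ^ k` for `t ≥ T`, the second one for `t ≤ T`
  have hpt : ∀ t : ℝ, 0 ≤ t → t ^ k ≤ δ * t ^ r + T ^ (k - 1) * t := by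
    intro t ht
    rcases eq_or_lt_of_le ht with rfl | ht0
    · rw [Real.zero_rpow (by linarith), Real.zero_rpow (by linarith)]; simp
    have hr0 : 0 ≤ t ^ r := by positivity
    rcases le_total T t with hTt | hTt
    · have e : t ^ k = t ^ (-(r - k)) * t ^ r := by rw [← Real.rpow_add ht0]; ring_nf
      have : t ^ (-(r - k)) ≤ δ :=
        (Real.rpow_le_rpow_of_nonpos hT0 hTt (by linarith)).trans hT.le
      rw [e]
      have h2 := mul_le_mul_of_nonneg_right this hr0
      have h3 : 0 ≤ T ^ (k - 1) * t := by positivity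
      linarith
    · have e : t ^ k = t ^ (k - 1) * t := by
        rw [← Real.rpow_add_one ht0.ne']; ring_nf
      have : t ^ (k - 1) ≤ T ^ (k - 1) := Real.rpow_le_rpow ht hTt (by linarith)
      rw [e]
      have h2 := mul_le_mul_of_nonneg_right this ht
      have h3 : 0 ≤ δ * t ^ r := by positivity
      linarith
  have hlim := h1'.const_mul (T ^ (k - 1))
  rw [mul_zero] at hlim
  filter_upwards [hlim.eventually_lt_const (half_pos hε)] with j hj
  calc ∫ x, ‖f j x‖ ^ k ∂m ≤ ∫ x, (δ * ‖f j x‖ ^ r + T ^ (k - 1) * ‖f j x‖) ∂m := by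
        have hb := ((hintr j).const_mul δ).add ((hint1 j).const_mul (T ^ (k - 1)))
        refine integral_mono_of_nonneg (ae_of_all _ fun x => by positivity) hb
          (ae_of_all _ fun x => hpt _ (norm_nonneg _))
    _ = δ * ∫ x, ‖f j x‖ ^ r ∂m + T ^ (k - 1) * ∫ x, ‖f j x‖ ∂m := by
        rw [integral_add ((hintr j).const_mul δ) ((hint1 j).const_mul _), integral_const_mul,
          integral_const_mul]
    _ < δ * (|R| + 1) + ε / 2 := by
        refine add_lt_add_of_le_of_lt (mul_le_mul_of_nonneg_left ?_ hδ0.le) hj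
        linarith [hR j, le_abs_self R]
    _ = ε := by rw [hδ]; field_simp; ring

end Interpolation

end DoublePhase

/-! ### Compactness in `W_0` and the lower order terms -/

namespace DoublePhase

section FiniteMeasure

variable {α V : Type*} {mα : MeasurableSpace α} {m : Measure α} [NormedAddCommGroup V]

/-- Hölder's inequality on a finite measure space, for exponents possibly less than `1`. -/
lemma exists_integral_norm_rpow_le [IsFiniteMeasure m] {s r : ℝ} (hs : 0 < s) (hsr : s ≤ r) :
    ∃ c : ℝ, 0 ≤ c ∧ ∀ f : α → V, MemLp f (ENNReal.ofReal r) m →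
      ∫ x, ‖f x‖ ^ s ∂m ≤ c * (∫ x, ‖f x‖ ^ r ∂m) ^ (s / r) := by
  have hr : 0 < r := hs.trans_le hsr
  set C : ℝ≥0∞ := m univ ^ (1 / (ENNReal.ofReal s).toReal - 1 / (ENNReal.ofReal r).toReal) with hC
  have hCtop : C ≠ ⊤ := by
    refine ENNReal.rpow_ne_top_of_nonneg ?_ (measure_ne_top _ _)
    rw [ENNReal.toReal_ofReal hs.le, ENNReal.toReal_ofReal hr.le, sub_nonneg]
    exact one_div_le_one_div_of_le hs hsr
  refine ⟨C.toReal ^ s, by positivity, fun f hf => ?_⟩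
  have hsr' : ENNReal.ofReal s ≤ ENNReal.ofReal r := ENNReal.ofReal_le_ofReal hsr
  have h1 : eLpNorm f (ENNReal.ofReal s) m ≤ eLpNorm f (ENNReal.ofReal r) m * C :=
    eLpNorm_le_eLpNorm_mul_rpow_measure_univ hsr' hf.1
  have h2 := ENNReal.toReal_mono (ENNReal.mul_ne_top hf.2.ne hCtop) h1
  rw [ENNReal.toReal_mul] at h2
  rw [integral_norm_rpow_eq hs (hf.mono_exponent hsr'), integral_norm_rpow_eq hr hf,
    ← Real.rpow_mul ENNReal.toReal_nonneg, mul_div_cancel₀ _ hr.ne', mul_comm,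
    ← Real.mul_rpow ENNReal.toReal_nonneg ENNReal.toReal_nonneg]
  exact Real.rpow_le_rpow ENNReal.toReal_nonneg h2 hs.le

end FiniteMeasure

namespace Data

variable {n : ℕ} {P : Data n}

namespace Admissible

variable (hP : P.Admissible)
include hP

lemma one_le_critExp : 1 ≤ critExp n P.p := hP.exps.p_gt.le.trans hP.p_le_critExp

lemma memLp {y g} (h : P.IsW0 y g) {r : ℝ} (hr : r ≤ critExp n P.p) :
    MemLp y (ENNReal.ofReal r) P.μ := by
  have := hP.isFiniteMeasure
  obtain ⟨c, hc⟩ := hP.sobolev hP.one_le_critExp le_rfl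
  have : MemLp y (ENNReal.ofReal (critExp n P.p)) P.μ :=
    ⟨h.meas, (hc y g h).trans_lt (ENNReal.mul_lt_top ENNReal.coe_lt_top (h.memH hP).1.2)⟩
  exact this.mono_exponent (ENNReal.ofReal_le_ofReal hr)

lemma memLp_deg {y g} (h : P.IsW0 y g) : MemLp y (ENNReal.ofReal P.deg) P.μ :=
  hP.memLp h hP.crit.le

lemma exists_integral_critExp_le : ∃ c : ℝ, 0 ≤ c ∧ ∀ y g, P.IsW0 y g →
    ∫ x, ‖y x‖ ^ critExp n P.p ∂P.μ ≤ c * P.energyP g ^ (critExp n P.p / P.p) := by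
  have hr0 : 0 < critExp n P.p := by linarith [hP.one_le_critExp]
  obtain ⟨c, hc⟩ := hP.sobolev hP.one_le_critExp le_rfl
  refine ⟨(c : ℝ) ^ critExp n P.p, by positivity, fun y g h => ?_⟩
  have h1 := ENNReal.toReal_mono (ENNReal.mul_ne_top ENNReal.coe_ne_top (h.memH hP).1.2.ne)
    (hc y g h)
  rw [ENNReal.toReal_mul, ENNReal.coe_toReal] at h1
  rw [integral_norm_rpow_eq hr0 (hP.memLp h le_rfl), energyP,
    integral_norm_rpow_eq hP.p_pos (h.memH hP).1, ← Real.rpow_mul ENNReal.toReal_nonneg,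
    mul_div_cancel₀ _ hP.p_pos.ne', ← Real.mul_rpow c.coe_nonneg ENNReal.toReal_nonneg]
  exact Real.rpow_le_rpow ENNReal.toReal_nonneg h1 hr0.le

/-- The Sobolev inequality in integral form. -/
lemma exists_integral_le {s : ℝ} (hs : 0 < s) (hs' : s ≤ critExp n P.p) : ∃ c : ℝ, 0 ≤ c ∧
    ∀ y g, P.IsW0 y g → ∫ x, ‖y x‖ ^ s ∂P.μ ≤ c * P.energyP g ^ (s / P.p) := by
  have := hP.isFiniteMeasure
  have hr0 : 0 < critExp n P.p := by linarith [hP.one_le_critExp]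
  obtain ⟨c₁, hc₁, h1⟩ := hP.exists_integral_critExp_le
  obtain ⟨c₂, hc₂, h2⟩ := exists_integral_norm_rpow_le (m := P.μ) (V := ℝ) hs hs'
  refine ⟨c₂ * c₁ ^ (s / critExp n P.p), by positivity, fun y g h => ?_⟩
  refine (h2 y (hP.memLp h le_rfl)).trans ?_
  rw [mul_assoc]
  refine mul_le_mul_of_nonneg_left ?_ hc₂
  have h0 : 0 ≤ ∫ x, ‖y x‖ ^ critExp n P.p ∂P.μ := integral_nonneg fun x => by positivity
  have hE := energyP_nonneg (P := P) g
  refine (Real.rpow_le_rpow h0 (h1 y g h) (by positivity)).trans (le_of_eq ?_)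
  rw [Real.mul_rpow hc₁ (by positivity), ← Real.rpow_mul hE]
  congr 2
  field_simp

/-- Rellich–Kondrachov: sequences in `W_0` bounded in energy have subsequences converging in
`L¹(Ω)` and in `L^k(Ω)`. -/
lemma exists_subseq_tendsto {u : ℕ → EuclideanSpace ℝ (Fin n) → ℝ}
    {g : ℕ → EuclideanSpace ℝ (Fin n) → EuclideanSpace ℝ (Fin n)}
    (hu : ∀ j, P.IsW0 (u j) (g j)) {M : ℝ} (hM : ∀ j, P.energyP (g j) ≤ M) :
    ∃ σ : ℕ → ℕ, StrictMono σ ∧ ∃ y : EuclideanSpace ℝ (Fin n) → ℝ,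
      MemLp y (ENNReal.ofReal P.deg) P.μ ∧
      Tendsto (fun j => eLpNorm (fun x => y x - u (σ j) x) 1 P.μ) atTop (𝓝 0) ∧
      Tendsto (fun j => ∫ x, ‖u (σ j) x - y x‖ ^ P.deg ∂P.μ) atTop (𝓝 0) := by
  have hfin := hP.isFiniteMeasure
  have hM0 : 0 ≤ M := (energyP_nonneg (g 0)).trans (hM 0)
  set R : ℝ≥0∞ := ENNReal.ofReal (M ^ (P.p)⁻¹) with hR
  have hgR : ∀ j, eLpNorm (g j) (ENNReal.ofReal P.p) P.μ ≤ R := fun j => by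
    rw [((hu j).memH hP).1.eLpNorm_eq_integral_rpow_norm (by simpa using hP.p_pos)
      ENNReal.ofReal_ne_top, ENNReal.toReal_ofReal hP.p_pos.le]
    exact ENNReal.ofReal_le_ofReal (Real.rpow_le_rpow (energyP_nonneg (P := P) (g j)) (hM j)
      (by have := hP.p_pos; positivity))
  -- replace `u j` by test functions whose distance to `u j` tends to `0`
  choose φ hφ h1 h2 _ using fun j : ℕ => (hu j).approx ((j : ℝ≥0∞) + 1)⁻¹ (by simp)
  have hinv : Tendsto (fun k : ℕ => ((k : ℝ≥0∞) + 1)⁻¹) atTop (𝓝 0) := by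
    refine (ENNReal.tendsto_inv_nat_nhds_zero.comp (tendsto_add_atTop_nat 1)).congr fun k => ?_
    simp
  have hinv1 : ∀ k : ℕ, ((k : ℝ≥0∞) + 1)⁻¹ ≤ 1 := fun k => by
    rw [ENNReal.inv_le_one]; exact le_add_self
  have hφR : ∀ j, eLpNorm (gradient (φ j)) (ENNReal.ofReal P.p) P.μ ≤ R + 1 := fun j => by
    have m2 : AEStronglyMeasurable (gradient (φ j)) P.μ :=
      (hφ j).continuous_gradient.aestronglyMeasurable
    have := eLpNorm_sub_le (hu j).meas_grad ((hu j).meas_grad.sub m2) hP.one_le_p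
    refine le_trans (le_of_eq ?_) (this.trans (add_le_add (hgR j) ((h2 j).trans (hinv1 j))))
    congr 1; ext x; simp
  obtain ⟨c₁, hc₁, hle₁⟩ := exists_eLpNorm_one_le (m := P.μ) (V := EuclideanSpace ℝ (Fin n))
    hP.one_le_p
  obtain ⟨c₂, hle₂⟩ := hP.sobolev_test le_rfl hP.one_le_critExp
  have hgrad : ∀ j, ∫⁻ x, ‖gradient (φ j) x‖ₑ ≤ c₁ * (R + 1) := fun j => by
    have hs : Function.support (gradient (φ j)) ⊆ P.Ω := by
      refine (Function.support_subset_iff'.2 fun x hx => ?_)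
      unfold gradient
      rw [image_eq_zero_of_notMem_tsupport
        (fun h' => hx ((hφ j).2.2 (tsupport_fderiv_subset ℝ h'))), map_zero]
    rw [← eLpNorm_one_eq_lintegral_enorm, ← eLpNorm_restrict_eq_of_support_subset hs]
    exact (hle₁ _ (hφ j).continuous_gradient.aestronglyMeasurable).trans
      (mul_le_mul_right (hφR j) _)
  have hN : ∀ j, ∫ z, ‖φ j z‖ ≤ (c₂ * (R + 1) : ℝ≥0∞).toReal := fun j => by
    have hs : Function.support (φ j) ⊆ P.Ω := (subset_tsupport _).trans (hφ j).2.2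
    have hi : Integrable (φ j) := (hφ j).1.continuous.integrable_of_hasCompactSupport (hφ j).2.1
    have h3 := hle₂ (φ j) (hφ j)
    rw [ENNReal.ofReal_one, μ, eLpNorm_restrict_eq_of_support_subset hs,
      eLpNorm_one_eq_lintegral_enorm, ← ofReal_integral_norm_eq_lintegral_enorm hi] at h3
    rw [← ENNReal.ofReal_le_iff_le_toReal (ENNReal.mul_ne_top ENNReal.coe_ne_top (by finiteness))]
    exact h3.trans (mul_le_mul_right (hφR j) _)
  obtain ⟨σ, hσ, y, hy1, hylim⟩ := exists_subseq_tendsto_eLpNorm_one (m₀ := P.μ)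
    Measure.restrict_le_self (fun j => (hφ j).1.of_le (by simp)) (fun j => (hφ j).2.1) hN
    (ENNReal.mul_ne_top hc₁ (by finiteness)) hgrad
  have hL1 : Tendsto (fun j => eLpNorm (fun x => y x - u (σ j) x) 1 P.μ) atTop (𝓝 0) := by
    have hs := hylim.add (hinv.comp hσ.tendsto_atTop)
    rw [add_zero] at hs
    refine tendsto_of_tendsto_of_tendsto_of_le_of_le tendsto_const_nhds hs (fun _ => zero_le)
      fun j => ?_
    have m1 : AEStronglyMeasurable (φ (σ j)) P.μ := (hφ _).1.continuous.aestronglyMeasurable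
    have h3 := eLpNorm_sub_le (hy1.1.sub m1) ((hu (σ j)).meas.sub m1) (le_refl 1)
    refine le_trans (le_of_eq ?_) (h3.trans (add_le_add le_rfl (h1 (σ j))))
    congr 1; ext x; simp
  obtain ⟨c₃, hle₃⟩ := hP.sobolev hP.one_le_critExp le_rfl
  have hur : ∀ j, eLpNorm (u j) (ENNReal.ofReal (critExp n P.p)) P.μ ≤ c₃ * R := fun j =>
    (hle₃ _ _ (hu j)).trans (mul_le_mul_right (hgR j) _)
  have hyr : eLpNorm y (ENNReal.ofReal (critExp n P.p)) P.μ ≤ c₃ * R := by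
    refine eLpNorm_le_of_approx one_ne_zero hy1.1 fun ε hε => ?_
    obtain ⟨j, hj⟩ := (hL1.eventually_lt_const (pos_iff_ne_zero.2 hε)).exists
    exact ⟨u (σ j), (hu _).meas, hj.le, hur _⟩
  have hcR : (c₃ * R : ℝ≥0∞) ≠ ⊤ := ENNReal.mul_ne_top ENNReal.coe_ne_top ENNReal.ofReal_ne_top
  have hyLp : MemLp y (ENNReal.ofReal (critExp n P.p)) P.μ := ⟨hy1.1, hyr.trans_lt hcR.lt_top⟩
  have hr0 : 0 < critExp n P.p := by linarith [hP.one_le_critExp]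
  refine ⟨σ, hσ, y, hyLp.mono_exponent (ENNReal.ofReal_le_ofReal hP.crit.le), hL1, ?_⟩
  have hmem : ∀ j, MemLp (fun x => u (σ j) x - y x) (ENNReal.ofReal (critExp n P.p)) P.μ :=
    fun j => (hP.memLp (hu _) le_rfl).sub hyLp
  refine tendsto_integral_norm_rpow_of_interpolation (r := critExp n P.p)
    (R := ((c₃ * R + c₃ * R : ℝ≥0∞).toReal) ^ critExp n P.p)
    (by linarith [hP.exps.p_gt, hP.exps.p_lt, hP.exps.q_lt]) hP.crit
    (fun j => (memLp_one_iff_integrable.2 (hu _).integrable).sub hy1) hmem (fun j => ?_) ?_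
  · rw [integral_norm_rpow_eq hr0 (hmem j)]
    refine Real.rpow_le_rpow ENNReal.toReal_nonneg (ENNReal.toReal_mono (by finiteness) ?_) hr0.le
    refine (eLpNorm_sub_le (hu _).meas hy1.1 ?_).trans (add_le_add (hur _) hyr)
    rw [← ENNReal.ofReal_one]; exact ENNReal.ofReal_le_ofReal hP.one_le_critExp
  · refine hL1.congr fun j => ?_
    exact eLpNorm_sub_comm _ _ _ _

end Admissible

/-- The singular term `∫_Ω a |y|^{1-ν}` of the energy. -/
noncomputable def singular (P : Data n) (a y : EuclideanSpace ℝ (Fin n) → ℝ) : ℝ :=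
  ∫ x, a x * |y x| ^ (1 - P.ν) ∂P.μ

/-- The coupling term `∫_Ω |y₁|^{κ₁+1} |y₂|^{κ₂+1}` of the energy. -/
noncomputable def coupling (P : Data n) (y₁ y₂ : EuclideanSpace ℝ (Fin n) → ℝ) : ℝ :=
  ∫ x, |y₁ x| ^ (P.κ₁ + 1) * |y₂ x| ^ (P.κ₂ + 1) ∂P.μ

namespace Admissible

variable (hP : P.Admissible)
include hP

lemma κ₁_pos : 0 < P.κ₁ := by linarith [hP.q_lt₁, hP.exps.p_gt, hP.exps.p_lt]
lemma κ₂_pos : 0 < P.κ₂ := by linarith [hP.q_lt₂, hP.exps.p_gt, hP.exps.p_lt]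

lemma one_sub_ν_pos : 0 < 1 - P.ν := by linarith [hP.exps.ν_lt]

lemma one_sub_ν_le : 1 - P.ν ≤ critExp n P.p := by linarith [hP.exps.ν_pos, hP.one_le_critExp]

lemma integrable_rpow_one_sub {y : EuclideanSpace ℝ (Fin n) → ℝ} (hy : Integrable y P.μ) :
    Integrable (fun x => |y x| ^ (1 - P.ν)) P.μ := by
  have := hP.isFiniteMeasure
  refine integrable_norm_rpow hP.one_sub_ν_pos ((memLp_one_iff_integrable.2 hy).mono_exponent ?_)
  rw [← ENNReal.ofReal_one]
  exact ENNReal.ofReal_le_ofReal (by linarith [hP.exps.ν_pos])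

omit hP in
lemma ae_norm_le {a : EuclideanSpace ℝ (Fin n) → ℝ} (ha : MemLp a ⊤ P.μ) :
    ∀ᵐ x ∂P.μ, ‖a x‖ ≤ (eLpNorm a ⊤ P.μ).toReal := by
  filter_upwards [ae_le_eLpNormEssSup (f := a) (μ := P.μ)] with x hx
  rw [eLpNorm_exponent_top, ← toReal_enorm]
  exact ENNReal.toReal_mono (by simpa using ha.2.ne) hx

lemma integrable_singular {a y : EuclideanSpace ℝ (Fin n) → ℝ} (ha : MemLp a ⊤ P.μ)
    (hy : Integrable y P.μ) : Integrable (fun x => a x * |y x| ^ (1 - P.ν)) P.μ :=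
  (hP.integrable_rpow_one_sub hy).bdd_mul ha.1 (ae_norm_le ha)

lemma exists_singular_le {a : EuclideanSpace ℝ (Fin n) → ℝ} (ha : MemLp a ⊤ P.μ) :
    ∃ c : ℝ, 0 ≤ c ∧ ∀ y g, P.IsW0 y g →
      P.singular a y ≤ c * P.energyP g ^ ((1 - P.ν) / P.p) := by
  obtain ⟨c, hc, h⟩ := hP.exists_integral_le hP.one_sub_ν_pos hP.one_sub_ν_le
  refine ⟨(eLpNorm a ⊤ P.μ).toReal * c, by positivity, fun y g hy => ?_⟩
  calc P.singular a y ≤ ∫ x, (eLpNorm a ⊤ P.μ).toReal * |y x| ^ (1 - P.ν) ∂P.μ := by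
        refine integral_mono_ae (hP.integrable_singular ha hy.integrable)
          ((hP.integrable_rpow_one_sub hy.integrable).const_mul _) ?_
        filter_upwards [ae_norm_le ha] with x hx
        exact mul_le_mul_of_nonneg_right ((le_abs_self _).trans hx) (by positivity)
    _ = (eLpNorm a ⊤ P.μ).toReal * ∫ x, ‖y x‖ ^ (1 - P.ν) ∂P.μ := integral_const_mul _ _
    _ ≤ _ := by
        rw [mul_assoc]
        exact mul_le_mul_of_nonneg_left (h y g hy) ENNReal.toReal_nonneg

lemma abs_rpow_sub_le (s t : ℝ) :
    abs (|s| ^ (1 - P.ν) - |t| ^ (1 - P.ν)) ≤ |s - t| ^ (1 - P.ν) := by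
  have h0 := hP.one_sub_ν_pos
  have h1 : 1 - P.ν ≤ 1 := by linarith [hP.exps.ν_pos]
  have key : ∀ s t : ℝ, |s| ^ (1 - P.ν) ≤ |t| ^ (1 - P.ν) + |s - t| ^ (1 - P.ν) := fun s t => by
    refine le_trans (Real.rpow_le_rpow (abs_nonneg _) (?_ : |s| ≤ |t| + |s - t|) h0.le)
      (Real.rpow_add_le_add_rpow (abs_nonneg _) (abs_nonneg _) h0.le h1)
    have := abs_add_le t (s - t)
    rwa [add_sub_cancel] at this
  have h2 := key s t
  have h3 := key t s
  rw [abs_sub_comm t s] at h3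
  rw [abs_le]
  constructor <;> linarith

/-- The singular term is Hölder continuous with respect to the `L¹` norm. -/
lemma tendsto_singular {a : EuclideanSpace ℝ (Fin n) → ℝ} (ha : MemLp a ⊤ P.μ) {ι : Type*}
    {l : Filter ι} {u : ι → EuclideanSpace ℝ (Fin n) → ℝ} {y : EuclideanSpace ℝ (Fin n) → ℝ}
    (hu : ∀ j, Integrable (u j) P.μ) (hy : Integrable y P.μ)
    (h : Tendsto (fun j => eLpNorm (fun x => y x - u j x) 1 P.μ) l (𝓝 0)) :
    Tendsto (fun j => P.singular a (u j)) l (𝓝 (P.singular a y)) := by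
  have hfin := hP.isFiniteMeasure
  have h0 := hP.one_sub_ν_pos
  have h1 : 1 - P.ν ≤ 1 := by linarith [hP.exps.ν_pos]
  obtain ⟨c, hc, hle⟩ := exists_integral_norm_rpow_le (m := P.μ) (V := ℝ) h0 h1
  have hlim : Tendsto (fun j => (eLpNorm a ⊤ P.μ).toReal *
      (c * ((eLpNorm (fun x => y x - u j x) 1 P.μ).toReal) ^ ((1 - P.ν) / 1))) l (𝓝 0) := by
    have h2 := (ENNReal.tendsto_toReal ENNReal.zero_ne_top).comp h
    have h3 := h2.rpow_const (p := (1 - P.ν) / 1) (Or.inr (by simpa using h0.le))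
    rw [ENNReal.toReal_zero, Real.zero_rpow (by simpa using h0.ne')] at h3
    have := (h3.const_mul c).const_mul (eLpNorm a ⊤ P.μ).toReal
    simpa using this
  rw [tendsto_iff_norm_sub_tendsto_zero]
  refine squeeze_zero (fun _ => norm_nonneg _) (fun j => ?_) hlim
  have hi : Integrable (fun x => y x - u j x) P.μ := hy.sub (hu j)
  have e : ∫ x, ‖y x - u j x‖ ^ (1 : ℝ) ∂P.μ = (eLpNorm (fun x => y x - u j x) 1 P.μ).toReal := by
    simp_rw [Real.rpow_one]
    rw [eLpNorm_one_eq_lintegral_enorm, ← ofReal_integral_norm_eq_lintegral_enorm hi,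
      ENNReal.toReal_ofReal (integral_nonneg fun x => norm_nonneg _)]
  have hm : MemLp (fun x => y x - u j x) (ENNReal.ofReal 1) P.μ := by
    rw [ENNReal.ofReal_one]; exact memLp_one_iff_integrable.2 hi
  have h4 := hle _ hm
  rw [e] at h4
  unfold singular
  rw [← integral_sub (hP.integrable_singular ha (hu j)) (hP.integrable_singular ha hy)]
  refine le_trans ?_ (mul_le_mul_of_nonneg_left h4 ENNReal.toReal_nonneg)
  rw [← integral_const_mul]
  refine norm_integral_le_of_norm_le ((hP.integrable_rpow_one_sub hi).const_mul _) ?_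
  filter_upwards [ae_norm_le ha] with x hx
  rw [← mul_sub, norm_mul]
  refine mul_le_mul hx ?_ (norm_nonneg _) ENNReal.toReal_nonneg
  have := hP.abs_rpow_sub_le (u j x) (y x)
  rwa [abs_sub_comm (u j x)] at this

lemma integrable_coupling_term {y₁ y₂ : EuclideanSpace ℝ (Fin n) → ℝ}
    (h1 : MemLp y₁ (ENNReal.ofReal P.deg) P.μ) (h2 : MemLp y₂ (ENNReal.ofReal P.deg) P.μ) :
    Integrable (fun x => |y₁ x| ^ (P.κ₁ + 1) * |y₂ x| ^ (P.κ₂ + 1)) P.μ :=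
  integrable_coupling (by linarith [hP.κ₁_pos]) (by linarith [hP.κ₂_pos]) h1 h2

lemma exists_coupling_le : ∃ c : ℝ, 0 ≤ c ∧ ∀ y₁ g₁ y₂ g₂, P.IsW0 y₁ g₁ → P.IsW0 y₂ g₂ →
    P.coupling y₁ y₂ ≤ c * (P.energyP g₁ + P.energyP g₂) ^ (P.deg / P.p) := by
  obtain ⟨c, hc, h⟩ := hP.exists_integral_le hP.deg_pos hP.crit.le
  refine ⟨c + c, by positivity, fun y₁ g₁ y₂ g₂ h1 h2 => ?_⟩
  have m1 := hP.memLp_deg h1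
  have m2 := hP.memLp_deg h2
  have i1 := integrable_norm_rpow hP.deg_pos m1
  have i2 := integrable_norm_rpow hP.deg_pos m2
  have E1 := energyP_nonneg (P := P) g₁
  have E2 := energyP_nonneg (P := P) g₂
  have hexp : 0 ≤ P.deg / P.p := (div_pos hP.deg_pos hP.p_pos).le
  calc P.coupling y₁ y₂ ≤ ∫ x, (‖y₁ x‖ ^ P.deg + ‖y₂ x‖ ^ P.deg) ∂P.μ := by
        refine integral_mono (hP.integrable_coupling_term m1 m2) (i1.add i2) fun x => ?_
        refine le_trans ?_ (norm_prod_rpow_le (r := P.deg) (y₁ x, y₂ x))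
        have hn := norm_nonneg (y₁ x, y₂ x)
        have hk1 := hP.κ₁_pos
        have hk2 := hP.κ₂_pos
        rcases eq_or_lt_of_le hn with h0 | h0
        · have hz : (y₁ x, y₂ x) = 0 := norm_eq_zero.1 h0.symm
          have hz1 : y₁ x = 0 := congrArg Prod.fst hz
          rw [hz1, abs_zero, Real.zero_rpow (by linarith), zero_mul]
          positivity
        · rw [deg, Real.rpow_add h0]
          exact mul_le_mul (Real.rpow_le_rpow (abs_nonneg _) (norm_fst_le (y₁ x, y₂ x))
            (by linarith)) (Real.rpow_le_rpow (abs_nonneg _) (norm_snd_le (y₁ x, y₂ x))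
            (by linarith)) (by positivity) (by positivity)
    _ = ∫ x, ‖y₁ x‖ ^ P.deg ∂P.μ + ∫ x, ‖y₂ x‖ ^ P.deg ∂P.μ := integral_add i1 i2
    _ ≤ c * (P.energyP g₁ + P.energyP g₂) ^ (P.deg / P.p)
        + c * (P.energyP g₁ + P.energyP g₂) ^ (P.deg / P.p) := by
        refine add_le_add ((h _ _ h1).trans ?_) ((h _ _ h2).trans ?_)
        · exact mul_le_mul_of_nonneg_left (Real.rpow_le_rpow E1 (by linarith) hexp) hc
        · exact mul_le_mul_of_nonneg_left (Real.rpow_le_rpow E2 (by linarith) hexp) hc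
    _ = _ := by ring

end Admissible

end Data

end DoublePhase

/-! ### The energy and the Nehari manifold in terms of fibering maps -/

namespace DoublePhase

section Fibering

variable {p q ν k lam A B C D : ℝ}

lemma fib_scale {t : ℝ} :
    fib p q ν k lam (t ^ p * A) (t ^ q * B) (t ^ (1 - ν) * C) (t ^ k * D) 1
      = fib p q ν k lam A B C D t := by
  simp only [fib, Real.one_rpow]; ring

/-- The second summand vanishes on the Nehari manifold, which is why `C` does not enter the second
condition of `FibMinus`. -/
lemma iteratedDeriv_two_fib (hp : p ≠ 0) (hq : q ≠ 0) (hν : 1 - ν ≠ 0) :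
    iteratedDeriv 2 (fib p q ν k lam A B C D) 1
      = slope p q ν k lam A B D 1 - ν * (reduced p q ν k lam A B D 1 - C) := by
  have h1 : deriv (fib p q ν k lam A B C D)
      =ᶠ[𝓝 1] fun t => t ^ (-ν) * (reduced p q ν k lam A B D t - C) := by
    filter_upwards [lt_mem_nhds (zero_lt_one (α := ℝ))] with t ht
    exact (hasDerivAt_fib hp hq hν ht).deriv
  rw [iteratedDeriv_succ, iteratedDeriv_one, h1.deriv_eq]
  have h2 : HasDerivAt (fun t : ℝ => t ^ (-ν)) (-ν * 1 ^ (-ν - 1)) 1 :=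
    Real.hasDerivAt_rpow_const (Or.inl one_ne_zero)
  have h3 := (hasDerivAt_reduced (p := p) (q := q) (ν := ν) (k := k) (lam := lam) (A := A)
    (B := B) (D := D) one_pos).sub_const C
  refine (h2.mul h3).deriv.trans ?_
  simp only [Real.one_rpow]
  ring

lemma fibMinus_iff : FibMinus p q ν k lam A B C D ↔
    reduced p q ν k lam A B D 1 = C ∧ slope p q ν k lam A B D 1 < 0 := by
  have := fibMinus_scale_iff (p := p) (q := q) (ν := ν) (k := k) (lam := lam) (A := A)
    (B := B) (C := C) (D := D) one_pos
  simpa only [Real.one_rpow, one_mul] using this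

/-- If `ψ'(1) = 0` and `D ≤ 0` then `ψ''(1) ≥ 0`, so such a pair is not in `N⁻`. -/
lemma FibMinus.pos (E : Exponents p q ν k) (hlam : 0 < lam) (hA : 0 ≤ A) (hB : 0 ≤ B)
    (h : FibMinus p q ν k lam A B C D) : 0 < D := by
  obtain ⟨h1, h2, h3, h4, h5⟩ := E
  by_contra hD
  have e1 : 0 ≤ (p - 1 + ν) * A := mul_nonneg (by linarith) hA
  have e2 : 0 ≤ (q - 1 + ν) * B := mul_nonneg (by linarith) hB
  have e3 : lam * k * (k - 1 + ν) * D ≤ 0 := mul_nonpos_of_nonneg_of_nonpos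
    (mul_nonneg (mul_pos hlam (by linarith)).le (by linarith)) (not_lt.1 hD)
  linarith [h.2]

end Fibering

namespace Data

variable {n : ℕ} {P : Data n}

/-- `A = ∫ |∇y₁|^p + |∇y₂|^p` as a function of the gradients. -/
noncomputable def sumP (P : Data n) (g : (EuclideanSpace ℝ (Fin n) → EuclideanSpace ℝ (Fin n)) ×
    (EuclideanSpace ℝ (Fin n) → EuclideanSpace ℝ (Fin n))) : ℝ :=
  P.energyP g.1 + P.energyP g.2

/-- `B = ∫ η |∇y₁|^q + η |∇y₂|^q` as a function of the gradients. -/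
noncomputable def sumQ (P : Data n) (g : (EuclideanSpace ℝ (Fin n) → EuclideanSpace ℝ (Fin n)) ×
    (EuclideanSpace ℝ (Fin n) → EuclideanSpace ℝ (Fin n))) : ℝ :=
  P.energyQ g.1 + P.energyQ g.2

/-- `C = ∫ a₁ |y₁|^{1-ν} + a₂ |y₂|^{1-ν}`. -/
noncomputable def sumS (P : Data n)
    (y : (EuclideanSpace ℝ (Fin n) → ℝ) × (EuclideanSpace ℝ (Fin n) → ℝ)) : ℝ :=
  P.singular P.a₁ y.1 + P.singular P.a₂ y.2

/-- `y ∈ W × W` with pair of weak gradients `g`. -/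
def IsPair (P : Data n) (y : (EuclideanSpace ℝ (Fin n) → ℝ) × (EuclideanSpace ℝ (Fin n) → ℝ))
    (g : (EuclideanSpace ℝ (Fin n) → EuclideanSpace ℝ (Fin n)) ×
      (EuclideanSpace ℝ (Fin n) → EuclideanSpace ℝ (Fin n))) : Prop :=
  P.IsW0 y.1 g.1 ∧ P.IsW0 y.2 g.2

/-- The fibering map of the pair `y` with gradients `g`. -/
noncomputable def pairFib (P : Data n) (lam : ℝ)
    (y : (EuclideanSpace ℝ (Fin n) → ℝ) × (EuclideanSpace ℝ (Fin n) → ℝ))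
    (g : (EuclideanSpace ℝ (Fin n) → EuclideanSpace ℝ (Fin n)) ×
      (EuclideanSpace ℝ (Fin n) → EuclideanSpace ℝ (Fin n))) (t : ℝ) : ℝ :=
  fib P.p P.q P.ν P.deg lam (P.sumP g) (P.sumQ g) (P.sumS y) (P.coupling y.1 y.2) t

/-- The condition `FibMinus` for the coefficients of the pair `y` with gradients `g`. -/
def PairMinus (P : Data n) (lam : ℝ)
    (y : (EuclideanSpace ℝ (Fin n) → ℝ) × (EuclideanSpace ℝ (Fin n) → ℝ))
    (g : (EuclideanSpace ℝ (Fin n) → EuclideanSpace ℝ (Fin n)) ×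
      (EuclideanSpace ℝ (Fin n) → EuclideanSpace ℝ (Fin n))) : Prop :=
  FibMinus P.p P.q P.ν P.deg lam (P.sumP g) (P.sumQ g) (P.sumS y) (P.coupling y.1 y.2)

variable {y : (EuclideanSpace ℝ (Fin n) → ℝ) × (EuclideanSpace ℝ (Fin n) → ℝ)}
  {g : (EuclideanSpace ℝ (Fin n) → EuclideanSpace ℝ (Fin n)) ×
      (EuclideanSpace ℝ (Fin n) → EuclideanSpace ℝ (Fin n))}

lemma sumP_nonneg (g) : 0 ≤ P.sumP g := add_nonneg (energyP_nonneg _) (energyP_nonneg _)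
lemma sumQ_nonneg (g) : 0 ≤ P.sumQ g := add_nonneg (energyQ_nonneg _) (energyQ_nonneg _)

lemma sumP_smul {t : ℝ} (ht : 0 ≤ t) : P.sumP (t • g) = t ^ P.p * P.sumP g := by
  unfold sumP
  rw [mul_add]
  exact congrArg₂ (· + ·) (energyP_smul t ht _) (energyP_smul t ht _)

lemma sumQ_smul {t : ℝ} (ht : 0 ≤ t) : P.sumQ (t • g) = t ^ P.q * P.sumQ g := by
  unfold sumQ
  rw [mul_add]
  exact congrArg₂ (· + ·) (energyQ_smul t ht _) (energyQ_smul t ht _)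

lemma singular_smul {t : ℝ} (ht : 0 ≤ t) (a y : EuclideanSpace ℝ (Fin n) → ℝ) :
    P.singular a (t • y) = t ^ (1 - P.ν) * P.singular a y := by
  unfold singular
  rw [← integral_const_mul]
  refine integral_congr_ae (Eventually.of_forall fun x => ?_)
  simp only [Pi.smul_apply, smul_eq_mul]
  rw [abs_mul, abs_of_nonneg ht, Real.mul_rpow ht (abs_nonneg _)]
  ring

lemma sumS_smul {t : ℝ} (ht : 0 ≤ t) : P.sumS (t • y) = t ^ (1 - P.ν) * P.sumS y := by
  unfold sumS
  rw [mul_add]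
  exact congrArg₂ (· + ·) (singular_smul ht _ _) (singular_smul ht _ _)

lemma coupling_smul {t : ℝ} (ht : 0 < t) :
    P.coupling (t • y).1 (t • y).2 = t ^ P.deg * P.coupling y.1 y.2 := by
  unfold coupling
  rw [← integral_const_mul]
  refine integral_congr_ae (Eventually.of_forall fun x => ?_)
  simp only [Prod.smul_fst, Prod.smul_snd, Pi.smul_apply, smul_eq_mul]
  rw [abs_mul, abs_mul, abs_of_pos ht, Real.mul_rpow ht.le (abs_nonneg _),
    Real.mul_rpow ht.le (abs_nonneg _), deg, Real.rpow_add ht (P.κ₁ + 1)]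
  ring

lemma pairFib_smul {lam t : ℝ} (ht : 0 < t) :
    P.pairFib lam (t • y) (t • g) 1 = P.pairFib lam y g t := by
  unfold pairFib
  rw [sumP_smul ht.le, sumQ_smul ht.le, sumS_smul ht.le, coupling_smul ht, fib_scale]

lemma pairMinus_smul_iff {lam t : ℝ} (ht : 0 < t) : P.PairMinus lam (t • y) (t • g) ↔
    FibMinus P.p P.q P.ν P.deg lam (t ^ P.p * P.sumP g) (t ^ P.q * P.sumQ g)
      (t ^ (1 - P.ν) * P.sumS y) (t ^ P.deg * P.coupling y.1 y.2) := by
  unfold PairMinus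
  rw [sumP_smul ht.le, sumQ_smul ht.le, sumS_smul ht.le, coupling_smul ht]

lemma IsPair.smul (h : P.IsPair y g) (t : ℝ) : P.IsPair (t • y) (t • g) :=
  ⟨h.1.const_mul t, h.2.const_mul t⟩

lemma IsPair.add (hP : P.Admissible) {y' g'} (h : P.IsPair y g) (h' : P.IsPair y' g') :
    P.IsPair (y + y') (g + g') :=
  ⟨h.1.add hP h'.1, h.2.add hP h'.2⟩

namespace Admissible

variable (hP : P.Admissible)
include hP

lemma isPair (h1 : P.MemW01H y.1) (h2 : P.MemW01H y.2) :
    P.IsPair y (weakGrad P.Ω y.1, weakGrad P.Ω y.2) := ⟨h1.isW0 hP, h2.isW0 hP⟩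

lemma J_eq (h : P.IsPair y g) (lam : ℝ) : P.J lam y = P.pairFib lam y g 1 := by
  have e1 := energyP_congr (h.1.weakGrad_ae_eq hP)
  have e2 := energyP_congr (h.2.weakGrad_ae_eq hP)
  have e3 := energyQ_congr (h.1.weakGrad_ae_eq hP)
  have e4 := energyQ_congr (h.2.weakGrad_ae_eq hP)
  have e5 := integral_add (hP.integrable_singular hP.a₁_memLp h.1.integrable)
    (hP.integrable_singular hP.a₂_memLp h.2.integrable)
  unfold energyQ at e3 e4
  rw [hP.integral_μη, hP.integral_μη] at e3 e4
  unfold J pairFib fib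
  rw [e3, e4, e5]
  change 1 / P.p * (P.energyP _ + P.energyP _) + _ - _ - _ = _
  rw [e1, e2]
  simp only [Real.one_rpow, sumP, sumQ, sumS, singular, coupling, energyQ, hP.integral_μη]
  ring

lemma fiber_eq (h : P.IsPair y g) (lam : ℝ) {t : ℝ} (ht : 0 < t) :
    P.fiber lam y t = P.pairFib lam y g t := by
  rw [fiber, hP.J_eq (h.smul t), pairFib_smul ht]

omit hP in
lemma norm_rpow_mul_inner {V : Type*} [NormedAddCommGroup V] [InnerProductSpace ℝ V] {r : ℝ}
    (hr : 0 < r) (v : V) : ‖v‖ ^ (r - 2) * inner ℝ v v = ‖v‖ ^ r := by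
  rcases eq_or_ne v 0 with rfl | hv
  · simp [Real.zero_rpow hr.ne']
  · rw [real_inner_self_eq_norm_sq, ← Real.rpow_natCast, ← Real.rpow_add (norm_pos_iff.2 hv)]
    norm_num

omit hP in
lemma abs_rpow_mul_self {r : ℝ} (hr : r + 2 ≠ 0) (t : ℝ) : |t| ^ r * t * t = |t| ^ (r + 2) := by
  rcases eq_or_ne t 0 with rfl | ht
  · simp [Real.zero_rpow hr]
  · rw [Real.rpow_add (abs_pos.2 ht), mul_assoc, ← pow_two, ← sq_abs, ← Real.rpow_natCast]
    norm_num

lemma opPairing_self {u : EuclideanSpace ℝ (Fin n) → ℝ}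
    {v : EuclideanSpace ℝ (Fin n) → EuclideanSpace ℝ (Fin n)} (h : P.IsW0 u v) :
    P.opPairing u u = P.energyP v + P.energyQ v := by
  rw [← energyP_congr (h.weakGrad_ae_eq hP), ← energyQ_congr (h.weakGrad_ae_eq hP)]
  unfold opPairing energyP energyQ
  have hq : 0 < P.q := hP.p_pos.trans hP.exps.p_lt
  rw [hP.integral_μη]
  congr 1
  · simp_rw [norm_rpow_mul_inner hP.p_pos]
  · simp_rw [mul_assoc, norm_rpow_mul_inner hq]

lemma dJ_self (h : P.IsPair y g) (lam : ℝ) : P.dJ lam y y =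
    P.sumP g + P.sumQ g - P.sumS y - lam * P.deg * P.coupling y.1 y.2 := by
  have hν := hP.one_sub_ν_pos
  have hκ₁ := hP.κ₁_pos
  have hκ₂ := hP.κ₂_pos
  have e1 : (∫ x, P.a₁ x * |y.1 x| ^ (-1 - P.ν) * y.1 x * y.1 x ∂P.μ) = P.singular P.a₁ y.1 := by
    refine integral_congr_ae (Eventually.of_forall fun x => ?_)
    have := abs_rpow_mul_self (r := -1 - P.ν) (by linarith) (y.1 x)
    beta_reduce
    rw [mul_assoc, mul_assoc, ← mul_assoc (|y.1 x| ^ _), this]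
    ring_nf
  have e2 : (∫ x, P.a₂ x * |y.2 x| ^ (-1 - P.ν) * y.2 x * y.2 x ∂P.μ) = P.singular P.a₂ y.2 := by
    refine integral_congr_ae (Eventually.of_forall fun x => ?_)
    have := abs_rpow_mul_self (r := -1 - P.ν) (by linarith) (y.2 x)
    beta_reduce
    rw [mul_assoc, mul_assoc, ← mul_assoc (|y.2 x| ^ _), this]
    ring_nf
  have e3 : (∫ x, |y.1 x| ^ (P.κ₁ - 1) * y.1 x * |y.2 x| ^ (P.κ₂ + 1) * y.1 x ∂P.μ)
      = P.coupling y.1 y.2 := by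
    refine integral_congr_ae (Eventually.of_forall fun x => ?_)
    have := abs_rpow_mul_self (r := P.κ₁ - 1) (by linarith) (y.1 x)
    rw [show P.κ₁ - 1 + 2 = P.κ₁ + 1 by ring] at this
    beta_reduce
    rw [← this]; ring
  have e4 : (∫ x, |y.1 x| ^ (P.κ₁ + 1) * |y.2 x| ^ (P.κ₂ - 1) * y.2 x * y.2 x ∂P.μ)
      = P.coupling y.1 y.2 := by
    refine integral_congr_ae (Eventually.of_forall fun x => ?_)
    have := abs_rpow_mul_self (r := P.κ₂ - 1) (by linarith) (y.2 x)
    rw [show P.κ₂ - 1 + 2 = P.κ₂ + 1 by ring] at this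
    beta_reduce
    rw [← this]; ring
  unfold dJ
  rw [e1, e2, e3, e4, hP.opPairing_self h.1, hP.opPairing_self h.2]
  unfold sumP sumQ sumS deg
  ring

lemma exists_sumS_le : ∃ c : ℝ, 0 ≤ c ∧ ∀ y g, P.IsPair y g →
    P.sumS y ≤ c * P.sumP g ^ ((1 - P.ν) / P.p) := by
  obtain ⟨c₁, hc₁, h1⟩ := hP.exists_singular_le hP.a₁_memLp
  obtain ⟨c₂, hc₂, h2⟩ := hP.exists_singular_le hP.a₂_memLp
  refine ⟨c₁ + c₂, add_nonneg hc₁ hc₂, fun y g h => ?_⟩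
  have hexp : 0 ≤ (1 - P.ν) / P.p := (div_pos hP.one_sub_ν_pos hP.p_pos).le
  have E1 := energyP_nonneg (P := P) g.1
  have E2 := energyP_nonneg (P := P) g.2
  rw [add_mul]
  refine add_le_add ((h1 _ _ h.1).trans ?_) ((h2 _ _ h.2).trans ?_)
  · exact mul_le_mul_of_nonneg_left (Real.rpow_le_rpow E1 (le_add_of_nonneg_right E2) hexp) hc₁
  · exact mul_le_mul_of_nonneg_left (Real.rpow_le_rpow E2 (le_add_of_nonneg_left E1) hexp) hc₂

lemma sumP_pos (h : P.IsPair y g) (hD : 0 < P.coupling y.1 y.2) : 0 < P.sumP g := by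
  obtain ⟨S, hS, h1⟩ := hP.exists_coupling_le
  refine (sumP_nonneg g).lt_of_ne' fun h0 => ?_
  have h2 := h1 _ _ _ _ h.1 h.2
  change _ ≤ S * P.sumP g ^ _ at h2
  rw [h0, Real.zero_rpow (div_pos hP.deg_pos hP.p_pos).ne', mul_zero] at h2
  exact absurd hD (not_lt.2 h2)

/-- Nontriviality of the pair need not be listed in `PairMinus`, as `D > 0` on `N⁻`. -/
lemma mem_nehariMinus_iff {lam : ℝ} (hlam : 0 < lam) (h : P.IsPair y g) :
    y ∈ P.nehariMinus lam ↔ P.PairMinus lam y g := by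
  have hq : 0 < P.q := hP.p_pos.trans hP.exps.p_lt
  have hf : P.fiber lam y =ᶠ[𝓝 1] P.pairFib lam y g := by
    filter_upwards [lt_mem_nhds (zero_lt_one (α := ℝ))] with t ht
    exact hP.fiber_eq h lam ht
  have h2 : iteratedDeriv 2 (P.fiber lam y) 1 = slope P.p P.q P.ν P.deg lam (P.sumP g) (P.sumQ g)
      (P.coupling y.1 y.2) 1 - P.ν * (reduced P.p P.q P.ν P.deg lam (P.sumP g) (P.sumQ g)
      (P.coupling y.1 y.2) 1 - P.sumS y) := by
    rw [hf.iteratedDeriv_eq]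
    exact iteratedDeriv_two_fib hP.p_pos.ne' hq.ne' hP.one_sub_ν_pos.ne'
  have h3 : P.dJ lam y y = 0 ↔ reduced P.p P.q P.ν P.deg lam (P.sumP g) (P.sumQ g)
      (P.coupling y.1 y.2) 1 = P.sumS y := by
    rw [hP.dJ_self h]
    simp only [reduced, Real.one_rpow]
    constructor <;> intro h <;> linarith
  rw [PairMinus, fibMinus_iff]
  constructor
  · rintro ⟨⟨-, -, -, h4⟩, h5⟩
    have h6 := h3.1 h4
    rw [h2, h6, sub_self, mul_zero, sub_zero] at h5
    exact ⟨h6, h5⟩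
  · rintro ⟨h4, h5⟩
    have hD := FibMinus.pos hP.exps hlam (sumP_nonneg g) (sumQ_nonneg g) (fibMinus_iff.2 ⟨h4, h5⟩)
    refine ⟨⟨h.1.memW01H hP, h.2.memW01H hP, fun h0 => ?_, h3.2 h4⟩, ?_⟩
    · refine absurd hD (not_lt.2 (le_of_eq ?_))
      refine integral_eq_zero_of_ae ?_
      filter_upwards [h0.1] with x hx
      have := hP.κ₁_pos
      simp [hx, Real.zero_rpow (by linarith : P.κ₁ + 1 ≠ 0)]
    · rw [h2, h4, sub_self, mul_zero, sub_zero]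
      exact h5

/-- The threshold for `λ`: below it, `J > 0` on `N⁻` and every pair with nontrivial coupling can be
dilated into `N⁻`, where the fibering map has its maximum. -/
lemma exists_threshold : ∃ lamStar : ℝ, 0 < lamStar ∧ ∀ lam : ℝ, 0 < lam → lam < lamStar →
    (∀ y g, P.IsPair y g → P.PairMinus lam y g → 0 < P.J lam y ∧
      ∀ t : ℝ, 0 < t → P.J lam (t • y) ≤ P.J lam y) ∧
    ∀ y g, P.IsPair y g → 0 < P.coupling y.1 y.2 →
      ∃ t : ℝ, 0 < t ∧ P.PairMinus lam (t • y) (t • g) := by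
  obtain ⟨c, hc, h1⟩ := hP.exists_sumS_le
  obtain ⟨S, hS, h2⟩ := hP.exists_coupling_le
  obtain ⟨lamStar, hpos, h⟩ := exists_lamStar hP.exps c S hc hS
  refine ⟨lamStar, hpos, fun lam hlam hlt => ⟨fun y g hy hm => ?_, fun y g hy hD => ?_⟩⟩
  · have hD := FibMinus.pos hP.exps hlam (sumP_nonneg g) (sumQ_nonneg g) hm
    obtain ⟨t₀, ht₀, h3, h4⟩ := h lam _ _ _ _ hlam hlt (hP.sumP_pos hy hD) (sumQ_nonneg g)
      (h1 _ _ hy) (h2 _ _ _ _ hy.1 hy.2)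
    obtain ⟨h5, h6⟩ := fib_le_fib_one hP.exps hlam (sumP_nonneg g) hD.le hm ht₀ h3 h4
    rw [hP.J_eq hy]
    refine ⟨h5, fun t ht => ?_⟩
    rw [hP.J_eq (hy.smul t), pairFib_smul ht]
    exact h6 t ht
  · obtain ⟨t₀, ht₀, h3, -⟩ := h lam _ _ _ _ hlam hlt (hP.sumP_pos hy hD) (sumQ_nonneg g)
      (h1 _ _ hy) (h2 _ _ _ _ hy.1 hy.2)
    obtain ⟨t, ht, h4⟩ := exists_fibMinus_scale hP.exps hlam (sumP_nonneg g) hD ht₀ h3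
    exact ⟨t, ht, (pairMinus_smul_iff ht).2 h4⟩

end Admissible

end Data

end DoublePhase

/-! ### Existence of minimizers over `N⁻` -/

namespace DoublePhase

/-- A sublinear term `c A ^ s` cannot compensate a linear one. -/
lemma exists_bound_of_sublinear {α β c s M : ℝ} (hα : 0 < α) (hβ : 0 < β) (hc : 0 ≤ c)
    (hs : 0 < s) (hs1 : s < 1) : ∃ M' : ℝ, ∀ A B : ℝ, 0 ≤ A → 0 ≤ B →
      α * A + β * B ≤ M + c * A ^ s → A ≤ M' ∧ B ≤ M' := by
  obtain ⟨R, hR, hR0⟩ := (((tendsto_rpow_atTop (by linarith : 0 < 1 - s)).eventually_ge_atTop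
    (c / (α / 2))).and (eventually_gt_atTop 0)).exists
  refine ⟨max ((M + c * R ^ s) / (α / 2)) ((M + c * R ^ s) / β), fun A B hA hB h => ?_⟩
  have key : c * A ^ s ≤ α / 2 * A + c * R ^ s := by
    rcases le_total A R with hAR | hAR
    · have := mul_le_mul_of_nonneg_left (Real.rpow_le_rpow hA hAR hs.le) hc
      have : 0 ≤ α / 2 * A := by positivity
      linarith
    · have hA0 : 0 < A := hR0.trans_le hAR
      have h1 : c ≤ α / 2 * A ^ (1 - s) := by
        rw [div_le_iff₀ (by positivity)] at hR
        have h2 := Real.rpow_le_rpow hR0.le hAR (by linarith : 0 ≤ 1 - s)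
        have : α / 2 * R ^ (1 - s) ≤ α / 2 * A ^ (1 - s) := by gcongr
        linarith
      have h2 : A ^ (1 - s) * A ^ s = A := by
        rw [← Real.rpow_add hA0]; simp
      have h3 := mul_le_mul_of_nonneg_right h1 (Real.rpow_nonneg hA s)
      rw [mul_assoc, h2] at h3
      have : 0 ≤ c * R ^ s := by positivity
      linarith
  have hA' : 0 ≤ α / 2 * A := by positivity
  have hB' : 0 ≤ β * B := by positivity
  constructor
  · refine le_trans ?_ (le_max_left _ _)
    rw [le_div_iff₀ (by positivity)]; linarith
  · refine le_trans ?_ (le_max_right _ _)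
    rw [le_div_iff₀ hβ]; linarith

/-- From `D ≤ S A ^ r` and `A ≤ (β / α) D` one gets `D ≤ K D ^ r`, which bounds `D > 0` from below. -/
lemma exists_pos_le_of_superlinear {α β S r : ℝ} (hα : 0 < α) (hβ : 0 < β) (hS : 0 ≤ S)
    (hr : 1 < r) : ∃ δ : ℝ, 0 < δ ∧ ∀ A D : ℝ, 0 ≤ A → 0 < D → α * A ≤ β * D →
      D ≤ S * A ^ r → δ ≤ D := by
  set K := S * (β / α) ^ r with hK
  have hK0 : 0 ≤ K := by positivity
  refine ⟨(1 / (K + 1)) ^ (1 / (r - 1)), by positivity, fun A D hA hD h1 h2 => ?_⟩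
  have h3 : A ≤ β / α * D := by
    rw [div_mul_eq_mul_div, le_div_iff₀ hα]; linarith
  have h4 : D ≤ K * D ^ r := by
    refine h2.trans ?_
    rw [hK, mul_assoc, ← Real.mul_rpow (by positivity) hD.le]
    exact mul_le_mul_of_nonneg_left (Real.rpow_le_rpow hA h3 (by linarith)) hS
  have h5 : 1 / (K + 1) ≤ D ^ (r - 1) := by
    have e : D ^ (r - 1) * D = D ^ r := by
      rw [← Real.rpow_add_one hD.ne']; ring_nf
    have h6 : 1 ≤ K * D ^ (r - 1) := by
      rw [← e, ← mul_assoc] at h4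
      exact le_of_mul_le_mul_right (by linarith) hD
    have : 0 ≤ D ^ (r - 1) := by positivity
    rw [div_le_iff₀ (by positivity)]; linarith
  calc (1 / (K + 1)) ^ (1 / (r - 1)) ≤ (D ^ (r - 1)) ^ (1 / (r - 1)) :=
        Real.rpow_le_rpow (by positivity) h5 (one_div_nonneg.2 (by linarith))
    _ = D := by
        rw [← Real.rpow_mul hD.le, mul_one_div_cancel (by linarith), Real.rpow_one]

namespace Data

variable {n : ℕ} {P : Data n}

namespace Admissible

variable (hP : P.Admissible)
include hP

lemma exists_isPair_coupling_pos : ∃ y g, P.IsPair y g ∧ 0 < P.coupling y.1 y.2 := by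
  obtain ⟨x₀, hx₀⟩ := hP.nonempty
  obtain ⟨f, hf1, hf2, hf3, -, hf5⟩ :=
    exists_contDiff_tsupport_subset (n := (⊤ : ℕ∞)) (hP.isOpen.mem_nhds hx₀)
  have hf : IsTestFunction P.Ω f := ⟨hf3, hf2, hf1⟩
  have h := IsW0.of_test (P := P) hf
  refine ⟨(f, f), (gradient f, gradient f), ⟨h, h⟩, ?_⟩
  have hκ₁ := hP.κ₁_pos
  have hκ₂ := hP.κ₂_pos
  have hd := hP.memLp_deg h
  refine (integral_pos_iff_support_of_nonneg (fun x => by positivity)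
    (hP.integrable_coupling_term hd hd)).2 ?_
  have hopen : IsOpen (P.Ω ∩ {x | f x ≠ 0}) :=
    hP.isOpen.inter (isOpen_ne_fun hf3.continuous continuous_const)
  have hpos : 0 < volume (P.Ω ∩ {x | f x ≠ 0}) :=
    hopen.measure_pos volume ⟨x₀, hx₀, by simp [hf5]⟩
  refine hpos.trans_le ?_
  rw [μ, Measure.restrict_apply' hP.isOpen.measurableSet]
  refine measure_mono fun x hx => ⟨?_, hx.1⟩
  have : 0 < |f x| := abs_pos.2 hx.2
  exact (mul_pos (Real.rpow_pos_of_pos this _) (Real.rpow_pos_of_pos this _)).ne'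

/-- `J` is coercive on the Nehari manifold: by the Nehari identity, the coupling term can be
eliminated and the singular term is of lower order. -/
lemma exists_energy_bound {lam : ℝ} (M : ℝ) : ∃ M' : ℝ, ∀ y g, P.IsPair y g →
    P.PairMinus lam y g → P.J lam y ≤ M → P.sumP g ≤ M' ∧ P.sumQ g ≤ M' := by
  obtain ⟨c, hc, h1⟩ := hP.exists_sumS_le
  have hp := hP.p_pos
  have hpq := hP.exps.p_lt
  have hqk := hP.exps.q_lt
  have hq : 0 < P.q := hp.trans hpq
  have hk : 0 < P.deg := hq.trans hqk
  have hν := hP.one_sub_ν_pos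
  have hpk : 0 < 1 / P.p - 1 / P.deg :=
    sub_pos.2 (one_div_lt_one_div_of_lt hp (hpq.trans hqk))
  have hqk' : 0 < 1 / P.q - 1 / P.deg := sub_pos.2 (one_div_lt_one_div_of_lt hq hqk)
  have hνk : 0 < 1 / (1 - P.ν) - 1 / P.deg :=
    sub_pos.2 (one_div_lt_one_div_of_lt hν (by linarith [hP.exps.ν_pos, hP.exps.p_gt]))
  obtain ⟨M', h⟩ := exists_bound_of_sublinear (M := M) (s := (1 - P.ν) / P.p)
    (c := (1 / (1 - P.ν) - 1 / P.deg) * c) hpk hqk' (by positivity) (by positivity)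
    (by rw [div_lt_one hp]; linarith [hP.exps.ν_pos, hP.exps.p_gt])
  refine ⟨M', fun y g hy hm hJ => h _ _ (sumP_nonneg g) (sumQ_nonneg g) ?_⟩
  rw [hP.J_eq hy] at hJ
  have e := hm.1
  have e2 : lam * P.coupling y.1 y.2 = (P.sumP g + P.sumQ g - P.sumS y) / P.deg := by
    rw [eq_div_iff hk.ne']; linarith
  simp only [pairFib, fib, Real.one_rpow, mul_one] at hJ
  rw [e2] at hJ
  have h2 := mul_le_mul_of_nonneg_left (h1 y g hy) hνk.le
  have h3 : 1 / P.p * P.sumP g + 1 / P.q * P.sumQ g - 1 / (1 - P.ν) * P.sumS y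
      - (P.sumP g + P.sumQ g - P.sumS y) / P.deg = (1 / P.p - 1 / P.deg) * P.sumP g
      + (1 / P.q - 1 / P.deg) * P.sumQ g - (1 / (1 - P.ν) - 1 / P.deg) * P.sumS y := by ring
  linarith

/-- By `ψ''(1) < 0` the coupling `D` dominates `A`, while `D ≤ S A ^ (k / p)` with `k > p` by Sobolev. -/
lemma exists_coupling_lower_bound {lam : ℝ} (hlam : 0 < lam) : ∃ δ : ℝ, 0 < δ ∧ ∀ y g,
    P.IsPair y g → P.PairMinus lam y g → δ ≤ P.coupling y.1 y.2 := by
  obtain ⟨S, hS, h1⟩ := hP.exists_coupling_le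
  have hp := hP.exps.p_gt
  have hν := hP.exps.ν_pos
  have hpk := hP.exps.p_lt.trans hP.exps.q_lt
  obtain ⟨δ, hδ, h⟩ := exists_pos_le_of_superlinear (α := P.p - 1 + P.ν)
    (β := lam * P.deg * (P.deg - 1 + P.ν)) (r := P.deg / P.p) (by linarith)
    (mul_pos (mul_pos hlam hP.deg_pos) (by linarith)) hS
    (by rw [one_lt_div hP.p_pos]; exact hpk)
  refine ⟨δ, hδ, fun y g hy hm => h (P.sumP g) _ (sumP_nonneg g)
    (FibMinus.pos hP.exps hlam (sumP_nonneg g) (sumQ_nonneg g) hm) ?_ (h1 _ _ _ _ hy.1 hy.2)⟩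
  have := mul_nonneg (by linarith [hP.exps.p_lt] : 0 ≤ P.q - 1 + P.ν) (sumQ_nonneg (P := P) g)
  linarith [hm.2]

lemma tendsto_coupling {u₁ u₂ : ℕ → EuclideanSpace ℝ (Fin n) → ℝ}
    {g₁ g₂ : ℕ → EuclideanSpace ℝ (Fin n) → EuclideanSpace ℝ (Fin n)}
    {y₁ y₂ : EuclideanSpace ℝ (Fin n) → ℝ} (h1 : ∀ j, P.IsW0 (u₁ j) (g₁ j))
    (h2 : ∀ j, P.IsW0 (u₂ j) (g₂ j)) (hy₁ : MemLp y₁ (ENNReal.ofReal P.deg) P.μ)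
    (hy₂ : MemLp y₂ (ENNReal.ofReal P.deg) P.μ) {M : ℝ} (hM1 : ∀ j, P.energyP (g₁ j) ≤ M)
    (hM2 : ∀ j, P.energyP (g₂ j) ≤ M)
    (hl1 : Tendsto (fun j => ∫ x, ‖u₁ j x - y₁ x‖ ^ P.deg ∂P.μ) atTop (𝓝 0))
    (hl2 : Tendsto (fun j => ∫ x, ‖u₂ j x - y₂ x‖ ^ P.deg ∂P.μ) atTop (𝓝 0)) :
    Tendsto (fun j => P.coupling (u₁ j) (u₂ j)) atTop (𝓝 (P.coupling y₁ y₂)) := by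
  obtain ⟨c, hc, h⟩ := hP.exists_integral_le hP.deg_pos hP.crit.le
  have hexp : 0 ≤ P.deg / P.p := (div_pos hP.deg_pos hP.p_pos).le
  have hb : ∀ u g, P.IsW0 u g → P.energyP g ≤ M →
      ∫ x, ‖u x‖ ^ P.deg ∂P.μ ≤ c * M ^ (P.deg / P.p) := fun u g hu hg =>
    (h u g hu).trans (mul_le_mul_of_nonneg_left
      (Real.rpow_le_rpow (energyP_nonneg g) hg hexp) hc)
  exact tendsto_integral_coupling (by linarith [hP.κ₁_pos]) (by linarith [hP.κ₂_pos])
    (fun j => hP.memLp_deg (h1 j)) (fun j => hP.memLp_deg (h2 j)) hy₁ hy₂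
    (fun j => hb _ _ (h1 j) (hM1 j)) (fun j => hb _ _ (h2 j) (hM2 j)) hl1 hl2

/-- The direct method on `N⁻`. The weak limit `y` of a minimizing sequence `uⱼ` need not lie in
`N⁻`, but it has nontrivial coupling, so some dilation `t|y|` does, and
`J(t|y|) ≤ liminf J(t uⱼ) ≤ lim J(uⱼ)` because fibering maps are maximal at `1` on `N⁻`. -/
lemma exists_minimizer {lam : ℝ} (hlam : 0 < lam)
    (hmax : ∀ y g, P.IsPair y g → P.PairMinus lam y g → 0 < P.J lam y ∧
      ∀ t : ℝ, 0 < t → P.J lam (t • y) ≤ P.J lam y)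
    (hscale : ∀ y g, P.IsPair y g → 0 < P.coupling y.1 y.2 →
      ∃ t : ℝ, 0 < t ∧ P.PairMinus lam (t • y) (t • g)) :
    ∃ y, P.IsNonnegMinimizer lam y := by
  set V : Set ℝ := {r | ∃ y g, P.IsPair y g ∧ P.PairMinus lam y g ∧ P.J lam y = r} with hV
  have hVne : V.Nonempty := by
    obtain ⟨y, g, hy, hD⟩ := hP.exists_isPair_coupling_pos
    obtain ⟨t, -, hm⟩ := hscale y g hy hD
    exact ⟨_, t • y, t • g, hy.smul t, hm, rfl⟩
  have hVbdd : BddBelow V := ⟨0, by rintro _ ⟨y, g, hy, hm, rfl⟩; exact (hmax y g hy hm).1.le⟩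
  obtain ⟨r, hranti, hrlim, hrV⟩ := exists_seq_tendsto_sInf hVne hVbdd
  choose u g hu hm hJ using hrV
  obtain ⟨M, hM⟩ := hP.exists_energy_bound (lam := lam) (r 0)
  have hMj : ∀ j, P.sumP (g j) ≤ M ∧ P.sumQ (g j) ≤ M := fun j =>
    hM _ _ (hu j) (hm j) ((hJ j).trans_le (hranti (Nat.zero_le j)))
  have b1 : ∀ j, P.energyP (g j).1 ≤ M := fun j =>
    (le_add_of_nonneg_right (energyP_nonneg _)).trans (hMj j).1
  have b2 : ∀ j, P.energyP (g j).2 ≤ M := fun j =>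
    (le_add_of_nonneg_left (energyP_nonneg _)).trans (hMj j).1
  have b3 : ∀ j, P.energyQ (g j).1 ≤ M := fun j =>
    (le_add_of_nonneg_right (energyQ_nonneg _)).trans (hMj j).2
  have b4 : ∀ j, P.energyQ (g j).2 ≤ M := fun j =>
    (le_add_of_nonneg_left (energyQ_nonneg _)).trans (hMj j).2
  obtain ⟨δ, hδ, hδD⟩ := hP.exists_coupling_lower_bound hlam
  obtain ⟨σ₁, hσ₁, y₁, hy₁, l1, k1⟩ := hP.exists_subseq_tendsto (fun j => (hu j).1) b1
  obtain ⟨σ₂, hσ₂, y₂, hy₂, l2, k2⟩ :=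
    hP.exists_subseq_tendsto (fun j => (hu (σ₁ j)).2) fun j => b2 (σ₁ j)
  -- pass to a further subsequence along which all four energies converge
  let w : ℕ → ℝ × ℝ × ℝ × ℝ := fun j => (P.energyP (g (σ₁ (σ₂ j))).1,
    P.energyP (g (σ₁ (σ₂ j))).2, P.energyQ (g (σ₁ (σ₂ j))).1, P.energyQ (g (σ₁ (σ₂ j))).2)
  obtain ⟨⟨α₁, α₂, β₁, β₂⟩, -, σ₃, hσ₃, hw⟩ :=
    (isCompact_Icc (a := ((0 : ℝ), (0 : ℝ), (0 : ℝ), (0 : ℝ))) (b := (M, M, M, M))).tendsto_subseq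
      (x := w) fun j => ⟨⟨energyP_nonneg _, energyP_nonneg _, energyQ_nonneg _, energyQ_nonneg _⟩,
        ⟨b1 _, b2 _, b3 _, b4 _⟩⟩
  set τ : ℕ → ℕ := fun j => σ₁ (σ₂ (σ₃ j)) with hτ
  have hτlim : Tendsto τ atTop atTop :=
    (hσ₁.tendsto_atTop.comp hσ₂.tendsto_atTop).comp hσ₃.tendsto_atTop
  have w1 : Tendsto (fun j => P.energyP (g (τ j)).1) atTop (𝓝 α₁) := hw.fst_nhds
  have w2 : Tendsto (fun j => P.energyP (g (τ j)).2) atTop (𝓝 α₂) := hw.snd_nhds.fst_nhds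
  have w3 : Tendsto (fun j => P.energyQ (g (τ j)).1) atTop (𝓝 β₁) := hw.snd_nhds.snd_nhds.fst_nhds
  have w4 : Tendsto (fun j => P.energyQ (g (τ j)).2) atTop (𝓝 β₂) := hw.snd_nhds.snd_nhds.snd_nhds
  have l1' : Tendsto (fun j => eLpNorm (fun x => y₁ x - (u (τ j)).1 x) 1 P.μ) atTop (𝓝 0) :=
    l1.comp (hσ₂.tendsto_atTop.comp hσ₃.tendsto_atTop)
  have k1' : Tendsto (fun j => ∫ x, ‖(u (τ j)).1 x - y₁ x‖ ^ P.deg ∂P.μ) atTop (𝓝 0) :=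
    k1.comp (hσ₂.tendsto_atTop.comp hσ₃.tendsto_atTop)
  have l2' : Tendsto (fun j => eLpNorm (fun x => y₂ x - (u (τ j)).2 x) 1 P.μ) atTop (𝓝 0) :=
    l2.comp hσ₃.tendsto_atTop
  have k2' : Tendsto (fun j => ∫ x, ‖(u (τ j)).2 x - y₂ x‖ ^ P.deg ∂P.μ) atTop (𝓝 0) :=
    k2.comp hσ₃.tendsto_atTop
  obtain ⟨v₁, hv₁, e1⟩ := hP.exists_isW0_of_tendsto hy₁.1 (fun j => (hu (τ j)).1) l1' w1 w3
  obtain ⟨v₂, hv₂, e2⟩ := hP.exists_isW0_of_tendsto hy₂.1 (fun j => (hu (τ j)).2) l2' w2 w4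
  obtain ⟨z₁, hz₁, f1⟩ := hv₁.abs hP
  obtain ⟨z₂, hz₂, f2⟩ := hv₂.abs hP
  set Y : (EuclideanSpace ℝ (Fin n) → ℝ) × (EuclideanSpace ℝ (Fin n) → ℝ) :=
    (fun x => |y₁ x|, fun x => |y₂ x|) with hY
  have hYp : P.IsPair Y (z₁, z₂) := ⟨hz₁, hz₂⟩
  have hS : Tendsto (fun j => P.sumS (u (τ j))) atTop (𝓝 (P.sumS Y)) := by
    have s1 := hP.tendsto_singular hP.a₁_memLp (fun j => (hu (τ j)).1.integrable)
      hv₁.integrable l1'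
    have s2 := hP.tendsto_singular hP.a₂_memLp (fun j => (hu (τ j)).2.integrable)
      hv₂.integrable l2'
    have : P.sumS Y = P.singular P.a₁ y₁ + P.singular P.a₂ y₂ := by
      simp only [sumS, singular, hY, abs_abs]
    rw [this]
    exact s1.add s2
  have hD : Tendsto (fun j => P.coupling (u (τ j)).1 (u (τ j)).2) atTop
      (𝓝 (P.coupling Y.1 Y.2)) := by
    have : P.coupling Y.1 Y.2 = P.coupling y₁ y₂ := by simp only [coupling, hY, abs_abs]
    rw [this]
    exact hP.tendsto_coupling (fun j => (hu (τ j)).1) (fun j => (hu (τ j)).2) hy₁ hy₂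
      (fun j => b1 _) (fun j => b2 _) k1' k2'
  have hDpos : 0 < P.coupling Y.1 Y.2 :=
    hδ.trans_le (ge_of_tendsto' hD fun j => hδD _ _ (hu _) (hm _))
  obtain ⟨t, ht, htm⟩ := hscale Y _ hYp hDpos
  have hp := hP.p_pos
  have hq : 0 < P.q := hp.trans hP.exps.p_lt
  have hlim : Tendsto (fun j => P.J lam (t • u (τ j))) atTop
      (𝓝 (fib P.p P.q P.ν P.deg lam (α₁ + α₂) (β₁ + β₂) (P.sumS Y) (P.coupling Y.1 Y.2) t)) := by
    have e : ∀ j, P.J lam (t • u (τ j)) = P.pairFib lam (u (τ j)) (g (τ j)) t := fun j => by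
      rw [hP.J_eq ((hu (τ j)).smul t), pairFib_smul ht]
    simp_rw [e, pairFib, fib, sumP, sumQ]
    exact ((((w1.add w2).const_mul _).add ((w3.add w4).const_mul _)).sub (hS.const_mul _)).sub
      (hD.const_mul _)
  have hle : fib P.p P.q P.ν P.deg lam (α₁ + α₂) (β₁ + β₂) (P.sumS Y) (P.coupling Y.1 Y.2) t
      ≤ sInf V := by
    refine le_of_tendsto_of_tendsto' hlim (hrlim.comp hτlim) fun j => ?_
    exact ((hmax _ _ (hu (τ j)) (hm _)).2 t ht).trans (hJ _).le
  have hJle : P.J lam (t • Y) ≤ sInf V := by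
    refine le_trans ?_ hle
    rw [hP.J_eq (hYp.smul t), pairFib_smul ht]
    have tp : 0 < t ^ P.p / P.p := by positivity
    have tq : 0 < t ^ P.q / P.q := by positivity
    have i1 := (f1 _ _ tp tq).trans (e1 _ _ tp tq)
    have i2 := (f2 _ _ tp tq).trans (e2 _ _ tp tq)
    simp only [pairFib, fib, sumP, sumQ]
    linarith
  refine ⟨t • Y, (hP.mem_nehariMinus_iff hlam (hYp.smul t)).2 htm, fun z hz => ?_,
    Eventually.of_forall fun x => ?_, Eventually.of_forall fun x => ?_⟩
  · have hzp := hP.isPair hz.1.1 hz.1.2.1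
    exact hJle.trans (csInf_le hVbdd ⟨z, _, hzp, (hP.mem_nehariMinus_iff hlam hzp).1 hz, rfl⟩)
  · exact mul_nonneg ht.le (abs_nonneg _)
  · exact mul_nonneg ht.le (abs_nonneg _)

end Admissible

end Data

end DoublePhase

/-! ### The Euler–Lagrange inequality -/

namespace DoublePhase

section Differentiation

variable {α : Type*} {mα : MeasurableSpace α} {m : Measure α}

lemma hasDerivAt_norm_add_smul_rpow {V : Type*} [NormedAddCommGroup V] [InnerProductSpace ℝ V]
    {r : ℝ} (hr : 1 < r) (f v : V) (s : ℝ) :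
    HasDerivAt (fun s : ℝ => ‖f + s • v‖ ^ r)
      (r * (‖f + s • v‖ ^ (r - 2) * inner ℝ (f + s • v) v)) s := by
  have h1 : HasDerivAt (fun s : ℝ => f + s • v) v s := by
    simpa using ((hasDerivAt_id s).smul_const v).const_add f
  have := (hasFDerivAt_norm_rpow (f + s • v) hr).comp_hasDerivAt s h1
  refine this.congr_deriv ?_
  change r * ‖f + s • v‖ ^ (r - 2) * inner ℝ (f + s • v) v = _
  ring

lemma rpow_sub_two_mul_self {b t : ℝ} (hb : 1 < b) (ht : 0 ≤ t) :
    t ^ (b - 2) * t = t ^ (b - 1) := by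
  rcases eq_or_lt_of_le ht with h0 | h0
  · rw [← h0, Real.zero_rpow (by linarith : b - 1 ≠ 0), mul_zero]
  · rw [← Real.rpow_add_one h0.ne']; ring_nf

lemma rpow_sub_one_mul_self {b t : ℝ} (hb : 1 < b) (ht : 0 ≤ t) : t ^ (b - 1) * t = t ^ b := by
  rcases eq_or_lt_of_le ht with h0 | h0
  · rw [← h0, Real.zero_rpow (by linarith : b ≠ 0), mul_zero]
  · rw [← Real.rpow_add_one h0.ne']; ring_nf

lemma hasDerivAt_integral_norm_add_smul_rpow {V : Type*} [NormedAddCommGroup V]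
    [InnerProductSpace ℝ V] {r : ℝ} (hr : 1 < r) {f v : α → V}
    (hf : MemLp f (ENNReal.ofReal r) m) (hv : MemLp v (ENNReal.ofReal r) m) :
    HasDerivAt (fun s : ℝ => ∫ x, ‖f x + s • v x‖ ^ r ∂m)
      (r * ∫ x, ‖f x‖ ^ (r - 2) * inner ℝ (f x) (v x) ∂m) 0 := by
  have hr0 : 0 < r := by linarith
  have hU : MemLp (fun x => ‖f x‖ + ‖v x‖) (ENNReal.ofReal r) m := hf.norm.add hv.norm
  have hmem : ∀ s : ℝ, MemLp (fun x => f x + s • v x) (ENNReal.ofReal r) m := fun s =>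
    hf.add (hv.const_smul s)
  have key := hasDerivAt_integral_of_dominated_loc_of_deriv_le (𝕜 := ℝ) (μ := m) (x₀ := 0)
    (s := Metric.ball 0 1) (F := fun s x => ‖f x + s • v x‖ ^ r)
    (F' := fun s x => r * (‖f x + s • v x‖ ^ (r - 2) * inner ℝ (f x + s • v x) (v x)))
    (bound := fun x => r * ‖‖f x‖ + ‖v x‖‖ ^ r)
    (Metric.ball_mem_nhds 0 one_pos)
    (Eventually.of_forall fun s => (integrable_norm_rpow hr0 (hmem s)).1)
    (integrable_norm_rpow hr0 (hmem 0)) ?_ (Eventually.of_forall fun x s hs => ?_)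
    ((integrable_norm_rpow hr0 hU).const_mul r)
    (Eventually.of_forall fun x s _ => hasDerivAt_norm_add_smul_rpow hr (f x) (v x) s)
  · refine key.2.congr_deriv ?_
    rw [integral_const_mul]
    simp
  · have h0 := (hmem 0).1
    exact (((h0.norm.aemeasurable.pow_const _).aestronglyMeasurable).mul
      (h0.inner hv.1)).const_mul r
  · have hs1 : |s| ≤ 1 := by
      rw [mem_ball_zero_iff] at hs; exact hs.le
    set z := f x + s • v x with hz
    have hzle : ‖z‖ ≤ ‖f x‖ + ‖v x‖ := by
      refine (norm_add_le _ _).trans (add_le_add le_rfl ?_)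
      rw [norm_smul]
      exact mul_le_of_le_one_left (norm_nonneg _) hs1
    have hN : 0 ≤ ‖f x‖ + ‖v x‖ := by positivity
    rw [norm_mul, Real.norm_of_nonneg hr0.le, Real.norm_of_nonneg hN]
    refine mul_le_mul_of_nonneg_left ?_ hr0.le
    rw [norm_mul, Real.norm_of_nonneg (by positivity)]
    calc ‖z‖ ^ (r - 2) * ‖inner ℝ z (v x)‖ ≤ ‖z‖ ^ (r - 2) * (‖z‖ * ‖v x‖) := by
          gcongr; exact norm_inner_le_norm _ _
      _ = ‖z‖ ^ (r - 1) * ‖v x‖ := by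
          rw [← mul_assoc, rpow_sub_two_mul_self hr (norm_nonneg z)]
      _ ≤ (‖f x‖ + ‖v x‖) ^ (r - 1) * (‖f x‖ + ‖v x‖) := by
          refine mul_le_mul (Real.rpow_le_rpow (norm_nonneg _) hzle (by linarith))
            (le_add_of_nonneg_left (norm_nonneg _)) (norm_nonneg _) (by positivity)
      _ = (‖f x‖ + ‖v x‖) ^ r := rpow_sub_one_mul_self hr hN

lemma rpow_sub_one_mul_le {b t U h : ℝ} (hb : 1 < b) (ht : |t| ≤ U) (hh : |h| ≤ U) :
    |t| ^ (b - 2) * |t| * |h| ≤ U ^ b := by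
  have hU : 0 ≤ U := (abs_nonneg _).trans ht
  rw [rpow_sub_two_mul_self hb (abs_nonneg t)]
  calc |t| ^ (b - 1) * |h| ≤ U ^ (b - 1) * U := mul_le_mul
        (Real.rpow_le_rpow (abs_nonneg _) ht (by linarith)) hh (abs_nonneg _) (by positivity)
    _ = U ^ b := rpow_sub_one_mul_self hb hU

/-- The directional derivative of the coupling density `|u|^b |v|^c` in direction `(h, w)`. -/
noncomputable def couplingDeriv (b c u v h w : ℝ) : ℝ :=
  b * |u| ^ (b - 2) * u * h * |v| ^ c + |u| ^ b * (c * |v| ^ (c - 2) * v * w)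

lemma hasDerivAt_coupling {b c : ℝ} (hb : 1 < b) (hc : 1 < c) (u v h w s : ℝ) :
    HasDerivAt (fun s : ℝ => |u + s * h| ^ b * |v + s * w| ^ c)
      (couplingDeriv b c (u + s * h) (v + s * w) h w) s := by
  have h1 (u h : ℝ) : HasDerivAt (fun s : ℝ => u + s * h) h s := by
    simpa using ((hasDerivAt_id s).mul_const h).const_add u
  exact ((hasDerivAt_abs_rpow (u + s * h) hb).comp s (h1 u h)).mul
    ((hasDerivAt_abs_rpow (v + s * w) hc).comp s (h1 v w))

lemma abs_couplingDeriv_le {b c : ℝ} (hb : 1 < b) (hc : 1 < c) {u v h w U V : ℝ}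
    (hu : |u| ≤ U) (hh : |h| ≤ U) (hv : |v| ≤ V) (hw : |w| ≤ V) :
    |couplingDeriv b c u v h w| ≤ (b + c) * (U ^ b * V ^ c) := by
  have hU : 0 ≤ U := (abs_nonneg _).trans hu
  have hV : 0 ≤ V := (abs_nonneg _).trans hv
  have e1 : |b * |u| ^ (b - 2) * u * h * |v| ^ c|
      = b * ((|u| ^ (b - 2) * |u| * |h|) * |v| ^ c) := by
    rw [abs_mul, abs_mul, abs_mul, abs_mul, abs_of_pos (by linarith : 0 < b),
      abs_of_nonneg (by positivity : 0 ≤ |u| ^ (b - 2)), abs_of_nonneg (by positivity : 0 ≤ |v| ^ c)]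
    ring
  have e2 : |(|u| ^ b * (c * |v| ^ (c - 2) * v * w))|
      = c * (|u| ^ b * (|v| ^ (c - 2) * |v| * |w|)) := by
    rw [abs_mul, abs_mul, abs_mul, abs_mul, abs_of_pos (by linarith : 0 < c),
      abs_of_nonneg (by positivity : 0 ≤ |v| ^ (c - 2)), abs_of_nonneg (by positivity : 0 ≤ |u| ^ b)]
    ring
  have i1 : |u| ^ b ≤ U ^ b := Real.rpow_le_rpow (abs_nonneg _) hu (by linarith)
  have i2 : |v| ^ c ≤ V ^ c := Real.rpow_le_rpow (abs_nonneg _) hv (by linarith)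
  unfold couplingDeriv
  refine (abs_add_le _ _).trans ?_
  rw [e1, e2, add_mul]
  refine add_le_add (mul_le_mul_of_nonneg_left ?_ (by linarith))
    (mul_le_mul_of_nonneg_left ?_ (by linarith))
  · exact mul_le_mul (rpow_sub_one_mul_le hb hu hh) i2 (by positivity) (by positivity)
  · exact mul_le_mul i1 (rpow_sub_one_mul_le hc hv hw) (by positivity) (by positivity)

lemma integral_couplingDeriv {b c : ℝ} (hb : 1 < b) (hc : 1 < c) {u v h w : α → ℝ}
    (hu : MemLp u (ENNReal.ofReal (b + c)) m) (hv : MemLp v (ENNReal.ofReal (b + c)) m)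
    (hh : MemLp h (ENNReal.ofReal (b + c)) m) (hw : MemLp w (ENNReal.ofReal (b + c)) m) :
    Integrable (fun x => couplingDeriv b c (u x) (v x) (h x) (w x)) m ∧
    HasDerivAt (fun s : ℝ => ∫ x, |u x + s * h x| ^ b * |v x + s * w x| ^ c ∂m)
      (∫ x, couplingDeriv b c (u x) (v x) (h x) (w x) ∂m) 0 := by
  have hb0 : 0 < b := by linarith
  have hc0 : 0 < c := by linarith
  have hU : MemLp (fun x => |u x| + |h x|) (ENNReal.ofReal (b + c)) m := hu.norm.add hh.norm
  have hV : MemLp (fun x => |v x| + |w x|) (ENNReal.ofReal (b + c)) m := hv.norm.add hw.norm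
  have hint : ∀ s : ℝ, Integrable (fun x => |u x + s * h x| ^ b * |v x + s * w x| ^ c) m :=
    fun s => integrable_coupling hb0 hc0 (hu.add (hh.const_mul s)) (hv.add (hw.const_mul s))
  have key := hasDerivAt_integral_of_dominated_loc_of_deriv_le (𝕜 := ℝ) (μ := m) (x₀ := 0)
    (s := Metric.ball 0 1) (F := fun s x => |u x + s * h x| ^ b * |v x + s * w x| ^ c)
    (F' := fun s x => couplingDeriv b c (u x + s * h x) (v x + s * w x) (h x) (w x))
    (bound := fun x => (b + c) * (|(|u x| + |h x|)| ^ b * |(|v x| + |w x|)| ^ c))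
    (Metric.ball_mem_nhds 0 one_pos) (Eventually.of_forall fun s => (hint s).1) (hint 0) ?_
    (Eventually.of_forall fun x s hs => ?_)
    ((integrable_coupling hb0 hc0 hU hV).const_mul _)
    (Eventually.of_forall fun x s _ => hasDerivAt_coupling hb hc _ _ _ _ s)
  · simpa using key
  · have m1 := hu.1.aemeasurable
    have m2 := hv.1.aemeasurable
    have m3 := hh.1.aemeasurable
    have m4 := hw.1.aemeasurable
    simp only [zero_mul, add_zero, couplingDeriv]
    refine AEMeasurable.aestronglyMeasurable ?_
    have n1 : AEMeasurable (fun x => |u x|) m := m1.abs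
    have n2 : AEMeasurable (fun x => |v x|) m := m2.abs
    exact (((((n1.pow_const _).const_mul _).mul m1).mul m3).mul (n2.pow_const _)).add
      ((n1.pow_const _).mul ((((n2.pow_const _).const_mul _).mul m2).mul m4))
  · have hs1 : |s| ≤ 1 := by
      rw [mem_ball_zero_iff] at hs; exact hs.le
    have hle : ∀ a d : ℝ, |a + s * d| ≤ |a| + |d| := fun a d => by
      refine (abs_add_le _ _).trans (add_le_add le_rfl ?_)
      rw [abs_mul]
      exact mul_le_of_le_one_left (abs_nonneg _) hs1
    rw [abs_of_nonneg (by positivity : 0 ≤ |u x| + |h x|),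
      abs_of_nonneg (by positivity : 0 ≤ |v x| + |w x|)]
    exact abs_couplingDeriv_le hb hc (hle _ _) (le_add_of_nonneg_left (abs_nonneg _)) (hle _ _)
      (le_add_of_nonneg_left (abs_nonneg _))

end Differentiation

namespace Data

variable {n : ℕ} {P : Data n}

/-- The pairing `∫ |g|^{p-2} g · v + ∫ η |g|^{q-2} g · v` of the double phase operator, as a
function of the gradients. -/
noncomputable def gradPairing (P : Data n)
    (g v : EuclideanSpace ℝ (Fin n) → EuclideanSpace ℝ (Fin n)) : ℝ :=
  (∫ x, ‖g x‖ ^ (P.p - 2) * inner ℝ (g x) (v x) ∂P.μ)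
    + ∫ x, ‖g x‖ ^ (P.q - 2) * inner ℝ (g x) (v x) ∂P.μη

/-- The derivative of the nonsingular part of `J` at `y` (with gradients `g`) in the direction `d`
(with gradients `v`). -/
noncomputable def regularDeriv (P : Data n) (lam : ℝ)
    (y : (EuclideanSpace ℝ (Fin n) → ℝ) × (EuclideanSpace ℝ (Fin n) → ℝ))
    (g : (EuclideanSpace ℝ (Fin n) → EuclideanSpace ℝ (Fin n)) ×
      (EuclideanSpace ℝ (Fin n) → EuclideanSpace ℝ (Fin n)))
    (d : (EuclideanSpace ℝ (Fin n) → ℝ) × (EuclideanSpace ℝ (Fin n) → ℝ))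
    (v : (EuclideanSpace ℝ (Fin n) → EuclideanSpace ℝ (Fin n)) ×
      (EuclideanSpace ℝ (Fin n) → EuclideanSpace ℝ (Fin n))) : ℝ :=
  P.gradPairing g.1 v.1 + P.gradPairing g.2 v.2
    - lam * ∫ x, couplingDeriv (P.κ₁ + 1) (P.κ₂ + 1) (y.1 x) (y.2 x) (d.1 x) (d.2 x) ∂P.μ

lemma gradPairing_neg (g v : EuclideanSpace ℝ (Fin n) → EuclideanSpace ℝ (Fin n)) :
    P.gradPairing g (-v) = -P.gradPairing g v := by
  simp only [gradPairing, Pi.neg_apply, inner_neg_right, mul_neg, integral_neg]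
  ring

lemma regularDeriv_neg (lam : ℝ) (y g d v) :
    P.regularDeriv lam y g (-d) (-v) = -P.regularDeriv lam y g d v := by
  have : ∀ x, couplingDeriv (P.κ₁ + 1) (P.κ₂ + 1) (y.1 x) (y.2 x) ((-d).1 x) ((-d).2 x)
      = -couplingDeriv (P.κ₁ + 1) (P.κ₂ + 1) (y.1 x) (y.2 x) (d.1 x) (d.2 x) := fun x => by
    simp only [couplingDeriv, Prod.fst_neg, Prod.snd_neg, Pi.neg_apply]; ring
  simp only [regularDeriv, this, integral_neg]
  simp only [Prod.fst_neg, Prod.snd_neg, gradPairing_neg]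
  ring

lemma tendsto_slope_of_hasDerivAt {f : ℝ → ℝ} {f' : ℝ} (h : HasDerivAt f f' 0) {s : ℕ → ℝ}
    (hs0 : ∀ j, 0 < s j) (hs : Tendsto s atTop (𝓝 0)) :
    Tendsto (fun j => (f (s j) - f 0) / s j) atTop (𝓝 f') := by
  have h1 : Tendsto s atTop (𝓝[≠] 0) :=
    tendsto_nhdsWithin_iff.2 ⟨hs, Eventually.of_forall fun j => (hs0 j).ne'⟩
  refine ((hasDerivAt_iff_tendsto_slope.1 h).comp h1).congr fun j => ?_
  simp [slope_def_field]

namespace Admissible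

variable (hP : P.Admissible)
include hP

variable {y d : (EuclideanSpace ℝ (Fin n) → ℝ) × (EuclideanSpace ℝ (Fin n) → ℝ)}
  {g v : (EuclideanSpace ℝ (Fin n) → EuclideanSpace ℝ (Fin n)) ×
      (EuclideanSpace ℝ (Fin n) → EuclideanSpace ℝ (Fin n))}

lemma hasDerivAt_sumP (hy : P.IsPair y g) (hd : P.IsPair d v) :
    HasDerivAt (fun s : ℝ => P.sumP (g + s • v))
      (P.p * ((∫ x, ‖g.1 x‖ ^ (P.p - 2) * inner ℝ (g.1 x) (v.1 x) ∂P.μ)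
        + ∫ x, ‖g.2 x‖ ^ (P.p - 2) * inner ℝ (g.2 x) (v.2 x) ∂P.μ)) 0 := by
  rw [mul_add]
  exact (hasDerivAt_integral_norm_add_smul_rpow hP.exps.p_gt (hy.1.memH hP).1 (hd.1.memH hP).1).add
    (hasDerivAt_integral_norm_add_smul_rpow hP.exps.p_gt (hy.2.memH hP).1 (hd.2.memH hP).1)

lemma hasDerivAt_sumQ (hy : P.IsPair y g) (hd : P.IsPair d v) :
    HasDerivAt (fun s : ℝ => P.sumQ (g + s • v))
      (P.q * ((∫ x, ‖g.1 x‖ ^ (P.q - 2) * inner ℝ (g.1 x) (v.1 x) ∂P.μη)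
        + ∫ x, ‖g.2 x‖ ^ (P.q - 2) * inner ℝ (g.2 x) (v.2 x) ∂P.μη)) 0 := by
  have hq : 1 < P.q := hP.exps.p_gt.trans hP.exps.p_lt
  rw [mul_add]
  exact (hasDerivAt_integral_norm_add_smul_rpow hq (hy.1.memH hP).2 (hd.1.memH hP).2).add
    (hasDerivAt_integral_norm_add_smul_rpow hq (hy.2.memH hP).2 (hd.2.memH hP).2)

lemma hasDerivAt_coupling (hy : P.IsPair y g) (hd : P.IsPair d v) :
    HasDerivAt (fun s : ℝ => P.coupling (y + s • d).1 (y + s • d).2)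
      (∫ x, couplingDeriv (P.κ₁ + 1) (P.κ₂ + 1) (y.1 x) (y.2 x) (d.1 x) (d.2 x) ∂P.μ) 0 :=
  (integral_couplingDeriv (by linarith [hP.κ₁_pos]) (by linarith [hP.κ₂_pos])
    (hP.memLp_deg hy.1) (hP.memLp_deg hy.2) (hP.memLp_deg hd.1) (hP.memLp_deg hd.2)).2

/-- Only continuity of the singular term is available at this point; its difference quotients may
blow up where `y` vanishes. -/
lemma tendsto_sumS_add_smul (hy : P.IsPair y g) (hd : P.IsPair d v) {s : ℕ → ℝ}
    (hs : Tendsto s atTop (𝓝 0)) :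
    Tendsto (fun j => P.sumS (y + s j • d)) atTop (𝓝 (P.sumS y)) := by
  have key : ∀ a u h : EuclideanSpace ℝ (Fin n) → ℝ, MemLp a ⊤ P.μ → Integrable u P.μ →
      Integrable h P.μ →
      Tendsto (fun j => P.singular a (u + s j • h)) atTop (𝓝 (P.singular a u)) := by
    intro a u h ha hu hh
    refine hP.tendsto_singular ha (fun j => hu.add (hh.smul (s j))) hu ?_
    have e : ∀ j, eLpNorm (fun x => u x - (u + s j • h) x) 1 P.μ
        = ‖s j‖ₑ * eLpNorm h 1 P.μ := fun j => by
      rw [← eLpNorm_const_smul, ← eLpNorm_neg]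
      congr 1; ext x; simp
    simp_rw [e]
    have h1 : Tendsto (fun j => ‖s j‖ₑ) atTop (𝓝 0) := by
      have := (continuous_enorm.tendsto (0 : ℝ)).comp hs
      rwa [enorm_zero] at this
    have h2 := ENNReal.Tendsto.mul_const h1
      (Or.inr (memLp_one_iff_integrable.2 hh).2.ne)
    rwa [zero_mul] at h2
  exact (key _ _ _ hP.a₁_memLp hy.1.integrable hd.1.integrable).add
    (key _ _ _ hP.a₂_memLp hy.2.integrable hd.2.integrable)

/-- The one-sided Euler–Lagrange inequality at a minimizer `y` of `J` over `N⁻`. For small `s > 0`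
some dilation `t(y + sd)` with `t` close to `1` lies in `N⁻`, and
`J(ty) ≤ J(y) ≤ J(t(y + sd))` since the fibering map of `y` is maximal at `1`. -/
lemma exists_seq_sumS_le {lam : ℝ} (hy : P.IsPair y g) (hm : P.PairMinus lam y g)
    (hmin : ∀ z G, P.IsPair z G → P.PairMinus lam z G → P.J lam y ≤ P.J lam z)
    (hmax : ∀ t : ℝ, 0 < t → P.J lam (t • y) ≤ P.J lam y) (hd : P.IsPair d v) :
    ∃ s e : ℕ → ℝ, (∀ j, 0 < s j) ∧ Tendsto s atTop (𝓝 0) ∧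
      Tendsto e atTop (𝓝 (P.regularDeriv lam y g d v)) ∧
      ∀ j, P.sumS (y + s j • d) - P.sumS y ≤ (1 - P.ν) * (s j * e j) := by
  have hν := hP.one_sub_ν_pos
  have hp := hP.p_pos
  have hq : 0 < P.q := hp.trans hP.exps.p_lt
  set s₀ : ℕ → ℝ := fun j => 1 / ((j : ℝ) + 1) with hs₀
  have hs₀lim : Tendsto s₀ atTop (𝓝 0) := tendsto_one_div_add_atTop_nhds_zero_nat
  have dA := hP.hasDerivAt_sumP hy hd
  have dB := hP.hasDerivAt_sumQ hy hd
  have dD := hP.hasDerivAt_coupling hy hd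
  have cA := dA.continuousAt.tendsto.comp hs₀lim
  have cB := dB.continuousAt.tendsto.comp hs₀lim
  have cD := dD.continuousAt.tendsto.comp hs₀lim
  have cC := hP.tendsto_sumS_add_smul hy hd hs₀lim
  simp only [zero_smul, add_zero] at cA cB cD
  have hev : ∀ i : ℕ, ∀ᶠ j in atTop, ∃ t : ℝ,
      t ∈ Ioo (1 - 1 / ((i : ℝ) + 2)) (1 + 1 / ((i : ℝ) + 2)) ∧
      P.PairMinus lam (t • (y + s₀ j • d)) (t • (g + s₀ j • v)) := fun i => by
    have hi : 0 < 1 / ((i : ℝ) + 2) := by positivity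
    have hi1 : 1 / ((i : ℝ) + 2) < 1 := by
      rw [div_lt_one (by positivity)]
      have : (0 : ℝ) ≤ i := Nat.cast_nonneg i
      linarith
    filter_upwards [FibMinus.exists_scale_of_tendsto hm cA cB cC cD hi hi1] with j hj
    obtain ⟨t, ht, hf⟩ := hj
    exact ⟨t, ht, (pairMinus_smul_iff (by linarith [ht.1])).2 hf⟩
  obtain ⟨φ, hφ, hφt⟩ := extraction_forall_of_eventually hev
  choose t ht htm using hφt
  have ht0 : ∀ j, 0 < t j := fun j => by
    have h1 := (ht j).1
    have : 1 / ((j : ℝ) + 2) ≤ 1 := by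
      rw [div_le_one (by positivity)]
      have : (0 : ℝ) ≤ j := Nat.cast_nonneg j
      linarith
    linarith
  have htlim : Tendsto t atTop (𝓝 1) := by
    have h0 : Tendsto (fun j : ℕ => 1 / ((j : ℝ) + 2)) atTop (𝓝 0) :=
      tendsto_const_nhds.div_atTop (tendsto_atTop_add_const_right _ _ tendsto_natCast_atTop_atTop)
    have h1 := (tendsto_const_nhds (x := (1 : ℝ))).sub h0
    have h2 := (tendsto_const_nhds (x := (1 : ℝ))).add h0
    rw [sub_zero] at h1
    rw [add_zero] at h2
    exact tendsto_of_tendsto_of_tendsto_of_le_of_le h1 h2 (fun j => (ht j).1.le)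
      fun j => (ht j).2.le
  set s : ℕ → ℝ := fun j => s₀ (φ j) with hs
  have hslim : Tendsto s atTop (𝓝 0) := hs₀lim.comp hφ.tendsto_atTop
  have hspos : ∀ j, 0 < s j := fun j => by positivity
  have qA := tendsto_slope_of_hasDerivAt dA hspos hslim
  have qB := tendsto_slope_of_hasDerivAt dB hspos hslim
  have qD := tendsto_slope_of_hasDerivAt dD hspos hslim
  simp only [zero_smul, add_zero] at qA qB qD
  have tr : ∀ r : ℝ, Tendsto (fun j => t j ^ r) atTop (𝓝 1) := fun r => by
    simpa using htlim.rpow_const (p := r) (Or.inl one_ne_zero)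
  refine ⟨s, fun j => t j ^ (P.ν - 1) * (t j ^ P.p / P.p * ((P.sumP (g + s j • v) - P.sumP g) / s j)
    + t j ^ P.q / P.q * ((P.sumQ (g + s j • v) - P.sumQ g) / s j)
    - lam * t j ^ P.deg * ((P.coupling (y + s j • d).1 (y + s j • d).2 - P.coupling y.1 y.2) / s j)),
    hspos, hslim, ?_, fun j => ?_⟩
  · have := (tr (P.ν - 1)).mul ((((((tr P.p).div_const P.p).mul qA).add
      (((tr P.q).div_const P.q).mul qB))).sub (((tr P.deg).const_mul lam).mul qD))
    convert this using 2
    have e (r X : ℝ) (hr : r ≠ 0) : 1 / r * (r * X) = X := by field_simp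
    rw [e _ _ hp.ne', e _ _ hq.ne', regularDeriv, gradPairing, gradPairing]
    ring
  · have h1 := hmin _ _ ((hy.add hP (hd.smul (s j))).smul (t j)) (htm j)
    have h2 := (hmax (t j) (ht0 j)).trans h1
    rw [hP.J_eq (hy.smul _), pairFib_smul (ht0 j), hP.J_eq ((hy.add hP (hd.smul (s j))).smul (t j)),
      pairFib_smul (ht0 j)] at h2
    simp only [pairFib, fib] at h2
    have h3 : t j ^ (1 - P.ν) / (1 - P.ν) * (P.sumS (y + s j • d) - P.sumS y)
        ≤ t j ^ P.p / P.p * (P.sumP (g + s j • v) - P.sumP g)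
          + t j ^ P.q / P.q * (P.sumQ (g + s j • v) - P.sumQ g)
          - lam * t j ^ P.deg *
            (P.coupling (y + s j • d).1 (y + s j • d).2 - P.coupling y.1 y.2) := by
      linarith
    have h4 : 0 < (1 - P.ν) * t j ^ (P.ν - 1) := mul_pos hν (Real.rpow_pos_of_pos (ht0 j) _)
    have h5 := mul_le_mul_of_nonneg_left h3 h4.le
    have h6 : t j ^ (P.ν - 1) * t j ^ (1 - P.ν) = 1 := by
      rw [← Real.rpow_add (ht0 j)]; simp
    have h7 : (1 - P.ν) * t j ^ (P.ν - 1) *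
        (t j ^ (1 - P.ν) / (1 - P.ν) * (P.sumS (y + s j • d) - P.sumS y))
        = P.sumS (y + s j • d) - P.sumS y := by
      have : (1 - P.ν) * t j ^ (P.ν - 1) *
        (t j ^ (1 - P.ν) / (1 - P.ν) * (P.sumS (y + s j • d) - P.sumS y))
        = (t j ^ (P.ν - 1) * t j ^ (1 - P.ν)) * ((1 - P.ν) / (1 - P.ν)) *
          (P.sumS (y + s j • d) - P.sumS y) := by ring
      rw [this, h6, div_self hν.ne', one_mul, one_mul]
    rw [h7] at h5
    refine h5.trans (le_of_eq ?_)
    have hsj := (hspos j).ne'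
    field_simp

end Admissible

end Data

end DoublePhase

/-! ### Positivity and the weak formulation -/

namespace DoublePhase

lemma abs_rpow_sub_one_le {r t : ℝ} (hr : 0 < r) (hr1 : r < 1) (ht : 0 ≤ t) :
    |t ^ r - 1| ≤ |t - 1| := by
  rcases le_total t 1 with h | h
  · have h1 : t ≤ t ^ r := by
      simpa using Real.rpow_le_rpow_of_exponent_ge' ht h hr.le hr1.le
    have h2 : t ^ r ≤ 1 := Real.rpow_le_one ht h hr.le
    rw [abs_of_nonpos (by linarith), abs_of_nonpos (by linarith)]; linarith
  · have h1 : t ^ r ≤ t := by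
      simpa using Real.rpow_le_rpow_of_exponent_le h hr1.le
    have h2 : 1 ≤ t ^ r := Real.one_le_rpow h hr.le
    rw [abs_of_nonneg (by linarith), abs_of_nonneg (by linarith)]; linarith

/-- The bound that dominates the difference quotients of `|·| ^ r` at `y > 0`, also for increments
that change the sign of the argument. -/
lemma abs_abs_rpow_sub_rpow_le {r y d : ℝ} (hr : 0 < r) (hr1 : r < 1) (hy : 0 < y) :
    |(|y + d| ^ r - |y| ^ r)| ≤ y ^ (r - 1) * |d| := by
  have e1 : |y + d| = y * (|y + d| / y) := by field_simp
  have h1 := abs_rpow_sub_one_le hr hr1 (t := |y + d| / y) (by positivity)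
  have h2 : |(|y + d| / y - 1)| ≤ |d| / y := by
    rw [div_sub_one hy.ne', abs_div, abs_of_pos hy]
    refine div_le_div_of_nonneg_right ?_ hy.le
    have h := abs_abs_sub_abs_le (y + d) y
    rwa [abs_of_pos hy, add_sub_cancel_left] at h
  rw [e1, Real.mul_rpow hy.le (by positivity), abs_of_pos hy, ← mul_sub_one, abs_mul,
    abs_of_pos (Real.rpow_pos_of_pos hy r), Real.rpow_sub_one hy.ne']
  calc y ^ r * |(|y + d| / y) ^ r - 1| ≤ y ^ r * (|d| / y) := by
        gcongr; exact h1.trans h2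
    _ = y ^ r / y * |d| := by ring

lemma hasDerivAt_abs_add_mul_rpow {r y h : ℝ} (hy : 0 < y) :
    HasDerivAt (fun s : ℝ => |y + s * h| ^ r) (r * (y ^ (r - 1) * h)) 0 := by
  have h1 : HasDerivAt (fun s : ℝ => y + s * h) h 0 := by
    simpa using ((hasDerivAt_id (0 : ℝ)).mul_const h).const_add y
  have h2 : HasDerivAt (fun t : ℝ => |t| ^ r) (r * y ^ (r - 1)) (y + 0 * h) := by
    rw [zero_mul, add_zero]
    refine (Real.hasDerivAt_rpow_const (Or.inl hy.ne')).congr_of_eventuallyEq ?_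
    filter_upwards [lt_mem_nhds hy] with t ht
    rw [abs_of_pos ht]
  refine (h2.comp 0 h1).congr_deriv ?_
  ring

namespace Data

variable {n : ℕ} {P : Data n}

namespace Admissible

variable (hP : P.Admissible)
include hP

variable {a u h : EuclideanSpace ℝ (Fin n) → ℝ} {s e : ℕ → ℝ} {L : ℝ}

lemma integrable_singular_slope (ha : MemLp a ⊤ P.μ) (hu : Integrable u P.μ)
    (hh : Integrable h P.μ) (t : ℝ) :
    Integrable (fun x => (a x * |u x + t * h x| ^ (1 - P.ν) - a x * |u x| ^ (1 - P.ν)) / t) P.μ ∧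
    ∫ x, (a x * |u x + t * h x| ^ (1 - P.ν) - a x * |u x| ^ (1 - P.ν)) / t ∂P.μ
      = (P.singular a (u + t • h) - P.singular a u) / t := by
  have i1 : Integrable (fun x => a x * |u x + t * h x| ^ (1 - P.ν)) P.μ :=
    hP.integrable_singular ha (hu.add (hh.const_mul t))
  have i2 := hP.integrable_singular ha hu
  refine ⟨(i1.sub i2).div_const _, ?_⟩
  rw [integral_div, integral_sub i1 i2]
  rfl

/-- Nonnegative directions: the difference quotients of the singular term blow up where `u`
vanishes and `h` does not, so by Fatou's lemma a bound on them forces `u > 0` there and the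
integrability of the limit `a u^{-ν} h`. -/
lemma pos_and_integrable_of_singular_le (ha : MemLp a ⊤ P.μ) (ha0 : ∀ᵐ x ∂P.μ, 0 < a x)
    (hu : Integrable u P.μ) (hu0 : ∀ᵐ x ∂P.μ, 0 ≤ u x) (hh : Integrable h P.μ)
    (hh0 : ∀ᵐ x ∂P.μ, 0 ≤ h x) (hs0 : ∀ j, 0 < s j) (hs : Tendsto s atTop (𝓝 0))
    (he : Tendsto e atTop (𝓝 L))
    (hle : ∀ j, P.singular a (u + s j • h) - P.singular a u ≤ (1 - P.ν) * (s j * e j)) :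
    (∀ᵐ x ∂P.μ, 0 < h x → 0 < u x) ∧ Integrable (fun x => a x * u x ^ (-P.ν) * h x) P.μ := by
  have hν := hP.one_sub_ν_pos
  set F : ℕ → EuclideanSpace ℝ (Fin n) → ℝ := fun j x =>
    (a x * |u x + s j * h x| ^ (1 - P.ν) - a x * |u x| ^ (1 - P.ν)) / s j with hF
  have hFint : ∀ j, Integrable (F j) P.μ := fun j =>
    (hP.integrable_singular_slope ha hu hh (s j)).1
  have hF0 : ∀ j, 0 ≤ᵐ[P.μ] F j := fun j => by
    filter_upwards [ha0, hu0, hh0] with x hax hux hhx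
    refine div_nonneg (sub_nonneg.2 (mul_le_mul_of_nonneg_left ?_ hax.le)) (hs0 j).le
    refine Real.rpow_le_rpow (abs_nonneg _) ?_ hν.le
    have : 0 ≤ s j * h x := mul_nonneg (hs0 j).le hhx
    rw [abs_of_nonneg hux, abs_of_nonneg (by linarith)]; linarith
  have hFle : ∀ j, ∫⁻ x, ENNReal.ofReal (F j x) ∂P.μ ≤ ENNReal.ofReal ((1 - P.ν) * e j) := by
    intro j
    rw [← ofReal_integral_eq_lintegral_ofReal (hFint j) (hF0 j)]
    refine ENNReal.ofReal_le_ofReal ?_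
    have : ∫ x, F j x ∂P.μ = (P.singular a (u + s j • h) - P.singular a u) / s j :=
      (hP.integrable_singular_slope ha hu hh (s j)).2
    rw [this, div_le_iff₀ (hs0 j)]
    linarith [hle j]
  have hfatou : ∫⁻ x, liminf (fun j => ENNReal.ofReal (F j x)) atTop ∂P.μ < ⊤ := by
    refine (lintegral_liminf_le' fun j => (hFint j).1.aemeasurable.ennreal_ofReal).trans_lt ?_
    refine (liminf_le_liminf (Eventually.of_forall hFle)).trans_lt ?_
    have := (ENNReal.continuous_ofReal.tendsto _).comp (he.const_mul (1 - P.ν))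
    have h2 := this.liminf_eq
    simp only [Function.comp_def] at h2
    rw [h2]
    exact ENNReal.ofReal_lt_top
  have hmeas : AEMeasurable (fun x => liminf (fun j => ENNReal.ofReal (F j x)) atTop) P.μ := by
    simp_rw [liminf_eq_iSup_iInf_of_nat']
    exact AEMeasurable.iSup fun m => AEMeasurable.iInf fun j =>
      (hFint (j + m)).1.aemeasurable.ennreal_ofReal
  have hpos : ∀ᵐ x ∂P.μ, 0 < h x → 0 < u x := by
    filter_upwards [ae_lt_top' hmeas hfatou.ne, ha0, hu0] with x hx hax hux hhx
    refine hux.lt_of_ne' fun hu0 => ?_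
    -- where `u = 0` the quotient equals `a h ^ (1 - ν) s ^ (-ν)`
    have hlim : Tendsto (fun j => F j x) atTop atTop := by
      have hs' : Tendsto s atTop (𝓝[>] 0) :=
        tendsto_nhdsWithin_iff.2 ⟨hs, Eventually.of_forall hs0⟩
      have h1 : Tendsto (fun j => a x * h x ^ (1 - P.ν) * s j ^ (-P.ν)) atTop atTop :=
        ((tendsto_rpow_neg_nhdsGT_zero (by linarith [hP.exps.ν_pos])).comp hs').const_mul_atTop
          (mul_pos hax (Real.rpow_pos_of_pos hhx _))
      refine h1.congr fun j => ?_
      simp only [hF]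
      rw [hu0, zero_add, abs_zero, Real.zero_rpow hν.ne', mul_zero, sub_zero,
        abs_of_pos (mul_pos (hs0 j) hhx), Real.mul_rpow (hs0 j).le hhx.le,
        show -P.ν = 1 - P.ν - 1 by ring, Real.rpow_sub_one (hs0 j).ne']
      ring
    have h2 := (ENNReal.tendsto_ofReal_atTop.comp hlim).liminf_eq
    simp only [Function.comp_def] at h2
    rw [h2] at hx
    exact lt_irrefl _ hx
  refine ⟨hpos, ?_⟩
  have hm : AEStronglyMeasurable (fun x => a x * u x ^ (-P.ν) * h x) P.μ :=
    (ha.1.mul (hu.1.aemeasurable.pow_const _).aestronglyMeasurable).mul hh.1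
  have h1 : ∀ᵐ x ∂P.μ, ‖(1 - P.ν) * (a x * u x ^ (-P.ν) * h x)‖ₑ
      ≤ liminf (fun j => ENNReal.ofReal (F j x)) atTop := by
    filter_upwards [ha0, hu0, hh0, hpos] with x hax hux hhx hx
    rcases eq_or_lt_of_le hhx with h0 | h0
    · rw [← h0]; simp
    have hux := hx h0
    have hd := (hasDerivAt_abs_add_mul_rpow (r := 1 - P.ν) (h := h x) hux).const_mul (a x)
    have h2 := tendsto_slope_of_hasDerivAt hd hs0 hs
    simp only [zero_mul, add_zero] at h2
    have h3 := ((ENNReal.continuous_ofReal.tendsto _).comp h2).liminf_eq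
    simp only [Function.comp_def] at h3
    simp only [hF]
    rw [h3, ← ofReal_norm, Real.norm_of_nonneg (by positivity)]
    refine le_of_eq ?_
    rw [show (1 - P.ν - 1) = -P.ν by ring]
    congr 1; ring
  have h2 : Integrable (fun x => (1 - P.ν) * (a x * u x ^ (-P.ν) * h x)) P.μ :=
    ⟨hm.const_mul _, (lintegral_mono_ae h1).trans_lt hfatou⟩
  exact (integrable_const_mul_iff (isUnit_iff_ne_zero.2 hν.ne') _).1 h2

/-- Once `a u^{-ν} h` is integrable, the singular term is differentiable in direction `h`. -/
lemma tendsto_singular_slope (ha : MemLp a ⊤ P.μ) (ha0 : ∀ᵐ x ∂P.μ, 0 < a x)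
    (hu : Integrable u P.μ) (hu0 : ∀ᵐ x ∂P.μ, 0 < u x) (hh : Integrable h P.μ)
    (hi : Integrable (fun x => a x * u x ^ (-P.ν) * h x) P.μ)
    (hs0 : ∀ j, 0 < s j) (hs : Tendsto s atTop (𝓝 0)) :
    Tendsto (fun j => (P.singular a (u + s j • h) - P.singular a u) / s j) atTop
      (𝓝 ((1 - P.ν) * ∫ x, a x * u x ^ (-P.ν) * h x ∂P.μ)) := by
  have hν := hP.one_sub_ν_pos
  set F : ℕ → EuclideanSpace ℝ (Fin n) → ℝ := fun j x =>
    (a x * |u x + s j * h x| ^ (1 - P.ν) - a x * |u x| ^ (1 - P.ν)) / s j with hF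
  have hFint : ∀ j, Integrable (F j) P.μ := fun j =>
    (hP.integrable_singular_slope ha hu hh (s j)).1
  have e : ∀ j, (P.singular a (u + s j • h) - P.singular a u) / s j = ∫ x, F j x ∂P.μ := fun j =>
    (hP.integrable_singular_slope ha hu hh (s j)).2.symm
  simp_rw [e]
  rw [← integral_const_mul]
  refine tendsto_integral_of_dominated_convergence (fun x => ‖a x * u x ^ (-P.ν) * h x‖)
    (fun j => (hFint j).1) hi.norm (fun j => ?_) ?_
  · filter_upwards [ha0, hu0] with x hax hux
    have h1 := abs_abs_rpow_sub_rpow_le (d := s j * h x) hν (by linarith [hP.exps.ν_pos]) hux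
    rw [show 1 - P.ν - 1 = -P.ν by ring, abs_mul, abs_of_pos (hs0 j)] at h1
    simp only [hF]
    rw [← mul_sub, norm_div, norm_mul, norm_mul, norm_mul, Real.norm_of_nonneg hax.le,
      Real.norm_of_nonneg (hs0 j).le, Real.norm_of_nonneg (Real.rpow_nonneg hux.le _),
      div_le_iff₀ (hs0 j), Real.norm_eq_abs, Real.norm_eq_abs]
    have := mul_le_mul_of_nonneg_left h1 hax.le
    linarith
  · filter_upwards [hu0] with x hux
    have hd := (hasDerivAt_abs_add_mul_rpow (r := 1 - P.ν) (h := h x) hux).const_mul (a x)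
    have h2 := tendsto_slope_of_hasDerivAt hd hs0 hs
    simp only [zero_mul, add_zero] at h2
    rw [show (1 - P.ν - 1) = -P.ν by ring] at h2
    convert h2 using 2
    ring

omit hP in
/-- Every point of `Ω` has a neighbourhood on which some test function `φ ≥ 0` is positive. -/
lemma ae_pos_of_forall_test (hΩ : IsOpen P.Ω)
    (H : ∀ φ, IsTestFunction P.Ω φ → (∀ x, 0 ≤ φ x) → ∀ᵐ x ∂P.μ, 0 < φ x → 0 < u x) :
    ∀ᵐ x ∂P.μ, 0 < u x := by
  rw [μ, ae_restrict_iff' hΩ.measurableSet, ae_iff]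
  refine measure_null_of_locally_null _ fun x hx => ?_
  have hxΩ : x ∈ P.Ω := by
    by_contra hcon
    exact hx fun h => absurd h hcon
  obtain ⟨f, hf1, hf2, hf3, hf4, hf5⟩ :=
    exists_contDiff_tsupport_subset (n := (⊤ : ℕ∞)) (hΩ.mem_nhds hxΩ)
  have h1 := H f ⟨hf3, hf2, hf1⟩ fun z => (hf4 (mem_range_self z)).1
  rw [μ, ae_restrict_iff' hΩ.measurableSet, ae_iff] at h1
  have hU : {z | 0 < f z} ∈ 𝓝 x :=
    (isOpen_lt continuous_const hf3.continuous).mem_nhds (by simp [hf5])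
  refine ⟨{z | 0 < f z} ∩ {z | ¬(z ∈ P.Ω → 0 < u z)},
    inter_mem (mem_nhdsWithin_of_mem_nhds hU) self_mem_nhdsWithin, ?_⟩
  refine measure_mono_null (fun z hz => ?_) h1
  intro hcon
  exact hz.2 fun hzΩ => hcon hzΩ hz.1

/-- A nonnegative minimizer over `N⁻` is a positive weak solution. -/
lemma isPositiveWeakSolution {lam : ℝ} (hlam : 0 < lam)
    (hmax : ∀ y g, P.IsPair y g → P.PairMinus lam y g → 0 < P.J lam y ∧
      ∀ t : ℝ, 0 < t → P.J lam (t • y) ≤ P.J lam y)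
    {y : (EuclideanSpace ℝ (Fin n) → ℝ) × (EuclideanSpace ℝ (Fin n) → ℝ)}
    (hy : P.IsNonnegMinimizer lam y) : P.IsPositiveWeakSolution lam y := by
  obtain ⟨hmem, hmin, hy1, hy2⟩ := hy
  have hν := hP.one_sub_ν_pos
  have hyp := hP.isPair hmem.1.1 hmem.1.2.1
  have hm := (hP.mem_nehariMinus_iff hlam hyp).1 hmem
  set g := (weakGrad P.Ω y.1, weakGrad P.Ω y.2) with hg
  have hEL : ∀ d v, P.IsPair d v → ∃ s e : ℕ → ℝ, (∀ j, 0 < s j) ∧ Tendsto s atTop (𝓝 0) ∧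
      Tendsto e atTop (𝓝 (P.regularDeriv lam y g d v)) ∧
      ∀ j, P.sumS (y + s j • d) - P.sumS y ≤ (1 - P.ν) * (s j * e j) := fun d v hd =>
    hP.exists_seq_sumS_le hyp hm
      (fun z G hz hzm => hmin ((hP.mem_nehariMinus_iff hlam hz).2 hzm))
      (hmax y g hyp hm).2 hd
  have h00 : P.IsW0 0 0 := by
    have := hyp.1.const_mul 0
    simpa [Pi.zero_def] using this
  have key₁ : ∀ h v, P.IsW0 h v → (∀ᵐ x ∂P.μ, 0 ≤ h x) → (∀ᵐ x ∂P.μ, 0 < h x → 0 < y.1 x) ∧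
      Integrable (fun x => P.a₁ x * y.1 x ^ (-P.ν) * h x) P.μ := fun h v hh hh0 => by
    obtain ⟨s, e, hs0, hs, he, hle⟩ := hEL (h, 0) (v, 0) ⟨hh, h00⟩
    refine hP.pos_and_integrable_of_singular_le hP.a₁_memLp hP.a₁_pos hyp.1.integrable hy1
      hh.integrable hh0 hs0 hs he fun j => ?_
    simpa [sumS] using hle j
  have key₂ : ∀ h v, P.IsW0 h v → (∀ᵐ x ∂P.μ, 0 ≤ h x) → (∀ᵐ x ∂P.μ, 0 < h x → 0 < y.2 x) ∧
      Integrable (fun x => P.a₂ x * y.2 x ^ (-P.ν) * h x) P.μ := fun h v hh hh0 => by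
    obtain ⟨s, e, hs0, hs, he, hle⟩ := hEL (0, h) (0, v) ⟨h00, hh⟩
    refine hP.pos_and_integrable_of_singular_le hP.a₂_memLp hP.a₂_pos hyp.2.integrable hy2
      hh.integrable hh0 hs0 hs he fun j => ?_
    simpa [sumS] using hle j
  have pos₁ : ∀ᵐ x ∂P.μ, 0 < y.1 x := ae_pos_of_forall_test hP.isOpen fun φ hφ h0 =>
    (key₁ φ _ (IsW0.of_test hφ) (Eventually.of_forall h0)).1
  have pos₂ : ∀ᵐ x ∂P.μ, 0 < y.2 x := ae_pos_of_forall_test hP.isOpen fun φ hφ h0 =>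
    (key₂ φ _ (IsW0.of_test hφ) (Eventually.of_forall h0)).1
  have habs : ∀ a u h : EuclideanSpace ℝ (Fin n) → ℝ, AEStronglyMeasurable a P.μ →
      AEStronglyMeasurable u P.μ → AEStronglyMeasurable h P.μ →
      Integrable (fun x => a x * u x ^ (-P.ν) * |h x|) P.μ →
      Integrable (fun x => a x * u x ^ (-P.ν) * h x) P.μ := fun a u h ha hu hh hi => by
    refine hi.mono ((ha.mul (hu.aemeasurable.pow_const _).aestronglyMeasurable).mul hh)
      (Eventually.of_forall fun x => ?_)
    simp [norm_mul]
  have int₁ : ∀ h v, P.IsW0 h v → Integrable (fun x => P.a₁ x * y.1 x ^ (-P.ν) * h x) P.μ :=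
    fun h v hh => by
      obtain ⟨w, hw, -⟩ := hh.abs hP
      exact habs _ _ _ hP.a₁_memLp.1 hyp.1.meas hh.meas
        (key₁ _ w hw (Eventually.of_forall fun x => abs_nonneg _)).2
  have int₂ : ∀ h v, P.IsW0 h v → Integrable (fun x => P.a₂ x * y.2 x ^ (-P.ν) * h x) P.μ :=
    fun h v hh => by
      obtain ⟨w, hw, -⟩ := hh.abs hP
      exact habs _ _ _ hP.a₂_memLp.1 hyp.2.meas hh.meas
        (key₂ _ w hw (Eventually.of_forall fun x => abs_nonneg _)).2
  -- the inequality in arbitrary directions, now that dominated convergence applies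
  have hle : ∀ d v, P.IsPair d v → (∫ x, P.a₁ x * y.1 x ^ (-P.ν) * d.1 x ∂P.μ)
      + ∫ x, P.a₂ x * y.2 x ^ (-P.ν) * d.2 x ∂P.μ ≤ P.regularDeriv lam y g d v := fun d v hd => by
    obtain ⟨s, e, hs0, hs, he, hle⟩ := hEL d v hd
    have t1 := hP.tendsto_singular_slope hP.a₁_memLp hP.a₁_pos hyp.1.integrable pos₁
      hd.1.integrable (int₁ _ _ hd.1) hs0 hs
    have t2 := hP.tendsto_singular_slope hP.a₂_memLp hP.a₂_pos hyp.2.integrable pos₂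
      hd.2.integrable (int₂ _ _ hd.2) hs0 hs
    have h3 := le_of_tendsto_of_tendsto' (t1.add t2) (he.const_mul (1 - P.ν)) fun j => by
      rw [← add_div, div_le_iff₀ (hs0 j)]
      have := hle j
      simp only [sumS, Prod.fst_add, Prod.snd_add, Prod.smul_fst, Prod.smul_snd] at this
      linarith
    rw [← mul_add] at h3
    exact le_of_mul_le_mul_left h3 hν
  refine ⟨hmem.1.1, hmem.1.2.1, pos₁, pos₂, fun h w hh hw => ?_⟩
  have hhw : P.IsPair (h, w) (weakGrad P.Ω h, weakGrad P.Ω w) := ⟨hh.isW0 hP, hw.isW0 hP⟩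
  refine ⟨int₁ _ _ hhw.1, int₂ _ _ hhw.2, ?_⟩
  have heq : (∫ x, P.a₁ x * y.1 x ^ (-P.ν) * h x ∂P.μ) + ∫ x, P.a₂ x * y.2 x ^ (-P.ν) * w x ∂P.μ
      = P.regularDeriv lam y g (h, w) (weakGrad P.Ω h, weakGrad P.Ω w) := by
    refine le_antisymm (hle _ _ hhw) ?_
    have hneg : P.IsPair (-(h, w)) (-(weakGrad P.Ω h, weakGrad P.Ω w)) := by
      have := hhw.smul (-1)
      rwa [neg_one_smul, neg_one_smul] at this
    have h1 := hle _ _ hneg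
    rw [regularDeriv_neg] at h1
    simp only [Prod.fst_neg, Prod.snd_neg, Pi.neg_apply, mul_neg, integral_neg] at h1
    linarith
  have hop : ∀ u h : EuclideanSpace ℝ (Fin n) → ℝ,
      P.opPairing u h = P.gradPairing (weakGrad P.Ω u) (weakGrad P.Ω h) := fun u h => by
    unfold opPairing gradPairing
    rw [hP.integral_μη]
    simp only [mul_assoc]
  have hκ₁ := hP.κ₁_pos
  have hκ₂ := hP.κ₂_pos
  have m1 := hP.memLp_deg hyp.1
  have m2 := hP.memLp_deg hyp.2
  have m3 := hP.memLp_deg hhw.1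
  have m4 := hP.memLp_deg hhw.2
  have m0 := hP.memLp_deg h00
  have c1 := (integral_couplingDeriv (by linarith : 1 < P.κ₁ + 1) (by linarith : 1 < P.κ₂ + 1)
    m1 m2 m3 m0).1
  have c2 := (integral_couplingDeriv (by linarith : 1 < P.κ₁ + 1) (by linarith : 1 < P.κ₂ + 1)
    m1 m2 m0 m4).1
  have hpow : ∀ (κ t : ℝ), 0 < κ → 0 < t → |t| ^ (κ + 1 - 2) * t = |t| ^ κ := fun κ t hκ ht => by
    rw [abs_of_pos ht, rpow_sub_two_mul_self (by linarith) ht.le]; ring_nf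
  have d1 : (∫ x, couplingDeriv (P.κ₁ + 1) (P.κ₂ + 1) (y.1 x) (y.2 x) (h x) 0 ∂P.μ)
      = (P.κ₁ + 1) * ∫ x, |y.1 x| ^ P.κ₁ * |y.2 x| ^ (P.κ₂ + 1) * h x ∂P.μ := by
    rw [← integral_const_mul]
    refine integral_congr_ae ?_
    filter_upwards [pos₁] with x hx
    rw [← hpow _ _ hκ₁ hx, couplingDeriv]; ring
  have d2 : (∫ x, couplingDeriv (P.κ₁ + 1) (P.κ₂ + 1) (y.1 x) (y.2 x) 0 (w x) ∂P.μ)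
      = (P.κ₂ + 1) * ∫ x, |y.1 x| ^ (P.κ₁ + 1) * |y.2 x| ^ P.κ₂ * w x ∂P.μ := by
    rw [← integral_const_mul]
    refine integral_congr_ae ?_
    filter_upwards [pos₂] with x hx
    rw [← hpow _ _ hκ₂ hx, couplingDeriv]; ring
  have d3 : (∫ x, couplingDeriv (P.κ₁ + 1) (P.κ₂ + 1) (y.1 x) (y.2 x) (h x) (w x) ∂P.μ)
      = (∫ x, couplingDeriv (P.κ₁ + 1) (P.κ₂ + 1) (y.1 x) (y.2 x) (h x) 0 ∂P.μ)
        + ∫ x, couplingDeriv (P.κ₁ + 1) (P.κ₂ + 1) (y.1 x) (y.2 x) 0 (w x) ∂P.μ := by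
    refine Eq.trans ?_ (integral_add c1 c2)
    refine integral_congr_ae (Eventually.of_forall fun x => ?_)
    simp only [couplingDeriv]; ring
  unfold regularDeriv at heq
  simp only at heq
  rw [d3, d1, d2] at heq
  rw [hop, hop]
  simp only [hg] at heq
  linarith

end Admissible

end Data

end DoublePhase

theorem theorem3p13 (n : ℕ) (hn : 2 ≤ n) (P : DoublePhase.Data n)
    (hΩ_open : IsOpen P.Ω) (hΩ_conn : IsConnected P.Ω) (hΩ_bdd : Bornology.IsBounded P.Ω)
    (hΩ_lip : DoublePhase.HasLipschitzBoundary P.Ω)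
    (hν0 : 0 < P.ν) (hν1 : P.ν < 1)
    (hp : 1 < P.p) (hpn : P.p < n) (hpq : P.p < P.q)
    (hκ₁ : P.q < P.κ₁ + 1) (hκ₂ : P.q < P.κ₂ + 1)
    (hκ : P.κ₁ + P.κ₂ + 2 < DoublePhase.critExp n P.p)
    (hη : MemLp P.η ⊤ (volume.restrict P.Ω)) (hη0 : ∀ᵐ x ∂(volume.restrict P.Ω), 0 ≤ P.η x)
    (ha₁ : MemLp P.a₁ ⊤ (volume.restrict P.Ω)) (ha₁0 : ∀ᵐ x ∂(volume.restrict P.Ω), 0 < P.a₁ x)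
    (ha₂ : MemLp P.a₂ ⊤ (volume.restrict P.Ω)) (ha₂0 : ∀ᵐ x ∂(volume.restrict P.Ω), 0 < P.a₂ x) :
    ∃ lamStar : ℝ, 0 < lamStar ∧ ∀ lam : ℝ, 0 < lam → lam < lamStar →
      (∃ y, P.IsNonnegMinimizer lam y) ∧
      ∀ y, P.IsNonnegMinimizer lam y → P.IsPositiveWeakSolution lam y ∧ 0 ≤ P.J lam y := by
  have hdeg : P.deg = P.κ₁ + P.κ₂ + 2 := by unfold DoublePhase.Data.deg; ring
  have hP : P.Admissible :=
    { isOpen := hΩ_open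
      nonempty := hΩ_conn.nonempty
      bounded := hΩ_bdd
      exps := ⟨hν0, hν1, hp, hpq, by rw [hdeg]; linarith⟩
      p_lt_n := hpn
      q_lt₁ := hκ₁
      q_lt₂ := hκ₂
      crit := by rw [hdeg]; exact hκ
      η_memLp := hη
      η_nonneg := hη0
      a₁_memLp := ha₁
      a₁_pos := ha₁0
      a₂_memLp := ha₂
      a₂_pos := ha₂0 }
  obtain ⟨lamStar, hpos, h⟩ := hP.exists_threshold
  refine ⟨lamStar, hpos, fun lam hlam hlt => ?_⟩
  obtain ⟨hmax, hscale⟩ := h lam hlam hlt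
  refine ⟨hP.exists_minimizer hlam hmax hscale, fun y hy =>
    ⟨hP.isPositiveWeakSolution hlam hmax hy, ?_⟩⟩
  have hyp := hP.isPair hy.1.1.1 hy.1.1.2.1
  exact (hmax y _ hyp ((hP.mem_nehariMinus_iff hlam hyp).1 hy.1)).1.le
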